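/- \textbf{Machine model.} A word RAM with words of $w$ bits has a fixed number $k$ of one-word registers, a working memory of words addressed by $0,1,2,\ldots$ (registers and memory are initially zero, except that one register holds $n$), the unit-cost word operations $+,-,\cdot$, integer division and remainder, bitwise and/or/xor and shifts (all modulo $2^w$), comparisons, loads and stores, read-only access to its input through constant-time access functions, and a write-only stream of output events. Programs are built from instructions by composition, conditionals and loops; the running time is the number of executed instructions and evaluated tests, and the working memory used is $(k+u)\,w$ bits, where $u$ is the least number such that all memory addresses read or written are smaller than $u$. \textbf{Input.} A graph has vertex set $\{0,\ldots,n-1\}$ for some $n\ge 1$ and no multiple edges; undirected graphs have no loops. An undirected graph is given by adjacency arrays, which list the neighbors of each vertex once each in an arbitrary order: $\mathrm{deg}(u)$ is the degree of $u$, $\mathrm{head}(u,i)$ is the neighbor of $u$ at position $i$ ($0\le i<\mathrm{deg}(u)$), and $\mathrm{mate}(u,i)$ is the position $j$ of $u$ in the array of $v=\mathrm{head}(u,i)$, so that $\mathrm{head}(v,j)=u$. A directed graph is given by two such families of arrays, of outneighbors and of inneighbors, with access to the lengths and entries of both; for an edge $(u,v)$, the function $\mathrm{mate}$ maps the position of $v$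 in the out-array of $u$ to the position of $u$ in the in-array of $v$, and vice versa. \textbf{Depth-first search (DFS).} Initially no vertex is discovered, no edge is explored and the stack is empty. While the stack is empty and some vertex is undiscovered, some undiscovered vertex $v$ is chosen as a root: it is discovered and pushed, with the event $\mathrm{preprocess}(v)$. While the stack is nonempty, let $v$ be its top vertex. If some edge from $v$ to a (out)neighbor $w$ has not been explored with $v$ on top, one such edge is explored: if $w$ is undiscovered, the events are $\mathrm{explore\_tree\_edge}(v,w)$ and $\mathrm{preprocess}(w)$, and $w$ is discovered and pushed; otherwise the event is $\mathrm{handle\_back\_edge}(v,w)$. If no such edge is left, $v$ is popped, with the event $\mathrm{postprocess}(v)$, followed by $\mathrm{retreat\_tree\_edge}(u,v)$ if a vertex $u$ is now on top of the stack. The search ends when the stack is empty and all vertices are discovered. A program \emph{carries out a DFS} if it halts and its output is the complete sequence of events of some such search. \textbf{Theorem.} There are a program for undirected graphs and a program for directed graphs, and for each of them a positive integer $\kappa$ and a real constant $C$, such that for all $n\ge 1$ and $m\ge 0$, for every graph (undirected or directed, respectively) with $n$ vertices and $m$ edges and every representation of it by adjacency arrays as above, the program, run with word length $w=\kappa(\lfloor\log_2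 n\rfloor+1)$, carries out a DFS of the graph in at most $C\,(n+m)$ time with at most $C\,n\log_2\log_2(4+m/n)$ bits of working memory. -/

import Mathlib

namespace SpaceDFS

/-! ### Depth-first search, as a sequence of visible actions -/

/-- The user procedures that a depth-first search has to execute. -/
inductive Event (V : Type) : Type
  /-- `v` is discovered (turns gray) -/
  | preprocess (v : V)
  /-- `v` has been processed completely (turns black) -/
  | postprocess (v : V)
  /-- the edge `(v, w)` is explored with `v` as the current vertex and leads to the new vertex `w` -/
  | exploreTreeEdge (v w : V)
  /-- the search withdraws from `w` to the parent `v` of `w` -/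
  | retreatTreeEdge (v w : V)
  /-- the edge `(v, w)` is explored with `v` as the current vertex and `w` is not new -/
  | handleBackEdge (v w : V)

/-- Renaming of vertices in an event. -/
def Event.map {V W : Type} (f : V → W) : Event V → Event W
  | .preprocess v => .preprocess (f v)
  | .postprocess v => .postprocess (f v)
  | .exploreTreeEdge v w => .exploreTreeEdge (f v) (f w)
  | .retreatTreeEdge v w => .retreatTreeEdge (f v) (f w)
  | .handleBackEdge v w => .handleBackEdge (f v) (f w)

/-- A situation during a depth-first search: the stack of gray vertices (top first), the vertices
discovered so far, and the pairs `(v, w)` such that the edge from `v` to `w` has been explored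
with `v` as the current vertex. -/
structure SearchState (V : Type) : Type where
  stack : List V
  discovered : Set V
  explored : Set (V × V)

/-- One move of a depth-first search in the graph with adjacency relation `Adj`, with the events
that it causes. The current vertex is the top of the stack; all its incident (out)edges
have to be explored before it leaves the stack. Which undiscovered vertex becomes the next root
and which unexplored (out)edge of the current vertex is explored next is left open. -/
inductive SearchStep {V : Type} (Adj : V → V → Prop) :
    SearchState V → List (Event V) → SearchState V → Prop
  | root (D : Set V) (X : Set (V × V)) (v : V) (hv : v ∉ D) :
      SearchStep Adj ⟨[], D, X⟩ [.preprocess v] ⟨[v], insert v D, X⟩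
  | treeEdge (S : List V) (D : Set V) (X : Set (V × V)) (v w : V)
      (hvw : Adj v w) (hX : (v, w) ∉ X) (hw : w ∉ D) :
      SearchStep Adj ⟨v :: S, D, X⟩ [.exploreTreeEdge v w, .preprocess w]
        ⟨w :: v :: S, insert w D, insert (v, w) X⟩
  | backEdge (S : List V) (D : Set V) (X : Set (V × V)) (v w : V)
      (hvw : Adj v w) (hX : (v, w) ∉ X) (hw : w ∈ D) :
      SearchStep Adj ⟨v :: S, D, X⟩ [.handleBackEdge v w] ⟨v :: S, D, insert (v, w) X⟩
  | retreat (S : List V) (D : Set V) (X : Set (V × V)) (u v : V)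
      (hv : ∀ w, Adj v w → (v, w) ∈ X) :
      SearchStep Adj ⟨v :: u :: S, D, X⟩ [.postprocess v, .retreatTreeEdge u v] ⟨u :: S, D, X⟩
  | finishRoot (D : Set V) (X : Set (V × V)) (v : V) (hv : ∀ w, Adj v w → (v, w) ∈ X) :
      SearchStep Adj ⟨[v], D, X⟩ [.postprocess v] ⟨[], D, X⟩

/-- A finite sequence of moves, with the concatenation of the events. -/
inductive SearchRun {V : Type} (Adj : V → V → Prop) :
    SearchState V → List (Event V) → SearchState V → Prop
  | nil (σ : SearchState V) : SearchRun Adj σ [] σ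
  | cons (σ τ ρ : SearchState V) (e f : List (Event V))
      (h : SearchStep Adj σ e τ) (h' : SearchRun Adj τ f ρ) : SearchRun Adj σ (e ++ f) ρ

/-- `tr` is the sequence of events of a complete depth-first search of the graph: it starts with no
vertex discovered and ends with all vertices discovered and an empty stack. -/
def IsDFS {V : Type} (Adj : V → V → Prop) (tr : List (Event V)) : Prop :=
  ∃ (D : Set V) (X : Set (V × V)), SearchRun Adj ⟨[], ∅, ∅⟩ tr ⟨[], D, X⟩ ∧ ∀ v, v ∈ D

/-! ### Input representation: adjacency arrays with cross links

Vertices are numbered `0, …, n - 1`. -/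

/-- One array per vertex `u`, listing the `v` with `R u v` in an arbitrary order. -/
structure AdjArrays {n : ℕ} (R : Fin n → Fin n → Prop) : Type where
  row : Fin n → List (Fin n)
  nodup : ∀ u, (row u).Nodup
  mem_iff : ∀ u v, v ∈ row u ↔ R u v

namespace AdjArrays

variable {n : ℕ} {R R' : Fin n → Fin n → Prop}

/-- The array of vertex number `u` (empty if there is no such vertex). -/
def nrow (A : AdjArrays R) (u : ℕ) : List ℕ :=
  if h : u < n then (A.row ⟨u, h⟩).map Fin.val else []

/-- Length of the array of `u`. -/
def deg (A : AdjArrays R) (u : ℕ) : ℕ := (A.nrow u).length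

/-- The entry at position `i` (counted from 0) of the array of `u` (0 if there is none). -/
def head (A : AdjArrays R) (u i : ℕ) : ℕ := (A.nrow u).getD i 0

/-- The position of `u` in the array (in `B`) of the vertex at position `i` of the array
(in `A`) of `u` (0 if there is no position `i`). -/
def mate (A : AdjArrays R) (B : AdjArrays R') (u i : ℕ) : ℕ :=
  if i < A.deg u then (B.nrow (A.head u i)).idxOf u else 0

end AdjArrays

/-- Access functions for undirected graphs. -/
inductive UQuery : Type
  | deg | head | mate

/-- Access functions for directed graphs, with in- and out-adjacency arrays. -/
inductive DQuery : Type
  | outDeg | outHead | outMate | inDeg | inHead | inMate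

/-- The values of the access functions of an undirected graph (`deg` ignores its second argument). -/
def uAccess {n : ℕ} {G : SimpleGraph (Fin n)} (A : AdjArrays G.Adj) : UQuery → ℕ → ℕ → ℕ
  | .deg, u, _ => A.deg u
  | .head, u, i => A.head u i
  | .mate, u, i => A.mate A u i

/-- The values of the access functions of a directed graph, for the arrays `A` of outneighbors and
the arrays `B` of inneighbors. -/
def dAccess {n : ℕ} {G : Digraph (Fin n)} (A : AdjArrays G.Adj)
    (B : AdjArrays (fun v u => G.Adj u v)) : DQuery → ℕ → ℕ → ℕ
  | .outDeg, u, _ => A.deg u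
  | .outHead, u, i => A.head u i
  | .outMate, u, i => A.mate B u i
  | .inDeg, u, _ => B.deg u
  | .inHead, u, i => B.head u i
  | .inMate, u, i => B.mate A u i

/-! ### Word RAM

A machine with words of `w` bits, `k` registers of one word each, a working memory of words,
read-only access to its input through access functions (indexed by `Q`), and a write-only stream of
events. Programs are built from instructions by composition, conditionals and loops. -/

/-- Operations on words. -/
inductive BinOp : Type
  | add | sub | mul | div | mod | and | or | xor | shl | shr

/-- Arithmetic is modulo `2 ^ w`. -/
def BinOp.eval (w : ℕ) (o : BinOp) (x y : ℕ) : ℕ :=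
  (match o with
    | .add => x + y
    | .sub => x + 2 ^ w - y
    | .mul => x * y
    | .div => x / y
    | .mod => x % y
    | .and => x &&& y
    | .or => x ||| y
    | .xor => x ^^^ y
    | .shl => x * 2 ^ y
    | .shr => x / 2 ^ y) % 2 ^ w

/-- Instructions; `r`, `a`, `b` are registers. -/
inductive Instr (Q : Type) (k : ℕ) : Type
  /-- `r := c` -/
  | const (r : Fin k) (c : ℕ)
  /-- `r := a o b` -/
  | op (o : BinOp) (r a b : Fin k)
  /-- `r := memory[a]` -/
  | load (r a : Fin k)
  /-- `memory[a] := b` -/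
  | store (a b : Fin k)
  /-- `r := q(a, b)` -/
  | query (q : Q) (r a b : Fin k)
  /-- execute a user procedure, with the contents of registers as arguments -/
  | emit (e : Event (Fin k))

/-- Tests on the contents of two registers. -/
inductive Test (k : ℕ) : Type
  | lt (a b : Fin k)
  | eq (a b : Fin k)

/-- Programs. -/
inductive Prog (Q : Type) (k : ℕ) : Type
  | skip
  | instr (i : Instr Q k)
  | seq (p q : Prog Q k)
  | cond (c : Test k) (p q : Prog Q k)
  | loop (c : Test k) (p : Prog Q k)

/-- Configurations: contents of the registers and of the memory, the number `used` of memory words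
in use (all addresses read or written so far are smaller than `used`), and the events so far. -/
structure Config (k : ℕ) : Type where
  reg : Fin k → ℕ
  mem : ℕ → ℕ
  used : ℕ
  out : List (Event ℕ)

/-- The effect of an instruction. -/
def Instr.exec {Q : Type} {k : ℕ} (w : ℕ) (acc : Q → ℕ → ℕ → ℕ) (i : Instr Q k)
    (s : Config k) : Config k :=
  match i with
  | .const r c => { s with reg := Function.update s.reg r (c % 2 ^ w) }
  | .op o r a b => { s with reg := Function.update s.reg r (o.eval w (s.reg a) (s.reg b)) }
  | .load r a => { s with
      reg := Function.update s.reg r (s.mem (s.reg a))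
      used := max s.used (s.reg a + 1) }
  | .store a b => { s with
      mem := Function.update s.mem (s.reg a) (s.reg b)
      used := max s.used (s.reg a + 1) }
  | .query q r a b => { s with
      reg := Function.update s.reg r (acc q (s.reg a) (s.reg b) % 2 ^ w) }
  | .emit e => { s with out := s.out ++ [e.map s.reg] }

/-- The condition expressed by a test. -/
def Test.Holds {k : ℕ} (c : Test k) (s : Config k) : Prop :=
  match c with
  | .lt a b => s.reg a < s.reg b
  | .eq a b => s.reg a = s.reg b

/-- `Exec w acc p s t s'`: started in `s`, the program `p` halts in `s'` after `t` steps. Each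
executed instruction and each evaluated test is one step. -/
inductive Exec {Q : Type} {k : ℕ} (w : ℕ) (acc : Q → ℕ → ℕ → ℕ) :
    Prog Q k → Config k → ℕ → Config k → Prop
  | skip (s : Config k) : Exec w acc .skip s 0 s
  | instr (i : Instr Q k) (s : Config k) : Exec w acc (.instr i) s 1 (i.exec w acc s)
  | seq (p q : Prog Q k) (s s₁ s₂ : Config k) (t₁ t₂ : ℕ)
      (h₁ : Exec w acc p s t₁ s₁) (h₂ : Exec w acc q s₁ t₂ s₂) :
      Exec w acc (.seq p q) s (t₁ + t₂) s₂
  | condTrue (c : Test k) (p q : Prog Q k) (s s₁ : Config k) (t : ℕ)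
      (hc : c.Holds s) (h : Exec w acc p s t s₁) : Exec w acc (.cond c p q) s (t + 1) s₁
  | condFalse (c : Test k) (p q : Prog Q k) (s s₁ : Config k) (t : ℕ)
      (hc : ¬ c.Holds s) (h : Exec w acc q s t s₁) : Exec w acc (.cond c p q) s (t + 1) s₁
  | loopExit (c : Test k) (p : Prog Q k) (s : Config k)
      (hc : ¬ c.Holds s) : Exec w acc (.loop c p) s 1 s
  | loopAgain (c : Test k) (p : Prog Q k) (s s₁ s₂ : Config k) (t₁ t₂ : ℕ)
      (hc : c.Holds s) (h₁ : Exec w acc p s t₁ s₁) (h₂ : Exec w acc (.loop c p) s₁ t₂ s₂) :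
      Exec w acc (.loop c p) s (t₁ + t₂ + 1) s₂

/-- At the start, register 0 holds `n`; the other registers and the memory are zero. -/
def initConfig (k w n : ℕ) : Config k where
  reg := fun r => if r.val = 0 then n % 2 ^ w else 0
  mem := fun _ => 0
  used := 0
  out := []

/-- On a machine with `w`-bit words and for the input given by `acc`, the program `p` carries
out a depth-first search of the graph on `{0, …, n - 1}` with adjacency relation `Adj` in at most
`T` steps with at most `S` bits of working memory (registers and memory words together). -/
def CarriesOutDFS {Q : Type} {k : ℕ} (p : Prog Q k) (w : ℕ) {n : ℕ} (acc : Q → ℕ → ℕ → ℕ)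
    (Adj : Fin n → Fin n → Prop) (T S : ℝ) : Prop :=
  ∃ (t : ℕ) (s : Config k) (tr : List (Event (Fin n))),
    Exec w acc p (initConfig k w n) t s ∧
    IsDFS Adj tr ∧ s.out = tr.map (Event.map Fin.val) ∧
    (t : ℝ) ≤ T ∧ (((k + s.used) * w : ℕ) : ℝ) ≤ S

end SpaceDFS

/-!
The search follows the textbook algorithm, with the edges of each vertex explored in the order of
its array. What takes space is the stack, whose entries would need `n` words if stored plainly.

*The stack.* The entry of a vertex `w` with parent `u` on the stack is the position of `u` in the
array of inneighbors of `w`. Together with the cross links, it gives `u` and the position of the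
edge from `u` to `w`, where the search goes on after the withdrawal from `w`. Entries are numbers
in mixed radix, packed into words of about `logb 2 n` bits (`enc`). As the average of
`logb 2 (indegree + 1)` is `O(D)`, where `D` is the logarithm of the average degree, all entries
together have `O(n * D)` bits. Even that is too much. Therefore the words are grouped in segments
of `n / logb 2 n` words each, of which there are `O(D)`, and only the two topmost ones are kept, in a
circular buffer, along with one vertex (trailer) for each segment (`StackRep`).

*Restoration.* When the words kept have all been popped, the segment below is computed again, by a
walk up the stack from its trailer to the current vertex. To find the child of a vertex on the
stack, two numbers of `O(logb 2 D)` bits are stored for each vertex: a color, which tells the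
segment of the entry, and the group of the position of the child in the array of the vertex, where
each array is divided into at most `D` groups. The child is the first vertex of the color in
question from the start of the group on, provided that vertices passed on the walk are marked:
neighbors that precede the child in the array were discovered before it, so that those still on
the stack lie below it (`Searching.below`, `wp_findChild`, `wp_climb`). With `m` edges, the walk
takes time `O(n + m / D)`. A restoration is necessary only after the contents of a whole segment
has been popped, and each vertex is popped only once. Hence there are `O(D)` restorations (`Paid`,
`Paid.le_of_valid`), and they take time `O(n * D + m) = O(n + m)` in total (`restoreCost_mul_le`).
The two numbers for each vertex make up the bulk of the memory, which is `O(n * logb 2 D)` bits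
(`space_le`, `bits_le_logb`).

*Programs.* The program is written in a small while language, which is compiled to the word RAM
(`Expr.exec_compile`) and comes with weakest preconditions that account for the time (`Wp`). The
time of loops is bounded with potentials (`wp_while`); `wp_move` is the step of the main loop.

An undirected graph is treated as a directed one in which each edge occurs in both directions.
-/

namespace SpaceDFS

section

/-! ### A while language with expressions on top of the word RAM -/

/-- The variables of the program. Each has a register of its own. -/
inductive Var : Type
  | n | bits | pow | per | D | q | N | grpB | bufB | trlB
  | start | cur | idx | root | acc | len | lo | fin
  | nb | pos | low | seg | ctr | total | lg | aux
  deriving DecidableEq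

/-- The register that holds a variable. The input size `n` comes first, since register 0 holds it
at the start. -/
def Var.loc (x : Var) : Fin 36 := ⟨x.ctorIdx, by cases x <;> decide⟩

theorem Var.loc_lt (x : Var) : x.loc.val < 26 := by cases x <;> decide

theorem Var.loc_injective : Function.Injective Var.loc := by
  intro x y h
  have h' : x.ctorIdx = y.ctorIdx := congrArg Fin.val h
  cases x <;> cases y <;> first | rfl | exact absurd h' (by decide)

/-- The registers that hold intermediate results. -/
def tmp (d : ℕ) : Fin 36 := ⟨26 + d % 10, by omega⟩

theorem loc_ne_tmp (x : Var) (d : ℕ) : x.loc ≠ tmp d := by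
  intro h
  have := congrArg Fin.val h
  have h1 := x.loc_lt
  simp only [tmp] at this
  omega

theorem tmp_ne {d e : ℕ} (hd : d < 10) (he : e < 10) (h : d ≠ e) : tmp d ≠ tmp e := by
  intro h'
  have := congrArg Fin.val h'
  simp only [tmp] at this
  omega

/-- Expressions without side effects, over variables, memory and access functions. -/
inductive Expr (Q : Type) : Type
  | lit (c : ℕ)
  | var (x : Var)
  | bin (o : BinOp) (a b : Expr Q)
  | ld (a : Expr Q)
  | qry (q : Q) (a b : Expr Q)

/-- The contents of variables and memory, and the events so far. -/
structure State : Type where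
  reg : Var → ℕ
  mem : ℕ → ℕ
  out : List (Event ℕ)

/-- Assignment to a variable. -/
def State.set (h : State) (x : Var) (a : ℕ) : State := { h with reg := Function.update h.reg x a }

/-- Assignment to a memory word. -/
def State.write (h : State) (p a : ℕ) : State := { h with mem := Function.update h.mem p a }

/-- Output of an event. -/
def State.put (h : State) (e : Event ℕ) : State := { h with out := h.out ++ [e] }

@[simp] theorem State.set_reg (h : State) (x y : Var) (a : ℕ) :
    (h.set x a).reg y = if y = x then a else h.reg y := by
  simp [State.set, Function.update_apply]
@[simp] theorem State.set_mem (h : State) (x : Var) (a : ℕ) : (h.set x a).mem = h.mem := rfl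
@[simp] theorem State.set_out (h : State) (x : Var) (a : ℕ) : (h.set x a).out = h.out := rfl
@[simp] theorem State.write_reg (h : State) (p a : ℕ) : (h.write p a).reg = h.reg := rfl
@[simp] theorem State.write_mem (h : State) (p a : ℕ) :
    (h.write p a).mem = Function.update h.mem p a := rfl
@[simp] theorem State.write_out (h : State) (p a : ℕ) : (h.write p a).out = h.out := rfl
@[simp] theorem State.put_reg (h : State) (e : Event ℕ) : (h.put e).reg = h.reg := rfl
@[simp] theorem State.put_out (h : State) (e : Event ℕ) : (h.put e).out = h.out ++ [e] := rfl

/-- The operations without reduction modulo `2 ^ w`. -/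
def BinOp.exact (o : BinOp) (x y : ℕ) : ℕ :=
  match o with
  | .add => x + y
  | .sub => x - y
  | .mul => x * y
  | .div => x / y
  | .mod => x % y
  | .and => x &&& y
  | .or => x ||| y
  | .xor => x ^^^ y
  | .shl => x * 2 ^ y
  | .shr => x / 2 ^ y

/-- The condition under which an operation on `w`-bit words does not wrap around. -/
def BinOp.Fits (w : ℕ) (o : BinOp) (x y : ℕ) : Prop :=
  match o with
  | .add => x + y < 2 ^ w
  | .sub => y ≤ x
  | .mul => x * y < 2 ^ w
  | .shl => x * 2 ^ y < 2 ^ w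
  | _ => True

theorem BinOp.eval_eq {w : ℕ} {o : BinOp} {x y : ℕ} (hx : x < 2 ^ w) (hy : y < 2 ^ w)
    (h : o.Fits w x y) : o.eval w x y = o.exact x y := by
  cases o <;> simp only [BinOp.eval, BinOp.exact, BinOp.Fits] at *
  · exact Nat.mod_eq_of_lt h
  · rw [show x + 2 ^ w - y = (x - y) + 2 ^ w by omega, Nat.add_mod_right]
    exact Nat.mod_eq_of_lt (by omega)
  · exact Nat.mod_eq_of_lt h
  · exact Nat.mod_eq_of_lt ((Nat.div_le_self _ _).trans_lt hx)
  · exact Nat.mod_eq_of_lt ((Nat.mod_le _ _).trans_lt hx)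
  · exact Nat.mod_eq_of_lt (Nat.and_lt_two_pow _ hy)
  · exact Nat.mod_eq_of_lt (Nat.or_lt_two_pow hx hy)
  · exact Nat.mod_eq_of_lt (Nat.xor_lt_two_pow hx hy)
  · exact Nat.mod_eq_of_lt h
  · exact Nat.mod_eq_of_lt ((Nat.div_le_self _ _).trans_lt hx)

theorem BinOp.eval_lt (w : ℕ) (o : BinOp) (x y : ℕ) : o.eval w x y < 2 ^ w :=
  Nat.mod_lt _ (by positivity)

section language

variable {Q : Type}

namespace Expr

/-- The value of an expression, in exact arithmetic. -/
def eval (ac : Q → ℕ → ℕ → ℕ) (h : State) : Expr Q → ℕ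
  | lit c => c
  | var x => h.reg x
  | bin o a b => o.exact (a.eval ac h) (b.eval ac h)
  | ld a => h.mem (a.eval ac h)
  | qry q a b => ac q (a.eval ac h) (b.eval ac h)

/-- No intermediate result overflows, and only addresses below `U` are read. -/
def Ok (w U : ℕ) (ac : Q → ℕ → ℕ → ℕ) (h : State) : Expr Q → Prop
  | lit c => c < 2 ^ w
  | var _ => True
  | bin o a b => a.Ok w U ac h ∧ b.Ok w U ac h ∧ o.Fits w (a.eval ac h) (b.eval ac h)
  | ld a => a.Ok w U ac h ∧ a.eval ac h < U
  | qry q a b => a.Ok w U ac h ∧ b.Ok w U ac h ∧ ac q (a.eval ac h) (b.eval ac h) < 2 ^ w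

/-- The number of instructions that compute an expression. -/
def cost : Expr Q → ℕ
  | lit _ => 1
  | var _ => 1
  | bin _ a b => a.cost + (b.cost + 1)
  | ld a => a.cost + 1
  | qry _ a b => a.cost + (b.cost + 1)

/-- The highest number of a register used for intermediate results. -/
def depth : Expr Q → ℕ
  | lit _ => 0
  | var _ => 0
  | bin _ a b => max a.depth (b.depth + 1)
  | ld a => a.depth
  | qry _ a b => max a.depth (b.depth + 1)

/-- The expression can be assigned to a variable within one unit of time. -/
def small (e : Expr Q) : Bool := decide (e.depth < 10) && decide (e.cost < 64)

/-- Code that computes an expression into register `tmp d`, without change to the registers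
`tmp d'` with `d' < d`. -/
def compile : Expr Q → ℕ → Prog Q 36
  | lit c, d => .instr (.const (tmp d) c)
  | var x, d => .instr (.op .or (tmp d) x.loc x.loc)
  | bin o a b, d =>
    .seq (a.compile d) (.seq (b.compile (d + 1)) (.instr (.op o (tmp d) (tmp d) (tmp (d + 1)))))
  | ld a, d => .seq (a.compile d) (.instr (.load (tmp d) (tmp d)))
  | qry q a b, d =>
    .seq (a.compile d) (.seq (b.compile (d + 1)) (.instr (.query q (tmp d) (tmp d) (tmp (d + 1)))))

instance : Add (Expr Q) := ⟨.bin .add⟩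
instance : Sub (Expr Q) := ⟨.bin .sub⟩
instance : Mul (Expr Q) := ⟨.bin .mul⟩
instance : Div (Expr Q) := ⟨.bin .div⟩
instance : Mod (Expr Q) := ⟨.bin .mod⟩
/-- Numerals are constants of the program. -/
instance (c : ℕ) : OfNat (Expr Q) c := ⟨.lit c⟩

section simps

variable (w U : ℕ) (ac : Q → ℕ → ℕ → ℕ) (h : State) (a b : Expr Q)

@[simp] theorem eval_ofNat (c : ℕ) : (no_index (OfNat.ofNat c) : Expr Q).eval ac h = c := rfl
@[simp] theorem eval_var (x : Var) : (var x : Expr Q).eval ac h = h.reg x := rfl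
@[simp] theorem eval_add : (a + b).eval ac h = a.eval ac h + b.eval ac h := rfl
@[simp] theorem eval_sub : (a - b).eval ac h = a.eval ac h - b.eval ac h := rfl
@[simp] theorem eval_mul : (a * b).eval ac h = a.eval ac h * b.eval ac h := rfl
@[simp] theorem eval_div : (a / b).eval ac h = a.eval ac h / b.eval ac h := rfl
@[simp] theorem eval_mod : (a % b).eval ac h = a.eval ac h % b.eval ac h := rfl
@[simp] theorem eval_xor : (bin .xor a b).eval ac h = a.eval ac h ^^^ b.eval ac h := rfl
@[simp] theorem eval_shl : (bin .shl a b).eval ac h = a.eval ac h * 2 ^ b.eval ac h := rfl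
@[simp] theorem eval_shr : (bin .shr a b).eval ac h = a.eval ac h / 2 ^ b.eval ac h := rfl
@[simp] theorem eval_ld : (ld a).eval ac h = h.mem (a.eval ac h) := rfl
@[simp] theorem eval_qry (q : Q) :
    (qry q a b).eval ac h = ac q (a.eval ac h) (b.eval ac h) := rfl

@[simp] theorem ok_ofNat (c : ℕ) :
    (no_index (OfNat.ofNat c) : Expr Q).Ok w U ac h ↔ c < 2 ^ w := Iff.rfl
@[simp] theorem ok_var (x : Var) : (var x : Expr Q).Ok w U ac h ↔ True := Iff.rfl
@[simp] theorem ok_add : (a + b).Ok w U ac h ↔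
    a.Ok w U ac h ∧ b.Ok w U ac h ∧ a.eval ac h + b.eval ac h < 2 ^ w := Iff.rfl
@[simp] theorem ok_sub : (a - b).Ok w U ac h ↔
    a.Ok w U ac h ∧ b.Ok w U ac h ∧ b.eval ac h ≤ a.eval ac h := Iff.rfl
@[simp] theorem ok_mul : (a * b).Ok w U ac h ↔
    a.Ok w U ac h ∧ b.Ok w U ac h ∧ a.eval ac h * b.eval ac h < 2 ^ w := Iff.rfl
@[simp] theorem ok_div : (a / b).Ok w U ac h ↔ a.Ok w U ac h ∧ b.Ok w U ac h := by
  change _ ∧ _ ∧ True ↔ _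
  rw [and_true]
@[simp] theorem ok_mod : (a % b).Ok w U ac h ↔ a.Ok w U ac h ∧ b.Ok w U ac h := by
  change _ ∧ _ ∧ True ↔ _
  rw [and_true]
@[simp] theorem ok_xor : (bin .xor a b).Ok w U ac h ↔ a.Ok w U ac h ∧ b.Ok w U ac h := by
  change _ ∧ _ ∧ True ↔ _
  rw [and_true]
@[simp] theorem ok_shl : (bin .shl a b).Ok w U ac h ↔
    a.Ok w U ac h ∧ b.Ok w U ac h ∧ a.eval ac h * 2 ^ b.eval ac h < 2 ^ w := Iff.rfl
@[simp] theorem ok_shr : (bin .shr a b).Ok w U ac h ↔ a.Ok w U ac h ∧ b.Ok w U ac h := by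
  change _ ∧ _ ∧ True ↔ _
  rw [and_true]
@[simp] theorem ok_ld : (ld a).Ok w U ac h ↔ a.Ok w U ac h ∧ a.eval ac h < U := Iff.rfl
@[simp] theorem ok_qry (q : Q) : (qry q a b).Ok w U ac h ↔
    a.Ok w U ac h ∧ b.Ok w U ac h ∧ ac q (a.eval ac h) (b.eval ac h) < 2 ^ w := Iff.rfl

end simps

end Expr

/-- A machine configuration represents a state: it agrees with it on variables, memory and output.
Moreover all its words are below `2 ^ w`, and all addresses used so far are below `U`. -/
structure Rel (w U : ℕ) (h : State) (c : Config 36) : Prop where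
  reg : ∀ x : Var, c.reg x.loc = h.reg x
  mem : c.mem = h.mem
  out : c.out = h.out
  used : c.used ≤ U
  reg_lt : ∀ r, c.reg r < 2 ^ w
  mem_lt : ∀ a, c.mem a < 2 ^ w

variable {w U : ℕ} {ac : Q → ℕ → ℕ → ℕ}

theorem Rel.tmp {h : State} {c : Config 36} (hc : Rel w U h c) (d y us : ℕ) (hy : y < 2 ^ w)
    (hus : us ≤ U) :
    Rel w U h { c with reg := Function.update c.reg (tmp d) y, used := us } where
  reg x := by simp [Function.update_of_ne (loc_ne_tmp x d), hc.reg]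
  mem := hc.mem
  out := hc.out
  used := hus
  reg_lt r := by
    by_cases hr : r = SpaceDFS.tmp d
    · subst hr; simpa using hy
    · simpa [Function.update_of_ne hr] using hc.reg_lt r
  mem_lt := hc.mem_lt

theorem Rel.set {h : State} {c : Config 36} (hc : Rel w U h c) (x : Var) (y : ℕ) (hy : y < 2 ^ w) :
    Rel w U (h.set x y) { c with reg := Function.update c.reg x.loc y } where
  reg z := by
    by_cases hz : z = x
    · subst hz; simp
    · simp [Function.update_of_ne (Var.loc_injective.ne hz), hz, hc.reg]
  mem := hc.mem
  out := hc.out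
  used := hc.used
  reg_lt r := by
    by_cases hr : r = x.loc
    · subst hr; simpa using hy
    · simpa [Function.update_of_ne hr] using hc.reg_lt r
  mem_lt := hc.mem_lt

/-- Compiled expressions compute their values: intermediate results of the left operand survive in
`tmp d` while the right operand is computed in the higher registers. -/
theorem Expr.exec_compile (e : Expr Q) {h : State} (hok : e.Ok w U ac h) :
    ∀ d, d + e.depth < 10 → ∀ c, Rel w U h c →
      ∃ c', Exec w ac (e.compile d) c e.cost c' ∧ Rel w U h c' ∧
        c'.reg (tmp d) = e.eval ac h ∧ ∀ d' < d, c'.reg (tmp d') = c.reg (tmp d') := by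
  induction e with
  | lit a =>
    intro d hd c hc
    refine ⟨_, .instr _ _, hc.tmp d _ _ (Nat.mod_lt _ (by positivity)) hc.used, ?_, ?_⟩
    · simpa [Instr.exec, Expr.eval] using Nat.mod_eq_of_lt hok
    · intro d' hd'
      simp only [Expr.depth] at hd
      simp [Instr.exec, Function.update_of_ne (tmp_ne (by omega) (by omega) hd'.ne)]
  | var x =>
    intro d hd c hc
    refine ⟨_, .instr _ _, hc.tmp d _ _ (BinOp.eval_lt _ _ _ _) hc.used, ?_, ?_⟩
    · simp only [Expr.eval, Instr.exec, Function.update_self]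
      rw [BinOp.eval_eq (o := .or) (hc.reg_lt _) (hc.reg_lt _) trivial]
      simp [BinOp.exact, hc.reg]
    · intro d' hd'
      simp only [Expr.depth] at hd
      simp [Instr.exec, Function.update_of_ne (tmp_ne (by omega) (by omega) hd'.ne)]
  | bin o a b iha ihb =>
    intro d hd c hc
    simp only [Expr.depth] at hd
    obtain ⟨c₁, h₁, r₁, e₁, f₁⟩ := iha hok.1 d (by omega) c hc
    obtain ⟨c₂, h₂, r₂, e₂, f₂⟩ := ihb hok.2.1 (d + 1) (by omega) c₁ r₁
    have hv₁ : c₂.reg (tmp d) = a.eval ac h := by rw [f₂ d (by omega), e₁]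
    refine ⟨_, .seq _ _ _ _ _ _ _ h₁ (.seq _ _ _ _ _ _ _ h₂ (.instr _ _)),
      r₂.tmp d _ _ (BinOp.eval_lt _ _ _ _) r₂.used, ?_, ?_⟩
    · simp only [Expr.eval, Instr.exec, Function.update_self]
      rw [BinOp.eval_eq (r₂.reg_lt _) (r₂.reg_lt _) (by rw [hv₁, e₂]; exact hok.2.2), hv₁, e₂]
    · intro d' hd'
      simp [Instr.exec, Function.update_of_ne (tmp_ne (by omega) (by omega) hd'.ne),
        f₂ d' (by omega), f₁ d' hd']
  | ld a iha =>
    intro d hd c hc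
    simp only [Expr.depth] at hd
    obtain ⟨c₁, h₁, r₁, e₁, f₁⟩ := iha hok.1 d (by omega) c hc
    refine ⟨_, .seq _ _ _ _ _ _ _ h₁ (.instr _ _), r₁.tmp d _ _ (r₁.mem_lt _) ?_, ?_, ?_⟩
    · rw [e₁]
      exact max_le r₁.used hok.2
    · simp [Expr.eval, Instr.exec, e₁, r₁.mem]
    · intro d' hd'
      simp [Instr.exec, Function.update_of_ne (tmp_ne (by omega) (by omega) hd'.ne), f₁ d' hd']
  | qry q a b iha ihb =>
    intro d hd c hc
    simp only [Expr.depth] at hd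
    obtain ⟨c₁, h₁, r₁, e₁, f₁⟩ := iha hok.1 d (by omega) c hc
    obtain ⟨c₂, h₂, r₂, e₂, f₂⟩ := ihb hok.2.1 (d + 1) (by omega) c₁ r₁
    have hv₁ : c₂.reg (tmp d) = a.eval ac h := by rw [f₂ d (by omega), e₁]
    refine ⟨_, .seq _ _ _ _ _ _ _ h₁ (.seq _ _ _ _ _ _ _ h₂ (.instr _ _)),
      r₂.tmp d _ _ (Nat.mod_lt _ (by positivity)) r₂.used, ?_, ?_⟩
    · simp only [Expr.eval, Instr.exec, Function.update_self]
      rw [hv₁, e₂]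
      exact Nat.mod_eq_of_lt hok.2.2
    · intro d' hd'
      simp [Instr.exec, Function.update_of_ne (tmp_ne (by omega) (by omega) hd'.ne),
        f₂ d' (by omega), f₁ d' hd']

/-- Comparisons of expressions. -/
inductive Cond (Q : Type) : Type
  | lt (a b : Expr Q)
  | eq (a b : Expr Q)

namespace Cond

/-- The expression on the left. -/
def fst : Cond Q → Expr Q
  | lt a _ => a
  | eq a _ => a

/-- The expression on the right. -/
def snd : Cond Q → Expr Q
  | lt _ b => b
  | eq _ b => b

/-- The machine test, once both sides have been computed. -/
def test : Cond Q → Test 36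
  | lt _ _ => .lt (tmp 0) (tmp 1)
  | eq _ _ => .eq (tmp 0) (tmp 1)

/-- The condition holds in a state. -/
def Holds (ac : Q → ℕ → ℕ → ℕ) (h : State) : Cond Q → Prop
  | lt a b => a.eval ac h < b.eval ac h
  | eq a b => a.eval ac h = b.eval ac h

/-- Both sides can be evaluated without overflow and within the memory bound. -/
def Ok (w U : ℕ) (ac : Q → ℕ → ℕ → ℕ) (h : State) (c : Cond Q) : Prop :=
  c.fst.Ok w U ac h ∧ c.snd.Ok w U ac h

/-- Code that computes both sides. -/
def compile (c : Cond Q) : Prog Q 36 := .seq (c.fst.compile 0) (c.snd.compile 1)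

/-- The condition is small enough to be evaluated within one unit of time. -/
def small (c : Cond Q) : Bool :=
  decide (c.fst.depth < 10) && (decide (1 + c.snd.depth < 10) &&
    decide (c.fst.cost + c.snd.cost < 64))

end Cond

/-- Assignment of the value of an expression to a variable. -/
def asg (x : Var) (e : Expr Q) : Prog Q 36 :=
  .seq (e.compile 0) (.instr (.op .or x.loc (tmp 0) (tmp 0)))

/-- Assignment of the value of `e` to the memory word with address `a`. -/
def sto (a e : Expr Q) : Prog Q 36 :=
  .seq (a.compile 0) (.seq (e.compile 1) (.instr (.store (tmp 0) (tmp 1))))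

/-- The assignment of `e` to the word with address `a` takes at most one unit of time. -/
def stoSmall (a e : Expr Q) : Bool :=
  decide (a.depth < 10) && (decide (1 + e.depth < 10) && decide (a.cost + e.cost < 64))

/-- Output of an event with the values of variables as arguments. -/
def say (e : Event Var) : Prog Q 36 := .instr (.emit (e.map Var.loc))

/-- Conditional statement. -/
def ite' (c : Cond Q) (p q : Prog Q 36) : Prog Q 36 := .seq c.compile (.cond c.test p q)

/-- While loop. -/
def while' (c : Cond Q) (p : Prog Q 36) : Prog Q 36 :=
  .seq c.compile (.loop c.test (.seq p c.compile))

/-- A sequence of statements. -/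
def block : List (Prog Q 36) → Prog Q 36
  | [] => .skip
  | p :: ps => .seq p (block ps)

/-- Started in a configuration that represents `h`, the program `p` halts in one that represents
some `h'` after at most `64 * t` steps, where `t` and `h'` satisfy `R`. Time is counted in units of
64 steps, enough for each of the assignments and tests that occur. -/
def Wp (w U : ℕ) (ac : Q → ℕ → ℕ → ℕ) (p : Prog Q 36) (h : State) (R : ℕ → State → Prop) : Prop :=
  ∃ (t : ℕ) (h' : State), (∀ c, Rel w U h c →
    ∃ t' ≤ 64 * t, ∃ c', Exec w ac p c t' c' ∧ Rel w U h' c') ∧ R t h'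

theorem Wp.mono {p : Prog Q 36} {h : State} {R R' : ℕ → State → Prop} (hp : Wp w U ac p h R)
    (hR : ∀ t h', R t h' → R' t h') : Wp w U ac p h R' := by
  obtain ⟨t, h', he, hr⟩ := hp
  exact ⟨t, h', he, hR _ _ hr⟩

theorem wp_seq {p q : Prog Q 36} {h : State} {R : ℕ → State → Prop}
    (hp : Wp w U ac p h fun t h' => Wp w U ac q h' fun t' h'' => R (t + t') h'') :
    Wp w U ac (.seq p q) h R := by
  obtain ⟨t, h', he, t', h'', he', hr⟩ := hp
  refine ⟨t + t', h'', fun c hc => ?_, hr⟩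
  obtain ⟨t₁, ht₁, c₁, e₁, r₁⟩ := he c hc
  obtain ⟨t₂, ht₂, c₂, e₂, r₂⟩ := he' c₁ r₁
  exact ⟨t₁ + t₂, by omega, c₂, .seq _ _ _ _ _ _ _ e₁ e₂, r₂⟩

theorem wp_nil {h : State} {R : ℕ → State → Prop} (hR : R 0 h) : Wp w U ac (block []) h R :=
  ⟨0, h, fun c hc => ⟨0, by omega, c, .skip _, hc⟩, hR⟩

theorem wp_cons {p : Prog Q 36} {ps : List (Prog Q 36)} {h : State} {R : ℕ → State → Prop}
    (hp : Wp w U ac p h fun t h' => Wp w U ac (block ps) h' fun t' h'' => R (t + t') h'') :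
    Wp w U ac (block (p :: ps)) h R :=
  wp_seq hp

theorem wp_asg {x : Var} {e : Expr Q} {h : State} {R : ℕ → State → Prop}
    (hs : e.small = true) (hok : e.Ok w U ac h) (hR : R 1 (h.set x (e.eval ac h))) :
    Wp w U ac (asg x e) h R := by
  simp only [Expr.small, Bool.and_eq_true, decide_eq_true_eq] at hs
  refine ⟨1, _, fun c hc => ?_, hR⟩
  obtain ⟨c₁, h₁, r₁, e₁, -⟩ := e.exec_compile hok 0 (by omega) c hc
  refine ⟨e.cost + 1, by omega, _, .seq _ _ _ _ _ _ _ h₁ (.instr _ _), ?_⟩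
  have hv : BinOp.or.eval w (c₁.reg (tmp 0)) (c₁.reg (tmp 0)) = e.eval ac h := by
    rw [BinOp.eval_eq (o := .or) (r₁.reg_lt _) (r₁.reg_lt _) trivial, e₁]
    simp [BinOp.exact]
  simp only [Instr.exec]
  rw [hv]
  exact r₁.set x _ (by rw [← hv]; exact BinOp.eval_lt _ _ _ _)

theorem wp_sto {a e : Expr Q} {h : State} {R : ℕ → State → Prop}
    (hs : stoSmall a e = true) (hoa : a.Ok w U ac h)
    (hoe : e.Ok w U ac h) (hU : a.eval ac h < U)
    (hR : R 1 (h.write (a.eval ac h) (e.eval ac h))) :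
    Wp w U ac (sto a e) h R := by
  simp only [stoSmall, Bool.and_eq_true, decide_eq_true_eq] at hs
  refine ⟨1, _, fun c hc => ?_, hR⟩
  obtain ⟨c₁, h₁, r₁, e₁, -⟩ := a.exec_compile hoa 0 (by omega) c hc
  obtain ⟨c₂, h₂, r₂, e₂, f₂⟩ := e.exec_compile hoe 1 (by omega) c₁ r₁
  refine ⟨a.cost + (e.cost + 1), by omega, _,
    .seq _ _ _ _ _ _ _ h₁ (.seq _ _ _ _ _ _ _ h₂ (.instr _ _)), ?_⟩
  have ha : c₂.reg (tmp 0) = a.eval ac h := by rw [f₂ 0 (by omega), e₁]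
  refine ⟨r₂.reg, ?_, r₂.out, ?_, r₂.reg_lt, ?_⟩
  · simp [Instr.exec, ha, e₂, r₂.mem]
  · simp only [Instr.exec, ha]
    exact max_le r₂.used hU
  · intro p
    simp only [Instr.exec, Function.update_apply]
    split_ifs
    · exact r₂.reg_lt _
    · exact r₂.mem_lt _

theorem wp_say {e : Event Var} {h : State} {R : ℕ → State → Prop}
    (hR : R 1 (h.put (e.map h.reg))) : Wp w U ac (say e) h R := by
  refine ⟨1, _, fun c hc => ⟨1, by omega, _, .instr _ _, ?_⟩, hR⟩
  refine ⟨hc.reg, hc.mem, ?_, hc.used, hc.reg_lt, hc.mem_lt⟩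
  have : (e.map Var.loc).map c.reg = e.map h.reg := by
    cases e <;> simp [Event.map, hc.reg]
  simp [Instr.exec, hc.out, this]

theorem Cond.exec_compile {b : Cond Q} {h : State} (hs : b.small = true) (hok : b.Ok w U ac h)
    {c : Config 36} (hc : Rel w U h c) :
    ∃ t c', t + 1 ≤ 64 ∧ Exec w ac b.compile c t c' ∧ Rel w U h c' ∧
      (b.test.Holds c' ↔ b.Holds ac h) := by
  simp only [Cond.small, Bool.and_eq_true, decide_eq_true_eq] at hs
  obtain ⟨c₁, h₁, r₁, e₁, -⟩ := b.fst.exec_compile hok.1 0 (by have := hs.1; omega) c hc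
  obtain ⟨c₂, h₂, r₂, e₂, f₂⟩ := b.snd.exec_compile hok.2 1 (by have := hs.2.1; omega) c₁ r₁
  have ha : c₂.reg (tmp 0) = b.fst.eval ac h := by rw [f₂ 0 (by omega), e₁]
  refine ⟨_, c₂, hs.2.2, .seq _ _ _ _ _ _ _ h₁ h₂, r₂, ?_⟩
  cases b <;> simp_all [Cond.test, Cond.Holds, Test.Holds, Cond.fst, Cond.snd]

theorem wp_ite {b : Cond Q} {p q : Prog Q 36} {h : State} {R : ℕ → State → Prop}
    (hs : b.small = true) (hok : b.Ok w U ac h)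
    (hp : b.Holds ac h → Wp w U ac p h fun t h' => R (t + 1) h')
    (hq : ¬ b.Holds ac h → Wp w U ac q h fun t h' => R (t + 1) h') :
    Wp w U ac (ite' b p q) h R := by
  by_cases hb : b.Holds ac h
  · obtain ⟨t, h', he, hr⟩ := hp hb
    refine ⟨t + 1, h', fun c hc => ?_, hr⟩
    obtain ⟨t₁, c₁, ht₁, e₁, r₁, i₁⟩ := Cond.exec_compile hs hok hc
    obtain ⟨t₂, ht₂, c₂, e₂, r₂⟩ := he c₁ r₁
    exact ⟨t₁ + (t₂ + 1), by omega, c₂,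
      .seq _ _ _ _ _ _ _ e₁ (.condTrue _ _ _ _ _ _ (i₁.2 hb) e₂), r₂⟩
  · obtain ⟨t, h', he, hr⟩ := hq hb
    refine ⟨t + 1, h', fun c hc => ?_, hr⟩
    obtain ⟨t₁, c₁, ht₁, e₁, r₁, i₁⟩ := Cond.exec_compile hs hok hc
    obtain ⟨t₂, ht₂, c₂, e₂, r₂⟩ := he c₁ r₁
    exact ⟨t₁ + (t₂ + 1), by omega, c₂,
      .seq _ _ _ _ _ _ _ e₁ (.condFalse _ _ _ _ _ _ (fun hh => hb (i₁.1 hh)) e₂), r₂⟩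

/-- Loops, with an invariant `I` about a ghost state and a potential `μ` that pays for the time of
each iteration and thereby also ensures termination. -/
theorem wp_while {G : Type*} {b : Cond Q} {p : Prog Q 36} {R : ℕ → State → Prop}
    (I : G → State → Prop) (μ : G → ℕ) (hs : b.small = true) (hok : ∀ g h, I g h → b.Ok w U ac h)
    (hstep : ∀ g h, I g h → b.Holds ac h →
      Wp w U ac p h fun t h' => ∃ g', I g' h' ∧ t + 1 + μ g' ≤ μ g)
    {g : G} {h : State} (hI : I g h)
    (hpost : ∀ t g' h', I g' h' → ¬ b.Holds ac h' → t + μ g' ≤ μ g + 1 → R t h') :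
    Wp w U ac (while' b p) h R := by
  have key : ∀ N g h, μ g ≤ N → I g h → ∃ (t : ℕ) (h' : State), (∀ c, Rel w U h c →
      (b.test.Holds c ↔ b.Holds ac h) →
      ∃ t' ≤ 64 * t + 1, ∃ c', Exec w ac (.loop b.test (.seq p b.compile)) c t' c' ∧
        Rel w U h' c') ∧
      ∃ g', I g' h' ∧ ¬ b.Holds ac h' ∧ t + μ g' ≤ μ g := by
    intro N
    induction N with
    | zero =>
      intro g h hN hI
      by_cases hb : b.Holds ac h
      · obtain ⟨t, h', -, g', -, hle⟩ := hstep g h hI hb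
        omega
      · refine ⟨0, h, fun c hc hi => ⟨1, by omega, c, .loopExit _ _ _ (fun hh => hb (hi.1 hh)), hc⟩,
          g, hI, hb, by omega⟩
    | succ N ih =>
      intro g h hN hI
      by_cases hb : b.Holds ac h
      · obtain ⟨t, h', he, g', hI', hle⟩ := hstep g h hI hb
        obtain ⟨t₂, h₂, he₂, g₂, hI₂, hb₂, hle₂⟩ := ih g' h' (by omega) hI'
        refine ⟨t + 1 + t₂, h₂, fun c hc hi => ?_, g₂, hI₂, hb₂, by omega⟩
        obtain ⟨s₁, hs₁, c₁, e₁, r₁⟩ := he c hc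
        obtain ⟨s₂, c₂, hs₂, e₂, r₂, i₂⟩ := Cond.exec_compile hs (hok g' h' hI') r₁
        obtain ⟨s₃, hs₃, c₃, e₃, r₃⟩ := he₂ c₂ r₂ i₂
        exact ⟨(s₁ + s₂) + s₃ + 1, by omega, c₃,
          .loopAgain _ _ _ _ _ _ _ (hi.2 hb) (.seq _ _ _ _ _ _ _ e₁ e₂) e₃, r₃⟩
      · refine ⟨0, h, fun c hc hi => ⟨1, by omega, c, .loopExit _ _ _ (fun hh => hb (hi.1 hh)), hc⟩,
          g, hI, hb, by omega⟩
  obtain ⟨t, h', he, g', hI', hb', hle⟩ := key _ g h le_rfl hI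
  refine ⟨t + 1, h', fun c hc => ?_, hpost _ g' h' hI' hb' (by omega)⟩
  obtain ⟨t₁, c₁, ht₁, e₁, r₁, i₁⟩ := Cond.exec_compile hs (hok g h hI) hc
  obtain ⟨t₂, ht₂, c₂, e₂, r₂⟩ := he c₁ r₁ i₁
  exact ⟨t₁ + t₂, by omega, c₂, .seq _ _ _ _ _ _ _ e₁ e₂, r₂⟩

end language

end

section

/-! ### Arrays of small numbers, packed into words -/

/-- From address `base` on, the memory holds the numbers `f v`, with `per` fields of `bits` bits in
each word. -/
def Packed {n : ℕ} (bits per : ℕ) (mem : ℕ → ℕ) (base : ℕ) (f : Fin n → ℕ) : Prop :=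
  ∀ v : Fin n, mem (base + v / per) / 2 ^ (v % per * bits) % 2 ^ bits = f v

namespace Packed

variable {n bits per base : ℕ} {mem : ℕ → ℕ} {f : Fin n → ℕ}

theorem lt (h : Packed bits per mem base f) (v : Fin n) : f v < 2 ^ bits := by
  rw [← h v]
  exact Nat.mod_lt _ (by positivity)

theorem update_outside (h : Packed bits per mem base f) {p a : ℕ}
    (hp : p < base ∨ base + n / per < p) : Packed bits per (Function.update mem p a) base f := by
  intro v
  have h1 : (v : ℕ) / per ≤ n / per := Nat.div_le_div_right v.2.le
  have h2 : base + v / per ≠ p := by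
    generalize (v : ℕ) / per = k at *
    generalize n / per = k' at *
    omega
  rw [Function.update_of_ne h2, h v]

/-- The xor of the old and the new value, shifted to its field, changes this field only. -/
theorem update (h : Packed bits per mem base f) (v : Fin n) {a : ℕ}
    (ha : a < 2 ^ bits) :
    Packed bits per (Function.update mem (base + v / per)
      (mem (base + v / per) ^^^ ((f v ^^^ a) * 2 ^ (v % per * bits)))) base
      (Function.update f v a) := by
  intro u
  have hx : f v ^^^ a < 2 ^ bits := Nat.xor_lt_two_pow (h.lt v) ha
  by_cases hw : (u : ℕ) / per = v / per
  · rw [hw, Function.update_self, ← Nat.shiftRight_eq_div_pow, ← Nat.shiftLeft_eq]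
    have hu := h u
    rw [hw, ← Nat.shiftRight_eq_div_pow] at hu
    by_cases huv : u = v
    · subst huv
      rw [Function.update_self, Nat.shiftRight_xor_distrib, Nat.xor_mod_two_pow, hu,
        Nat.shiftLeft_shiftRight, Nat.mod_eq_of_lt hx, ← Nat.xor_assoc, Nat.xor_self,
        Nat.zero_xor]
    · rw [Function.update_of_ne huv, Nat.shiftRight_xor_distrib, Nat.xor_mod_two_pow, hu]
      have hm : (u : ℕ) % per ≠ v % per := by
        intro hm
        apply huv
        apply Fin.ext
        rw [← Nat.div_add_mod (u : ℕ) per, ← Nat.div_add_mod (v : ℕ) per, hw, hm]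
      -- the bits changed lie outside the field of `u`
      have h0 : ((f v ^^^ a) <<< (v % per * bits)) >>> (u % per * bits) % 2 ^ bits = 0 := by
        apply Nat.eq_of_testBit_eq
        intro k
        rw [Nat.testBit_mod_two_pow, Nat.testBit_shiftRight, Nat.testBit_shiftLeft,
          Nat.zero_testBit]
        by_cases hk : k < bits
        · rcases lt_or_gt_of_ne hm with hlt | hgt
          · have : (u : ℕ) % per * bits + bits ≤ v % per * bits := by
              rw [← Nat.succ_mul]
              exact Nat.mul_le_mul_right _ hlt
            simp [show ¬ (v % per * bits ≤ u % per * bits + k) by omega]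
          · have : (v : ℕ) % per * bits + bits ≤ u % per * bits := by
              rw [← Nat.succ_mul]
              exact Nat.mul_le_mul_right _ hgt
            rw [Nat.testBit_lt_two_pow (x := f v ^^^ a)
              (hx.trans_le (Nat.pow_le_pow_right (by omega) (by omega)))]
            simp
        · simp [hk]
      rw [h0, Nat.xor_zero]
  · rw [Function.update_of_ne (by omega), h u, Function.update_of_ne]
    intro huv
    exact hw (by rw [huv])

end Packed

/-! ### The stack, encoded in words -/

/-- A stack of numbers in mixed radix: the words that are full, the last one first, the word under
construction, and the weight of the entries in the latter. A word under construction is at least 1,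
and it is 1 exactly if it holds no entry. -/
structure Code : Type where
  words : List ℕ
  acc : ℕ
  wt : ℕ

/-- Push an entry `x` with radix `r` and weight `k`; words are full from `N` on. -/
def Code.push (N : ℕ) (c : Code) (r x k : ℕ) : Code :=
  if c.acc * r + x < N then ⟨c.words, c.acc * r + x, c.wt + k⟩
  else ⟨(c.acc * r + x) :: c.words, 1, 0⟩

variable {n : ℕ} {R : Fin n → Fin n → Prop}

/-- An integral upper bound for `logb 2 (indegree + 1)`. In contrast to the logarithm itself, it is
easily summed: the sum over all vertices is at most `n * (D + 1)` if the average of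
`indegree + 1` is at most `2 ^ D`. -/
def weight (B : AdjArrays R) (D : ℕ) (v : Fin n) : ℕ := D + ((B.row v).length + 1) / 2 ^ D

theorem radix_le (B : AdjArrays R) (D : ℕ) (v : Fin n) :
    (B.row v).length + 1 ≤ 2 ^ weight B D v := by
  have h1 : (B.row v).length + 1 < 2 ^ D * (((B.row v).length + 1) / 2 ^ D + 1) :=
    Nat.lt_mul_div_succ _ (by positivity)
  rw [weight, pow_add]
  exact h1.le.trans (Nat.mul_le_mul_left _ Nat.lt_two_pow_self)

/-- The encoding of a stack of vertices, top first: the entry for a vertex is the position of the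
next lower vertex in its array of inneighbors. The lowest vertex has no entry. -/
def enc (B : AdjArrays R) (D L : ℕ) : List (Fin n) → Code
  | [] => ⟨[], 1, 0⟩
  | [_] => ⟨[], 1, 0⟩
  | w :: u :: S => (enc B D L (u :: S)).push (2 ^ (L + 1)) ((B.row w).length + 1)
      ((B.row w).idxOf u) (weight B D w)

section enc

variable {B : AdjArrays R} {D L : ℕ}

/-- The number of words of the encoding of a stack. -/
def encLen (B : AdjArrays R) (D L : ℕ) (S : List (Fin n)) : ℕ := (enc B D L S).words.length

theorem enc_singleton (v : Fin n) : enc B D L [v] = ⟨[], 1, 0⟩ := by rw [enc]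

theorem encLen_singleton (v : Fin n) : encLen B D L [v] = 0 := by
  rw [encLen, enc_singleton]; rfl

theorem enc_push_of_lt {w u : Fin n} {S : List (Fin n)}
    (h : (enc B D L (u :: S)).acc * ((B.row w).length + 1) + (B.row w).idxOf u < 2 ^ (L + 1)) :
    enc B D L (w :: u :: S) = ⟨(enc B D L (u :: S)).words,
      (enc B D L (u :: S)).acc * ((B.row w).length + 1) + (B.row w).idxOf u,
      (enc B D L (u :: S)).wt + weight B D w⟩ := by
  rw [enc, Code.push, if_pos h]

theorem enc_push_of_le {w u : Fin n} {S : List (Fin n)}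
    (h : 2 ^ (L + 1) ≤ (enc B D L (u :: S)).acc * ((B.row w).length + 1) + (B.row w).idxOf u) :
    enc B D L (w :: u :: S) =
      ⟨((enc B D L (u :: S)).acc * ((B.row w).length + 1) + (B.row w).idxOf u) ::
        (enc B D L (u :: S)).words, 1, 0⟩ := by
  rw [enc, Code.push, if_neg (by omega)]

theorem one_le_acc (S : List (Fin n)) : 1 ≤ (enc B D L S).acc := by
  induction S with
  | nil => simp [enc]
  | cons w S ih =>
    cases S with
    | nil => simp [enc]
    | cons u S =>
      rw [enc, Code.push]
      split_ifs
      · exact Nat.le_add_right_of_le (Nat.mul_pos ih (by omega))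
      · simp

theorem acc_lt (S : List (Fin n)) : (enc B D L S).acc < 2 ^ (L + 1) := by
  have h1 : 1 < 2 ^ (L + 1) := Nat.one_lt_two_pow (by omega)
  cases S with
  | nil => simp [enc]
  | cons w S =>
    cases S with
    | nil => simp [enc]
    | cons u S =>
      rw [enc, Code.push]
      split_ifs with h
      · exact h
      · exact h1

/-- An entry with its radix does not exceed what its weight accounts for. -/
theorem push_le {a r x k t : ℕ} (ha : a + 1 ≤ 2 ^ (t + 1)) (hx : x < r) (hr : r ≤ 2 ^ k) :
    a * r + x + 1 ≤ 2 ^ (t + k + 1) :=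
  calc a * r + x + 1 ≤ (a + 1) * r := by rw [Nat.succ_mul]; omega
    _ ≤ 2 ^ (t + 1) * 2 ^ k := Nat.mul_le_mul ha hr
    _ = 2 ^ (t + k + 1) := by rw [← pow_add]; ring_nf

theorem idxOf_lt_radix (w u : Fin n) : (B.row w).idxOf u < (B.row w).length + 1 :=
  Nat.lt_succ_of_le List.idxOf_le_length

/-- The entries of the word under construction fit into as many bits as their weights tell. -/
theorem acc_le_wt (S : List (Fin n)) : (enc B D L S).acc + 1 ≤ 2 ^ ((enc B D L S).wt + 1) := by
  induction S with
  | nil => simp [enc]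
  | cons w S ih =>
    cases S with
    | nil => simp [enc]
    | cons u S =>
      rw [enc, Code.push]
      split_ifs
      · exact push_le ih (idxOf_lt_radix w u) (radix_le B D w)
      · simp

/-- The entries in a full word have a total weight of at least `L`. -/
theorem le_wt_of_full {w u : Fin n} {S : List (Fin n)}
    (h : 2 ^ (L + 1) ≤ (enc B D L (u :: S)).acc * ((B.row w).length + 1) + (B.row w).idxOf u) :
    L ≤ (enc B D L (u :: S)).wt + weight B D w := by
  have h1 := push_le (acc_le_wt (B := B) (D := D) (L := L) (u :: S)) (idxOf_lt_radix w u)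
    (radix_le B D w)
  have h2 : 2 ^ (L + 1) < 2 ^ ((enc B D L (u :: S)).wt + weight B D w + 1) := by omega
  have := (Nat.pow_lt_pow_iff_right (by omega : 1 < 2)).1 h2
  omega

/-- The words of the encoding are paid for by the weights of the vertices on the stack. -/
theorem encLen_mul_le (S : List (Fin n)) :
    encLen B D L S * L + (enc B D L S).wt ≤ (S.map (weight B D)).sum := by
  induction S with
  | nil => simp [enc, encLen]
  | cons w S ih =>
    cases S with
    | nil => simp [enc, encLen]
    | cons u S =>
      rw [encLen] at *
      rw [List.map_cons, List.sum_cons]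
      by_cases h : (enc B D L (u :: S)).acc * ((B.row w).length + 1) + (B.row w).idxOf u
          < 2 ^ (L + 1)
      · rw [enc_push_of_lt h]
        simp only
        omega
      · have h' := not_lt.1 h
        rw [enc_push_of_le h']
        have := le_wt_of_full h'
        simp only [List.length_cons, Nat.succ_mul]
        omega

/-- A push adds no word or fills the word under construction. -/
theorem encLen_cons (w u : Fin n) (S : List (Fin n)) :
    encLen B D L (w :: u :: S) = encLen B D L (u :: S) ∨
      encLen B D L (w :: u :: S) = encLen B D L (u :: S) + 1 ∧
        (enc B D L (w :: u :: S)).acc = 1 := by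
  by_cases h : (enc B D L (u :: S)).acc * ((B.row w).length + 1) + (B.row w).idxOf u
      < 2 ^ (L + 1)
  · simp only [encLen]
    rw [enc_push_of_lt h]
    exact .inl rfl
  · have h' := not_lt.1 h
    simp only [encLen]
    rw [enc_push_of_le h']
    exact .inr ⟨rfl, rfl⟩

theorem encLen_le_cons (w : Fin n) (S : List (Fin n)) :
    encLen B D L S ≤ encLen B D L (w :: S) := by
  cases S with
  | nil => simp [enc, encLen]
  | cons u S => rcases (encLen_cons (B := B) (D := D) (L := L) w u S) with h | h <;> omega

theorem encLen_mono {S S' : List (Fin n)} (h : S' <:+ S) :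
    encLen B D L S' ≤ encLen B D L S := by
  induction S with
  | nil => rw [List.suffix_nil.1 h]
  | cons w S ih =>
    rcases List.suffix_cons_iff.1 h with rfl | h
    · exact le_rfl
    · exact (ih h).trans (encLen_le_cons w S)

/-- Each number of words up to the present one was first reached by some vertex on the stack. -/
theorem exists_suffix_encLen_eq {S : List (Fin n)} (hS : S ≠ []) {k : ℕ}
    (hk : k ≤ encLen B D L S) :
    ∃ w S', w :: S' <:+ S ∧ encLen B D L (w :: S') = k ∧ (S' = [] ∨ encLen B D L S' < k) ∧
      (enc B D L (w :: S')).acc = 1 := by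
  induction S with
  | nil => exact absurd rfl hS
  | cons w S ih =>
    cases S with
    | nil =>
      rw [encLen_singleton] at hk
      exact ⟨w, [], List.suffix_refl _, by rw [encLen_singleton]; omega, .inl rfl,
        by rw [enc_singleton]⟩
    | cons u S =>
      by_cases hk' : k ≤ encLen B D L (u :: S)
      · obtain ⟨w', S', h1, h2⟩ := ih (by simp) hk'
        exact ⟨w', S', h1.trans (List.suffix_cons _ _), h2⟩
      · rcases (encLen_cons (B := B) (D := D) (L := L) w u S) with h | h
        · omega
        · exact ⟨w, u :: S, List.suffix_refl _, by omega, .inr (by omega), h.2⟩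

end enc

end

section

variable {n : ℕ} {R : Fin n → Fin n → Prop}

/-! ### The part of the stack that is kept -/

/-- The working memory represents the stack `S`. The words of the encoding are grouped in segments
of `q` words. Those of segment `lo` and above are kept in the circular buffer `buf`, which has room
for two segments. For each segment, `trl` holds the vertex whose push completed the words below the
segment. -/
structure StackRep (B : AdjArrays R) (D L q : ℕ) (S : List (Fin n)) (acc len lo : ℕ)
    (buf trl : ℕ → ℕ) : Prop where
  acc_eq : (enc B D L S).acc = acc
  len_eq : encLen B D L S = len
  lo_le : lo * q ≤ len
  le_lo : len ≤ (lo + 2) * q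
  word : ∀ c ws, c :: ws <:+ (enc B D L S).words → lo * q ≤ ws.length →
    buf (ws.length % (2 * q)) = c
  trailer : ∀ w S', w :: S' <:+ S → q ∣ encLen B D L (w :: S') →
    (S' = [] ∨ encLen B D L S' < encLen B D L (w :: S')) → trl (encLen B D L (w :: S') / q) = w

namespace StackRep

variable {B : AdjArrays R} {D L q acc len lo : ℕ} {buf trl : ℕ → ℕ} {S : List (Fin n)}
  {u v w : Fin n}

theorem singleton (v : Fin n) (h : trl 0 = v) : StackRep B D L q [v] 1 0 0 buf trl where
  acc_eq := by rw [enc_singleton]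
  len_eq := encLen_singleton v
  lo_le := by simp
  le_lo := by simp
  word c ws hc := by simp [enc_singleton] at hc
  trailer w S' hs _ _ := by
    have : w :: S' = [v] := by simpa [List.suffix_cons_iff] using hs
    obtain ⟨rfl, rfl⟩ := by simpa using this
    simpa [encLen_singleton] using h

theorem push_of_lt (h : StackRep B D L q (u :: S) acc len lo buf trl)
    (hlt : acc * ((B.row w).length + 1) + (B.row w).idxOf u < 2 ^ (L + 1)) :
    StackRep B D L q (w :: u :: S) (acc * ((B.row w).length + 1) + (B.row w).idxOf u) len lo
      buf trl := by
  have he := enc_push_of_lt (B := B) (D := D) (L := L) (w := w) (u := u) (S := S)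
    (by rw [h.acc_eq]; exact hlt)
  have hl : encLen B D L (w :: u :: S) = encLen B D L (u :: S) := by rw [encLen, he]; rfl
  refine ⟨by rw [he, h.acc_eq], by rw [hl, h.len_eq], h.lo_le, h.le_lo, ?_, ?_⟩
  · intro c ws hc
    rw [he] at hc
    exact h.word c ws hc
  · intro x S' hs hd hS'
    rcases List.suffix_cons_iff.1 hs with hs' | hs'
    · obtain ⟨rfl, rfl⟩ := by simpa using hs'
      rcases hS' with hS' | hS'
      · simp at hS'
      · omega
    · exact h.trailer x S' hs' hd hS'

theorem push_of_le (hq : 1 ≤ q) (h : StackRep B D L q (u :: S) acc len lo buf trl)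
    (hle : 2 ^ (L + 1) ≤ acc * ((B.row w).length + 1) + (B.row w).idxOf u) :
    StackRep B D L q (w :: u :: S) 1 (len + 1) (max lo (len / q - 1))
      (Function.update buf (len % (2 * q)) (acc * ((B.row w).length + 1) + (B.row w).idxOf u))
      (if (len + 1) % q = 0 then Function.update trl ((len + 1) / q) w else trl) := by
  have he := enc_push_of_le (B := B) (D := D) (L := L) (w := w) (u := u) (S := S)
    (by rw [h.acc_eq]; exact hle)
  rw [h.acc_eq] at he
  have hlen : (enc B D L (u :: S)).words.length = len := h.len_eq
  have hl : encLen B D L (w :: u :: S) = len + 1 := by rw [encLen, he, List.length_cons, hlen]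
  have hdm := Nat.div_add_mod' len q
  have hmod := Nat.mod_lt len hq
  have h1 := h.lo_le
  have h2 := h.le_lo
  -- the segment that precedes the one of the new word starts at most `2 * q - 1` words below it
  have hprev : (len / q - 1) * q ≤ len ∧ len + 1 ≤ (len / q - 1 + 2) * q := by
    rcases Nat.eq_zero_or_pos (len / q) with h0 | h0
    · rw [h0] at hdm ⊢
      simp only [Nat.zero_sub, zero_mul, zero_add] at *
      omega
    · obtain ⟨k, hk⟩ := Nat.exists_eq_succ_of_ne_zero h0.ne'
      rw [hk] at hdm ⊢
      simp only [Nat.succ_eq_add_one, Nat.add_sub_cancel]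
      rw [Nat.succ_mul] at hdm
      rw [Nat.add_mul]
      omega
  have hloq : max lo (len / q - 1) * q = max (lo * q) ((len / q - 1) * q) :=
    (Nat.mul_max_mul_right ..).symm
  refine ⟨by rw [he], hl, ?_, ?_, ?_, ?_⟩
  · rw [hloq]
    have := hprev.1
    omega
  · rw [Nat.add_mul] at *
    rw [hloq]
    have := hprev.2
    omega
  · intro c ws hc hws
    rw [he] at hc
    rcases List.suffix_cons_iff.1 hc with hc' | hc'
    · obtain ⟨rfl, rfl⟩ := by simpa using hc'
      rw [hlen, Function.update_self]
    · rw [hloq] at hws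
      have h3 : ws.length < len := by
        have := hc'.length_le
        rw [List.length_cons] at this
        omega
      rw [Function.update_of_ne, h.word c ws hc' (by omega)]
      intro heq
      have h4 : 2 * q ∣ len - ws.length := (Nat.modEq_iff_dvd' h3.le).1 heq
      have h5 := Nat.le_of_dvd (by omega) h4
      have h6 := hprev.2
      rw [Nat.add_mul] at h6
      omega
  · intro x S' hs hd hS'
    rcases List.suffix_cons_iff.1 hs with hs' | hs'
    · obtain ⟨rfl, rfl⟩ := by simpa using hs'
      rw [hl] at hd ⊢
      rw [if_pos (Nat.mod_eq_zero_of_dvd hd), Function.update_self]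
    · have hmono := encLen_mono (B := B) (D := D) (L := L) hs'
      rw [h.len_eq] at hmono
      have := h.trailer x S' hs' hd hS'
      split_ifs with hm
      · rw [Function.update_of_ne, this]
        intro heq
        have hd' := Nat.dvd_of_mod_eq_zero hm
        have e1 := Nat.div_mul_cancel hd
        have e2 := Nat.div_mul_cancel hd'
        rw [heq] at e1
        omega
      · exact this

/-- Pops that have no effect on the memory. What has to be shown is that the words needed are
kept. -/
theorem suffix_tail {S' : List (Fin n)} {buf trl} (h : StackRep B D L q S acc len lo buf trl)
    (hs : S' <:+ S) {lo' : ℕ} (h1 : lo' * q ≤ encLen B D L S')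
    (h2 : encLen B D L S' ≤ (lo' + 2) * q) (hw : ∀ c ws, c :: ws <:+ (enc B D L S').words →
      lo' * q ≤ ws.length → buf (ws.length % (2 * q)) = c) :
    StackRep B D L q S' (enc B D L S').acc (encLen B D L S') lo' buf trl :=
  ⟨rfl, rfl, h1, h2, hw, fun w T hT => h.trailer w T (hT.trans hs)⟩

/-- Pop an entry from a word under construction that has one. -/
theorem pop_of_ne (h : StackRep B D L q (v :: u :: S) acc len lo buf trl) (hacc : acc ≠ 1) :
    StackRep B D L q (u :: S) (acc / ((B.row v).length + 1)) len lo buf trl ∧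
      acc % ((B.row v).length + 1) = (B.row v).idxOf u := by
  by_cases hlt : (enc B D L (u :: S)).acc * ((B.row v).length + 1) + (B.row v).idxOf u
      < 2 ^ (L + 1)
  · have he := enc_push_of_lt hlt
    have hl : encLen B D L (u :: S) = len := by rw [← h.len_eq, encLen, encLen, he]
    have ha := h.acc_eq
    rw [he] at ha
    simp only at ha
    have hx := idxOf_lt_radix (B := B) v u
    have hdiv : acc / ((B.row v).length + 1) = (enc B D L (u :: S)).acc := by
      rw [← ha, mul_comm, Nat.mul_add_div (by omega), Nat.div_eq_of_lt hx, add_zero]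
    refine ⟨?_, ?_⟩
    · have := h.suffix_tail (List.suffix_cons v (u :: S)) (lo' := lo) (by rw [hl]; exact h.lo_le)
        (by rw [hl]; exact h.le_lo) (fun c ws hc => h.word c ws (by rw [he]; exact hc))
      rwa [hl, ← hdiv] at this
    · rw [← ha, mul_comm, Nat.mul_add_mod, Nat.mod_eq_of_lt hx]
  · have he := enc_push_of_le (not_lt.1 hlt)
    have := h.acc_eq
    rw [he] at this
    exact absurd this.symm hacc

/-- An empty word under construction shows that the latest push filled a word: the radix of the
entry is at least 2, so that a push to a word that does not become full makes it at least 2. -/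
theorem full_of_acc_eq_one (h : StackRep B D L q (v :: u :: S) 1 len lo buf trl)
    (hv : 1 ≤ (B.row v).length) :
    2 ^ (L + 1) ≤ (enc B D L (u :: S)).acc * ((B.row v).length + 1) + (B.row v).idxOf u := by
  by_contra hlt
  have he := enc_push_of_lt (not_le.1 hlt)
  have ha := h.acc_eq
  rw [he] at ha
  simp only at ha
  have := one_le_acc (B := B) (D := D) (L := L) (u :: S)
  nlinarith

/-- Pop an entry from the last full word, if this word is kept. -/
theorem pop_of_eq (h : StackRep B D L q (v :: u :: S) 1 len lo buf trl)
    (hv : 1 ≤ (B.row v).length) (hlo : lo * q ≠ len) :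
    1 ≤ len ∧ StackRep B D L q (u :: S)
      (buf ((len - 1) % (2 * q)) / ((B.row v).length + 1)) (len - 1) lo buf trl ∧
      buf ((len - 1) % (2 * q)) % ((B.row v).length + 1) = (B.row v).idxOf u := by
  have he := enc_push_of_le (h.full_of_acc_eq_one hv)
  have hl : encLen B D L (u :: S) + 1 = len := by rw [← h.len_eq, encLen, encLen, he]; rfl
  have h1 := h.lo_le
  have h2 := h.le_lo
  have hb := h.word _ _ (by rw [he]) (by rw [encLen] at hl; omega)
  have hl' : (enc B D L (u :: S)).words.length = len - 1 := by rw [encLen] at hl; omega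
  rw [hl'] at hb
  have hx := idxOf_lt_radix (B := B) v u
  rw [hb, mul_comm, Nat.mul_add_mod, Nat.mod_eq_of_lt hx, Nat.mul_add_div (by omega),
    Nat.div_eq_of_lt hx, add_zero]
  refine ⟨by omega, ?_, rfl⟩
  have := h.suffix_tail (List.suffix_cons v (u :: S)) (lo' := lo) (by omega)
    (by omega) (fun c ws hc => h.word c ws (by rw [he]; exact hc.trans (List.suffix_cons _ _)))
  rwa [show encLen B D L (u :: S) = len - 1 by omega] at this

/-- If the words kept have all been popped, then the words of the segment `lo - 1` can be computed
again, starting from its trailer `w`: the vertices above `w` are those whose entries belong to the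
segment. -/
theorem exists_restart (hq : 1 ≤ q) (h : StackRep B D L q (v :: u :: S) 1 len lo buf trl)
    (hv : 1 ≤ (B.row v).length) (hlo : lo * q = len) :
    ∃ w S', 1 ≤ lo ∧ w :: S' <:+ u :: S ∧ trl (lo - 1) = w ∧
      StackRep B D L q (w :: S') 1 ((lo - 1) * q) (lo - 1) buf trl ∧
      ∀ y x S₁, y :: x :: S₁ <:+ v :: u :: S →
        (encLen B D L (x :: S₁) / q = lo - 1 ↔ w :: S' <:+ x :: S₁) := by
  have he := enc_push_of_le (h.full_of_acc_eq_one hv)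
  have hl : encLen B D L (u :: S) + 1 = len := by rw [← h.len_eq, encLen, encLen, he]; rfl
  obtain ⟨j, rfl⟩ : ∃ j, lo = j + 1 := ⟨lo - 1, by
    rcases Nat.eq_zero_or_pos lo with h0 | h0
    · rw [h0] at hlo; omega
    · omega⟩
  rw [Nat.succ_mul] at hlo
  simp only [Nat.add_sub_cancel]
  obtain ⟨w, S', hs, hk, hS', ha⟩ := exists_suffix_encLen_eq (B := B) (D := D) (L := L)
    (S := u :: S) (by simp) (k := j * q) (by omega)
  have hs' : w :: S' <:+ v :: u :: S := hs.trans (List.suffix_cons _ _)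
  refine ⟨w, S', by omega, hs, ?_, ?_, ?_⟩
  · have := h.trailer w S' hs' (by rw [hk]; exact Dvd.intro_left j rfl) (by rwa [hk])
    rwa [hk, Nat.mul_div_cancel _ (by omega)] at this
  · have := h.suffix_tail hs' (lo' := j) hk.ge (by rw [hk, Nat.add_mul]; omega) (by
      intro c ws hc hws
      have := hc.length_le
      rw [List.length_cons] at this
      rw [encLen] at hk
      omega)
    rwa [ha, hk] at this
  · intro y x S₁ hy
    have hx : x :: S₁ <:+ u :: S := by
      rcases List.suffix_cons_iff.1 hy with hy' | hy'
      · rw [(List.cons.inj hy').2]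
      · exact (List.suffix_cons _ _).trans hy'
    have hlt := encLen_mono (B := B) (D := D) (L := L) hx
    constructor
    · intro hj
      rcases List.suffix_or_suffix_of_suffix hs hx with h' | h'
      · exact h'
      · rcases List.suffix_cons_iff.1 h' with h'' | h''
        · rw [h'']
        · have h3 := encLen_mono (B := B) (D := D) (L := L) h''
          rcases hS' with rfl | hS'
          · simp at h''
          · have := Nat.div_lt_of_lt_mul (k := j) (n := q) (m := encLen B D L (x :: S₁))
              (by rw [mul_comm]; omega)
            omega
    · intro hw
      have h3 := encLen_mono (B := B) (D := D) (L := L) hw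
      apply Nat.div_eq_of_lt_le
      · omega
      · rw [Nat.succ_mul]; omega

end StackRep

/-! ### The number of restorations -/

/-- The invariant that bounds the number `k` of restorations. The vertices popped so far, of total
weight `W`, account for the words of the segments restored, and, together with those in the word
under construction, of weight `wt`, for the words popped from the lowest segment kept since that
segment became the lowest one. -/
def Paid (q L k W len lo wt : ℕ) : Prop :=
  (k * q + ((lo + 1) * q - len)) * L ≤ W + if (lo + 1) * q ≤ len then 0 else min L wt

namespace Paid

variable {q L k W len lo wt : ℕ}

/-- A push that does not fill a word. -/
theorem push_of_lt (h : Paid q L k W len lo wt) (a : ℕ) : Paid q L k W len lo (wt + a) := by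
  rw [Paid] at *
  split_ifs at * <;> omega

/-- A push that fills a word. If this raises `lo`, then the new lowest segment is full. -/
theorem push_of_le (h : Paid q L k W len lo wt) :
    Paid q L k W (len + 1) (max lo (len / q - 1)) 0 := by
  rw [Paid] at *
  by_cases hl : len / q - 1 ≤ lo
  · rw [max_eq_left hl]
    by_cases h1 : (lo + 1) * q ≤ len
    · rw [if_pos h1, Nat.sub_eq_zero_of_le h1] at h
      rw [if_pos (by omega), Nat.sub_eq_zero_of_le (by omega)]
      exact h
    · rw [if_neg h1] at h
      obtain ⟨d, hd⟩ : ∃ d, (lo + 1) * q - len = d + 1 := ⟨(lo + 1) * q - len - 1, by omega⟩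
      rw [show (lo + 1) * q - (len + 1) = d by omega]
      rw [hd, ← add_assoc, Nat.succ_mul] at h
      omega
  · rw [max_eq_right (by omega)]
    have hdm := Nat.div_mul_le_self len q
    have h1 : (lo + 1) * q ≤ len := (Nat.mul_le_mul_right q (by omega)).trans hdm
    have h2 : (len / q - 1 + 1) * q ≤ len := by rwa [show len / q - 1 + 1 = len / q by omega]
    rw [if_pos h1, Nat.sub_eq_zero_of_le h1] at h
    rw [if_pos (by omega), Nat.sub_eq_zero_of_le (by omega)]
    exact h

/-- A pop from a word under construction that has an entry. -/
theorem pop {a : ℕ} (h : Paid q L k W len lo (wt + a)) : Paid q L k (W + a) len lo wt := by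
  rw [Paid] at *
  split_ifs at * <;> omega

/-- A pop from a full word. The weight `wt + a` of its entries is at least `L`. -/
theorem pop_of_full {a : ℕ} (hfull : L ≤ wt + a) (hlen : 1 ≤ len) (h : Paid q L k W len lo 0) :
    Paid q L k (W + a) (len - 1) lo wt := by
  rw [Paid] at *
  obtain ⟨l, rfl⟩ : ∃ l, len = l + 1 := ⟨len - 1, by omega⟩
  simp only [Nat.add_sub_cancel]
  by_cases h1 : (lo + 1) * q ≤ l
  · rw [if_pos (by omega), Nat.sub_eq_zero_of_le (by omega)] at h
    rw [if_pos h1, Nat.sub_eq_zero_of_le h1]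
    omega
  · rw [if_neg h1]
    obtain ⟨d, hd⟩ : ∃ d, (lo + 1) * q - (l + 1) = d := ⟨_, rfl⟩
    rw [show (lo + 1) * q - l = d + 1 by omega, ← add_assoc, Nat.succ_mul]
    rw [hd] at h
    split_ifs at h <;> omega

/-- When the words kept have all been popped, the weight popped pays for one more restoration. -/
theorem restore (h : Paid q L k W len lo 0) (hlo : 1 ≤ lo) (hlen : lo * q = len) :
    Paid q L (k + 1) W len (lo - 1) 0 := by
  rw [Paid] at *
  obtain ⟨j, rfl⟩ : ∃ j, lo = j + 1 := ⟨lo - 1, by omega⟩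
  simp only [Nat.add_sub_cancel]
  rw [if_pos hlen.le, hlen, Nat.sub_self]
  rw [Nat.succ_mul (j + 1) q, hlen, Nat.add_sub_cancel_left] at h
  rw [Nat.succ_mul k, add_zero]
  split_ifs at h <;> simpa using h

end Paid

end

section

variable {n : ℕ} {R : Fin n → Fin n → Prop}

/-! ### Depth-first search that explores the edges of each vertex in array order -/

theorem SearchRun.trans {V : Type} {Adj : V → V → Prop} {σ τ ρ : SearchState V}
    {e f : List (Event V)} (h : SearchRun Adj σ e τ) (h' : SearchRun Adj τ f ρ) :
    SearchRun Adj σ (e ++ f) ρ := by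
  induction h with
  | nil => exact h'
  | cons σ τ' _ e₁ e₂ hs _ ih =>
    rw [List.append_assoc]
    exact .cons _ _ _ _ _ hs (ih h')

theorem SearchRun.snoc {V : Type} {Adj : V → V → Prop} {σ τ ρ : SearchState V}
    {e f : List (Event V)} (h : SearchRun Adj σ e τ) (h' : SearchStep Adj τ f ρ) :
    SearchRun Adj σ (e ++ f) ρ := by
  have := h.trans (.cons _ _ _ _ _ h' (.nil _))
  rwa [List.append_nil] at this

/-- The edges explored if each vertex `v` has explored the first `e v` edges of its array. -/
def exploredSet (A : AdjArrays R) (e : Fin n → ℕ) : Set (Fin n × Fin n) :=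
  {p | R p.1 p.2 ∧ (A.row p.1).idxOf p.2 < e p.1}

/-- A search in progress: its stack `S`, its set `disc` of discovered vertices, the numbers `e v` of
edges explored, and the events `tr` so far. -/
structure Searching (A : AdjArrays R) (S : List (Fin n)) (disc : Finset (Fin n))
    (e : Fin n → ℕ) (tr : List (Event (Fin n))) : Prop where
  run : SearchRun R ⟨[], ∅, ∅⟩ tr ⟨S, ↑disc, exploredSet A e⟩
  nodup : S.Nodup
  subset : ∀ v ∈ S, v ∈ disc
  white : ∀ v, v ∉ disc → e v = 0
  le_deg : ∀ v, e v ≤ (A.row v).length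
  head_mem : ∀ v x, R v x → (A.row v).idxOf x < e v → x ∈ disc
  chain : ∀ w u S', w :: u :: S' <:+ S → R u w ∧ e u = (A.row u).idxOf w + 1
  /-- The neighbors of `u` that precede its child and are still on the stack lie below the child. -/
  below : ∀ w u S', w :: u :: S' <:+ S → ∀ x, R u x → (A.row u).idxOf x < (A.row u).idxOf w →
    x ∈ S → x ∈ u :: S'

section rows

variable (A : AdjArrays R)

theorem idxOf_row_getElem (v : Fin n) (i : ℕ) (hi : i < (A.row v).length) :
    (A.row v).idxOf (A.row v)[i] = i :=
  (A.nodup v).idxOf_getElem i hi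

theorem getElem_idxOf_row (v x : Fin n) (h : R v x) :
    ∃ hi : (A.row v).idxOf x < (A.row v).length, (A.row v)[(A.row v).idxOf x] = x :=
  ⟨List.idxOf_lt_length_of_mem ((A.mem_iff v x).2 h), List.getElem_idxOf _⟩

theorem rel_getElem (v : Fin n) (i : ℕ) (hi : i < (A.row v).length) : R v (A.row v)[i] :=
  (A.mem_iff _ _).1 (List.getElem_mem hi)

theorem exploredSet_update {v : Fin n} {e : Fin n → ℕ} (hi : e v < (A.row v).length) :
    exploredSet A (Function.update e v (e v + 1)) =
      insert (v, (A.row v)[e v]) (exploredSet A e) := by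
  ext ⟨a, x⟩
  simp only [exploredSet, Set.mem_ofPred_eq, Set.mem_insert_iff, Prod.mk.injEq]
  by_cases ha : a = v
  · subst ha
    simp only [Function.update_self, true_and]
    constructor
    · rintro ⟨h1, h2⟩
      rcases Nat.lt_succ_iff_lt_or_eq.1 h2 with h3 | h3
      · exact .inr ⟨h1, h3⟩
      · left
        obtain ⟨h4, h5⟩ := getElem_idxOf_row A a x h1
        rw [← h5]
        congr 1
    · rintro (rfl | ⟨h1, h2⟩)
      · exact ⟨rel_getElem A a _ hi, by rw [idxOf_row_getElem]; omega⟩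
      · exact ⟨h1, by omega⟩
  · simp [ha]

theorem not_mem_exploredSet {v : Fin n} {e : Fin n → ℕ} (hi : e v < (A.row v).length) :
    (v, (A.row v)[e v]) ∉ exploredSet A e := by
  simp [exploredSet, idxOf_row_getElem]

theorem mem_exploredSet_of_le {v : Fin n} {e : Fin n → ℕ} (hi : (A.row v).length ≤ e v) :
    ∀ w, R v w → (v, w) ∈ exploredSet A e := by
  intro w hw
  have := (getElem_idxOf_row A v w hw).1
  exact ⟨hw, by simp only; omega⟩

/-- A neighbor among the first `e v + 1` ones is the last of these or among the first `e v`. -/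
theorem idxOf_lt_succ {v x : Fin n} {i : ℕ} (hi : i < (A.row v).length) (hx : R v x)
    (h : (A.row v).idxOf x < i + 1) : (A.row v).idxOf x < i ∨ x = (A.row v)[i] := by
  rcases Nat.lt_succ_iff_lt_or_eq.1 h with h | h
  · exact .inl h
  · right
    obtain ⟨h1, h2⟩ := getElem_idxOf_row A v x hx
    rw [← h2]
    congr 1

end rows

namespace Searching

variable {A : AdjArrays R} {S : List (Fin n)} {disc : Finset (Fin n)} {e : Fin n → ℕ}
  {tr : List (Event (Fin n))} {v u : Fin n}

theorem init (A : AdjArrays R) : Searching A [] ∅ (fun _ => 0) [] where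
  run := by
    have : exploredSet A (fun _ => 0) = ∅ := by ext; simp [exploredSet]
    rw [this, Finset.coe_empty]
    exact .nil _
  nodup := List.nodup_nil
  subset := by simp
  white := by simp
  le_deg := by simp
  head_mem := by simp
  chain := by simp
  below := by simp

theorem root (h : Searching A [] disc e tr) (hv : v ∉ disc) :
    Searching A [v] (insert v disc) e (tr ++ [.preprocess v]) where
  run := by
    have := h.run.snoc (.root _ _ v (by simpa using hv))
    rwa [Finset.coe_insert]
  nodup := List.nodup_singleton v
  subset := by simp
  white x hx := h.white x (fun hh => hx (Finset.mem_insert_of_mem hh))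
  le_deg := h.le_deg
  head_mem x y h1 h2 := Finset.mem_insert_of_mem (h.head_mem x y h1 h2)
  chain w u S' hs := by
    have := hs.length_le
    simp at this
  below w u S' hs := by
    have := hs.length_le
    simp at this

theorem backEdge (h : Searching A (v :: S) disc e tr) (hi : e v < (A.row v).length)
    (hw : (A.row v)[e v] ∈ disc) :
    Searching A (v :: S) disc (Function.update e v (e v + 1))
      (tr ++ [.handleBackEdge v (A.row v)[e v]]) where
  run := by
    rw [exploredSet_update A hi]
    exact h.run.snoc (.backEdge _ _ _ _ _ (rel_getElem A v _ hi) (not_mem_exploredSet A hi) hw)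
  nodup := h.nodup
  subset := h.subset
  white x hx := by
    rw [Function.update_of_ne, h.white x hx]
    rintro rfl
    exact hx (h.subset x (by simp))
  le_deg x := by
    rw [Function.update_apply]
    split_ifs with hx
    · subst hx; omega
    · exact h.le_deg x
  head_mem a x h1 h2 := by
    by_cases ha : a = v
    · subst ha
      rw [Function.update_self] at h2
      rcases idxOf_lt_succ A hi h1 h2 with h3 | rfl
      · exact h.head_mem _ _ h1 h3
      · exact hw
    · rw [Function.update_of_ne ha] at h2
      exact h.head_mem a x h1 h2
  chain w u S' hs := by
    have hc := h.chain w u S' hs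
    refine ⟨hc.1, ?_⟩
    rw [Function.update_of_ne, hc.2]
    rintro rfl
    have h1 := h.nodup
    rcases List.suffix_cons_iff.1 hs with hs' | hs'
    · obtain ⟨rfl, rfl⟩ := List.cons.inj hs'
      simp at h1
    · have : u ∈ S := hs'.subset (by simp)
      exact (List.nodup_cons.1 h1).1 this
  below := h.below

theorem treeEdge (h : Searching A (v :: S) disc e tr) (hi : e v < (A.row v).length)
    (hw : (A.row v)[e v] ∉ disc) :
    Searching A ((A.row v)[e v] :: v :: S) (insert (A.row v)[e v] disc)
      (Function.update e v (e v + 1))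
      (tr ++ [.exploreTreeEdge v (A.row v)[e v], .preprocess (A.row v)[e v]]) where
  run := by
    rw [exploredSet_update A hi, Finset.coe_insert]
    exact h.run.snoc (.treeEdge _ _ _ _ _ (rel_getElem A v _ hi) (not_mem_exploredSet A hi)
      (by simpa using hw))
  nodup := List.nodup_cons.2 ⟨fun hh => hw (h.subset _ hh), h.nodup⟩
  subset x hx := by
    rcases List.mem_cons.1 hx with rfl | hx
    · exact Finset.mem_insert_self _ _
    · exact Finset.mem_insert_of_mem (h.subset x hx)
  white x hx := by
    rw [Finset.mem_insert, not_or] at hx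
    rw [Function.update_of_ne, h.white x hx.2]
    rintro rfl
    exact hx.2 (h.subset x (by simp))
  le_deg x := by
    rw [Function.update_apply]
    split_ifs with hx
    · subst hx; omega
    · exact h.le_deg x
  head_mem a x h1 h2 := by
    by_cases ha : a = v
    · subst ha
      rw [Function.update_self] at h2
      rcases idxOf_lt_succ A hi h1 h2 with h3 | rfl
      · exact Finset.mem_insert_of_mem (h.head_mem _ _ h1 h3)
      · exact Finset.mem_insert_self _ _
    · rw [Function.update_of_ne ha] at h2
      exact Finset.mem_insert_of_mem (h.head_mem a x h1 h2)
  chain w u S' hs := by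
    rcases List.suffix_cons_iff.1 hs with hs' | hs'
    · obtain ⟨rfl, hs''⟩ := List.cons.inj hs'
      obtain ⟨rfl, rfl⟩ := List.cons.inj hs''
      exact ⟨rel_getElem A u _ hi, by rw [Function.update_self, idxOf_row_getElem]⟩
    · have hc := h.chain w u S' hs'
      refine ⟨hc.1, ?_⟩
      rw [Function.update_of_ne, hc.2]
      rintro rfl
      have h1 := h.nodup
      rcases List.suffix_cons_iff.1 hs' with hs'' | hs''
      · obtain ⟨rfl, rfl⟩ := List.cons.inj hs''
        simp at h1
      · have : u ∈ S := hs''.subset (by simp)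
        exact (List.nodup_cons.1 h1).1 this
  below w u S' hs x hx hlt hxS := by
    rcases List.suffix_cons_iff.1 hs with hs' | hs'
    · obtain ⟨rfl, hs''⟩ := List.cons.inj hs'
      obtain ⟨rfl, rfl⟩ := List.cons.inj hs''
      rcases List.mem_cons.1 hxS with rfl | hxS
      · exact absurd hlt (lt_irrefl _)
      · exact hxS
    · have hc := h.chain w u S' hs'
      rcases List.mem_cons.1 hxS with rfl | hxS
      · exact absurd (h.head_mem u _ hx (by omega)) hw
      · exact h.below w u S' hs' x hx hlt hxS

theorem retreat (h : Searching A (v :: u :: S) disc e tr) (hi : (A.row v).length ≤ e v) :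
    Searching A (u :: S) disc e (tr ++ [.postprocess v, .retreatTreeEdge u v]) where
  run := h.run.snoc (.retreat _ _ _ _ _ (mem_exploredSet_of_le A hi))
  nodup := (List.nodup_cons.1 h.nodup).2
  subset x hx := h.subset x (List.mem_cons_of_mem _ hx)
  white := h.white
  le_deg := h.le_deg
  head_mem := h.head_mem
  chain w u' S' hs := h.chain w u' S' (hs.trans (List.suffix_cons _ _))
  below w u' S' hs x hx hlt hxS :=
    h.below w u' S' (hs.trans (List.suffix_cons _ _)) x hx hlt (List.mem_cons_of_mem _ hxS)

theorem finishRoot (h : Searching A [v] disc e tr) (hi : (A.row v).length ≤ e v) :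
    Searching A [] disc e (tr ++ [.postprocess v]) where
  run := h.run.snoc (.finishRoot _ _ _ (mem_exploredSet_of_le A hi))
  nodup := List.nodup_nil
  subset := by simp
  white := h.white
  le_deg := h.le_deg
  head_mem := h.head_mem
  chain := by simp
  below := by simp

end Searching

end

section

/-! ### The program -/

section program

variable {Q : Type}

open SpaceDFS.Expr

/-- The entry of number `e` of the packed array at address `base`. The array `grp` starts at
address `grpB`, and the array `col` of colors at address 0. -/
def fld (base e : Expr Q) : Expr Q :=
  bin .shr (ld (base + e / var .per)) (e % var .per * var .bits) % var .pow

/-- Assignment to an entry of a packed array. -/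
def setFld (base e a : Expr Q) : Prog Q 36 :=
  sto (base + e / var .per) (bin .xor (ld (base + e / var .per))
    (bin .shl (bin .xor (fld base e) a) (e % var .per * var .bits)))

variable (f : DQuery → Q)

/-- Push an entry `pos` for the vertex `nb`. If this fills the word under construction, the word
goes to the circular buffer, possibly overwriting a word of the lowest segment kept, which is then
given up. If it also completes a segment, then `nb` is the trailer of the next one. -/
def pushEntry : Prog Q 36 := block [
  asg .acc (var .acc * (qry (f .inDeg) (var .nb) 0 + 1) + var .pos),
  ite' (.lt (var .acc) (var .N)) (block []) (block [
    sto (var .bufB + var .len % (2 * var .q)) (var .acc),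
    ite' (.lt (var .lo + 1) (var .len / var .q)) (asg .lo (var .len / var .q - 1)) (block []),
    asg .acc 1,
    asg .len (var .len + 1),
    ite' (.eq (var .len % var .q) 0) (sto (var .trlB + var .len / var .q) (var .nb)) (block [])])]

/-- Starting from the approximate position stored for the vertex `low`, find the position of its
child, which is the first neighbor with the color of segment `seg`. -/
def findChild : Prog Q 36 := block [
  asg .ctr (fld (var .grpB) (var .low) * (qry (f .outDeg) (var .low) 0 / var .D + 1)),
  while' (.lt 0 (bin .xor (fld 0 (qry (f .outHead) (var .low) (var .ctr))) (4 + var .seg)))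
    (asg .ctr (var .ctr + 1))]

/-- Compute the words of a segment again, walking up the stack from its trailer to the current
vertex. The vertices passed are marked with color 2. -/
def climb : Prog Q 36 := while' (.lt 0 (bin .xor (var .low) (var .cur))) (block [
  findChild f,
  asg .nb (qry (f .outHead) (var .low) (var .ctr)),
  asg .pos (qry (f .outMate) (var .low) (var .ctr)),
  pushEntry f,
  setFld 0 (var .nb) 2,
  asg .low (var .nb)])

/-- Give all marked vertices the color of segment `seg` again. -/
def unmark : Prog Q 36 := block [
  asg .ctr 0,
  while' (.lt (var .ctr) (var .n)) (block [
    ite' (.eq (fld 0 (var .ctr)) 2) (setFld 0 (var .ctr) (4 + var .seg)) (block []),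
    asg .ctr (var .ctr + 1)])]

/-- Restore the segment below the lowest one kept. -/
def restore : Prog Q 36 := block [
  asg .seg (var .lo - 1),
  asg .lo (var .seg),
  asg .len (var .len - var .q),
  asg .low (ld (var .trlB + var .seg)),
  climb f,
  unmark]

/-- Provide a word under construction that is not empty: if there is no entry in it, fetch the last
full word, for which the segment of this word has to be restored if it is not kept. -/
def fetch : Prog Q 36 := ite' (.eq (var .acc) 1)
  (block [
    ite' (.eq (var .len) (var .lo * var .q)) (restore f) (block []),
    asg .len (var .len - 1),
    asg .acc (ld (var .bufB + var .len % (2 * var .q)))])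
  (block [])

/-- Pop the entry of the current vertex, and compute its parent and the position there. -/
def popEntry : Prog Q 36 := block [
  fetch f,
  asg .pos (var .acc % (qry (f .inDeg) (var .cur) 0 + 1)),
  asg .acc (var .acc / (qry (f .inDeg) (var .cur) 0 + 1)),
  asg .low (qry (f .inHead) (var .cur) (var .pos)),
  asg .idx (qry (f .inMate) (var .cur) (var .pos))]

/-- Explore an edge to a new vertex. The current vertex memorizes the group of positions of the
edge, and the color of the new vertex tells the segment that its entry belongs to. -/
def descend : Prog Q 36 := block [
  say (.exploreTreeEdge .cur .nb),
  say (.preprocess .nb),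
  setFld (var .grpB) (var .cur)
    (var .idx / (qry (f .outDeg) (var .cur) 0 / var .D + 1)),
  setFld 0 (var .nb) (4 + var .len / var .q),
  asg .pos (qry (f .outMate) (var .cur) (var .idx)),
  pushEntry f,
  asg .cur (var .nb),
  asg .idx 0]

/-- Withdraw from the current vertex to its parent. -/
def ascend : Prog Q 36 := block [
  popEntry f,
  setFld 0 (var .cur) 1,
  say (.retreatTreeEdge .low .cur),
  asg .cur (var .low),
  asg .idx (var .idx + 1)]

/-- One move of the search: explore the next edge of the current vertex, or withdraw from it. Color
0 is for undiscovered vertices, 1 for finished ones, 3 for the root. -/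
def move : Prog Q 36 := ite' (.lt (var .idx) (qry (f .outDeg) (var .cur) 0))
  (block [
    asg .nb (qry (f .outHead) (var .cur) (var .idx)),
    ite' (.eq (fld 0 (var .nb)) 0) (descend f)
      (block [say (.handleBackEdge .cur .nb), asg .idx (var .idx + 1)])])
  (block [
    say (.postprocess .cur),
    ite' (.eq (var .cur) (var .root)) (block [setFld 0 (var .cur) 1, asg .fin 1]) (ascend f)])

/-- Search from the root `start`. -/
def searchFrom : Prog Q 36 := block [
  asg .cur (var .start),
  asg .root (var .start),
  asg .idx 0,
  asg .fin 0,
  asg .acc 1,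
  asg .len 0,
  asg .lo 0,
  sto (var .trlB) (var .start),
  setFld 0 (var .start) 3,
  say (.preprocess .cur),
  while' (.lt (var .fin) 1) (move f)]

/-- The whole search, after the computation of the sizes. -/
def searchAll : Prog Q 36 := block [
  asg .start 0,
  while' (.lt (var .start) (var .n)) (block [
    ite' (.eq (fld 0 (var .start)) 0) (searchFrom f) (block []),
    asg .start (var .start + 1)])]

/-- Compute the number `x` of bits of the value of `e`, and `y = 2 ^ x`. -/
def sizeOf' (x y : Var) (e : Expr Q) : Prog Q 36 := block [
  asg x 0,
  asg y 1,
  while' (.lt (var y) (e + 1)) (block [asg x (var x + 1), asg y (var y * 2)])]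

/-- Compute the sum of all outdegrees. -/
def countEdges : Prog Q 36 := block [
  asg .ctr 0,
  asg .total 0,
  while' (.lt (var .ctr) (var .n)) (block [
    asg .total (var .total + qry (f .outDeg) (var .ctr) 0),
    asg .ctr (var .ctr + 1)])]

/-- Compute all sizes that do not change during the search. -/
def setup : Prog Q 36 := block [
  countEdges f,
  sizeOf' .lg .N (var .n),
  asg .N (var .N * 2),
  sizeOf' .D .aux (var .total / var .n + 2),
  sizeOf' .bits .pow (var .D + 5),
  asg .per (var .lg / var .bits + 1),
  asg .grpB (var .n / var .per + 1),
  asg .q (var .n / var .lg + 1),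
  asg .bufB (2 * var .grpB),
  asg .trlB (var .bufB + 2 * var .q)]

/-- Depth-first search. -/
def dfs : Prog Q 36 := .seq (setup f) (searchAll f)

end program

/-! ### Sizes and access to the input -/

/-- The sizes on which the layout of the memory depends: the width `bits` of the fields of packed
arrays and the number `per` of fields in a word, a bound `D` for the number of groups of positions
of each vertex and for the number of segments, the number `q` of words in a segment, and the number
`lg` of bits of a full word. -/
structure Sizes : Type where
  bits : ℕ
  per : ℕ
  D : ℕ
  q : ℕ
  lg : ℕ

namespace Sizes

/-- The address of the second packed array. -/
def grpB (z : Sizes) (n : ℕ) : ℕ := n / z.per + 1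

/-- The address of the circular buffer. -/
def bufB (z : Sizes) (n : ℕ) : ℕ := 2 * z.grpB n

/-- The address of the array of trailers. -/
def trlB (z : Sizes) (n : ℕ) : ℕ := z.bufB n + 2 * z.q

/-- The number of words of memory used. -/
def bound (z : Sizes) (n : ℕ) : ℕ := z.trlB n + z.D + 2

end Sizes

/-- The variables that are set once and for all before the search. -/
@[simp] def Var.isConst : Var → Bool
  | .n | .bits | .pow | .per | .D | .q | .N | .grpB | .bufB | .trlB => true
  | _ => false

/-- The values of these variables. -/
def Sizes.val (z : Sizes) (n : ℕ) : Var → ℕ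
  | .n => n
  | .bits => z.bits
  | .pow => 2 ^ z.bits
  | .per => z.per
  | .D => z.D
  | .q => z.q
  | .N => 2 ^ (z.lg + 1)
  | .grpB => z.grpB n
  | .bufB => z.bufB n
  | .trlB => z.trlB n
  | _ => 0

/-- The variables for sizes have the values that they should have. -/
def Fixed (z : Sizes) (n : ℕ) (h : State) : Prop :=
  ∀ x : Var, x.isConst = true → h.reg x = z.val n x

namespace Fixed

variable {z : Sizes} {n : ℕ} {h : State}

theorem n_eq (hf : Fixed z n h) : h.reg .n = n := hf .n rfl
theorem bits_eq (hf : Fixed z n h) : h.reg .bits = z.bits := hf .bits rfl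
theorem pow_eq (hf : Fixed z n h) : h.reg .pow = 2 ^ z.bits := hf .pow rfl
theorem per_eq (hf : Fixed z n h) : h.reg .per = z.per := hf .per rfl
theorem D_eq (hf : Fixed z n h) : h.reg .D = z.D := hf .D rfl
theorem q_eq (hf : Fixed z n h) : h.reg .q = z.q := hf .q rfl
theorem N_eq (hf : Fixed z n h) : h.reg .N = 2 ^ (z.lg + 1) := hf .N rfl
theorem grpB_eq (hf : Fixed z n h) : h.reg .grpB = z.grpB n := hf .grpB rfl
theorem bufB_eq (hf : Fixed z n h) : h.reg .bufB = z.bufB n := hf .bufB rfl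
theorem trlB_eq (hf : Fixed z n h) : h.reg .trlB = z.trlB n := hf .trlB rfl

theorem of_reg {h' : State} (hf : Fixed z n h)
    (hr : ∀ x : Var, x.isConst = true → h'.reg x = h.reg x) : Fixed z n h' :=
  fun x hx => (hr x hx).trans (hf x hx)

theorem set (hf : Fixed z n h) {x : Var} {a : ℕ} (hx : x.isConst = false) :
    Fixed z n (h.set x a) := by
  refine hf.of_reg fun y hy => ?_
  rw [State.set_reg, if_neg]
  rintro rfl
  exact absurd (hx.symm.trans hy) (by decide)

end Fixed

variable {n : ℕ} {R : Fin n → Fin n → Prop} {Q : Type}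

/-- The access functions give access to the arrays `A` of outneighbors and `B` of inneighbors. -/
structure Input (ac : Q → ℕ → ℕ → ℕ) (f : DQuery → Q) (A : AdjArrays R)
    (B : AdjArrays fun v u => R u v) : Prop where
  outDeg : ∀ u i, ac (f .outDeg) u i = A.deg u
  outHead : ∀ u i, ac (f .outHead) u i = A.head u i
  outMate : ∀ u i, ac (f .outMate) u i = A.mate B u i
  inDeg : ∀ u i, ac (f .inDeg) u i = B.deg u
  inHead : ∀ u i, ac (f .inHead) u i = B.head u i
  inMate : ∀ u i, ac (f .inMate) u i = B.mate A u i

namespace AdjArrays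

theorem nrow_fin (A : AdjArrays R) (v : Fin n) : A.nrow v = (A.row v).map Fin.val := by
  simp [nrow]

theorem deg_fin (A : AdjArrays R) (v : Fin n) : A.deg v = (A.row v).length := by
  simp [deg, nrow_fin]

theorem head_fin (A : AdjArrays R) (v : Fin n) {i : ℕ} (hi : i < (A.row v).length) :
    A.head v i = ((A.row v)[i] : Fin n) := by
  rw [head, nrow_fin, List.getD_eq_getElem _ _ (by simpa using hi), List.getElem_map]

theorem idxOf_map_val (l : List (Fin n)) (v : Fin n) :
    (l.map Fin.val).idxOf (v : ℕ) = l.idxOf v := by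
  induction l with
  | nil => simp
  | cons a l ih => simp only [List.map_cons, List.idxOf_cons, ih, beq_eq_decide, Fin.val_inj]

theorem mate_fin {R' : Fin n → Fin n → Prop} (A : AdjArrays R) (B : AdjArrays R') (v : Fin n)
    {i : ℕ} (hi : i < (A.row v).length) : A.mate B v i = (B.row (A.row v)[i]).idxOf v := by
  rw [mate, deg_fin, if_pos hi, head_fin A v hi, nrow_fin, idxOf_map_val]

theorem length_row_le (A : AdjArrays R) (v : Fin n) : (A.row v).length ≤ n := by
  simpa using (A.nodup v).length_le_card

end AdjArrays

namespace Input

variable {ac : Q → ℕ → ℕ → ℕ} {f : DQuery → Q} {A : AdjArrays R} {B : AdjArrays fun v u => R u v}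

theorem outDeg_fin (h : Input ac f A B) (v : Fin n) (i : ℕ) :
    ac (f .outDeg) v i = (A.row v).length := by rw [h.outDeg, A.deg_fin]

theorem inDeg_fin (h : Input ac f A B) (v : Fin n) (i : ℕ) :
    ac (f .inDeg) v i = (B.row v).length := by rw [h.inDeg, B.deg_fin]

theorem outHead_fin (h : Input ac f A B) (v : Fin n) {i : ℕ} (hi : i < (A.row v).length) :
    ac (f .outHead) v i = ((A.row v)[i] : Fin n) := by rw [h.outHead, A.head_fin v hi]

theorem outMate_fin (h : Input ac f A B) (v : Fin n) {i : ℕ} (hi : i < (A.row v).length) :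
    ac (f .outMate) v i = (B.row (A.row v)[i]).idxOf v := by rw [h.outMate, A.mate_fin B v hi]

theorem inHead_idxOf (h : Input ac f A B) {u v : Fin n} (huv : R u v) :
    ac (f .inHead) v ((B.row v).idxOf u) = u := by
  obtain ⟨h1, h2⟩ := getElem_idxOf_row B v u huv
  rw [h.inHead, B.head_fin v h1, h2]

theorem inMate_idxOf (h : Input ac f A B) {u v : Fin n} (huv : R u v) :
    ac (f .inMate) v ((B.row v).idxOf u) = (A.row u).idxOf v := by
  obtain ⟨h1, h2⟩ := getElem_idxOf_row B v u huv
  rw [h.inMate, B.mate_fin A v h1, h2]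

end Input

/-- What the correctness proof needs to know about the sizes, for words of `w` bits. By `n_le`, a
segment of `q` words accounts for a weight of at least `n`, so that there are few segments. -/
structure Sizes.Valid (z : Sizes) (w : ℕ) (B : AdjArrays fun v u => R u v) :
    Prop where
  q_pos : 1 ≤ z.q
  lg_pos : 1 ≤ z.lg
  D_pos : 1 ≤ z.D
  n_lt : n + 1 ≤ 2 ^ z.lg
  n_le : n ≤ z.q * z.lg
  weight_le : ∑ v, weight B z.D v ≤ n * (z.D + 1)
  D_lt : z.D + 5 < 2 ^ z.bits
  bits_le : z.bits ≤ w
  per_bits : z.per * z.bits ≤ w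
  per_pos : 1 ≤ z.per
  lg_le : 2 * z.lg + 1 ≤ w
  bound_le : z.bound n ≤ 2 ^ w
  small : n * (z.D + 1) + 8 < 2 ^ w

end

section

variable {n : ℕ} {R : Fin n → Fin n → Prop} {Q : Type}

/-! ### The layout of the memory -/

/-- The memory holds two packed arrays `col` and `grp`, a circular buffer and the trailers. -/
structure MemRep (z : Sizes) (mem : ℕ → ℕ) (col grp : Fin n → ℕ) (buf trl : ℕ → ℕ) : Prop where
  col : Packed z.bits z.per mem 0 col
  grp : Packed z.bits z.per mem (z.grpB n) grp
  buf : ∀ i < 2 * z.q, mem (z.bufB n + i) = buf i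
  trl : ∀ i ≤ z.D + 1, mem (z.trlB n + i) = trl i

namespace MemRep

variable {z : Sizes} {mem : ℕ → ℕ} {col grp : Fin n → ℕ} {buf trl : ℕ → ℕ}

theorem set_col (h : MemRep z mem col grp buf trl) (v : Fin n) {a : ℕ} (ha : a < 2 ^ z.bits) :
    MemRep z (Function.update mem (0 + v / z.per)
      (mem (0 + v / z.per) ^^^ ((col v ^^^ a) * 2 ^ (v % z.per * z.bits))))
      (Function.update col v a) grp buf trl := by
  have h1 : (v : ℕ) / z.per ≤ n / z.per := Nat.div_le_div_right v.2.le
  have h2 : z.bufB n = 2 * z.grpB n := rfl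
  have h3 : z.trlB n = z.bufB n + 2 * z.q := rfl
  have h4 : z.grpB n = n / z.per + 1 := rfl
  refine ⟨h.col.update v ha, h.grp.update_outside (.inl ?_), ?_, ?_⟩
  · rw [h4, zero_add]
    exact Nat.lt_succ_of_le h1
  · intro i hi
    rw [Function.update_of_ne, h.buf i hi]
    generalize (v : ℕ) / z.per = k at *
    generalize n / z.per = k' at *
    omega
  · intro i hi
    rw [Function.update_of_ne, h.trl i hi]
    generalize (v : ℕ) / z.per = k at *
    generalize n / z.per = k' at *
    omega

theorem set_grp (h : MemRep z mem col grp buf trl) (v : Fin n) {a : ℕ} (ha : a < 2 ^ z.bits) :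
    MemRep z (Function.update mem (z.grpB n + v / z.per)
      (mem (z.grpB n + v / z.per) ^^^ ((grp v ^^^ a) * 2 ^ (v % z.per * z.bits))))
      col (Function.update grp v a) buf trl := by
  have h1 : (v : ℕ) / z.per ≤ n / z.per := Nat.div_le_div_right v.2.le
  have h2 : z.bufB n = 2 * z.grpB n := rfl
  have h3 : z.trlB n = z.bufB n + 2 * z.q := rfl
  have h4 : z.grpB n = n / z.per + 1 := rfl
  refine ⟨h.col.update_outside (.inr ?_), h.grp.update v ha, ?_, ?_⟩
  · rw [h4, zero_add, add_assoc]
    exact Nat.lt_add_of_pos_right (Nat.add_pos_left one_pos _)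
  · intro i hi
    rw [Function.update_of_ne, h.buf i hi]
    generalize (v : ℕ) / z.per = k at *
    generalize n / z.per = k' at *
    omega
  · intro i hi
    rw [Function.update_of_ne, h.trl i hi]
    generalize (v : ℕ) / z.per = k at *
    generalize n / z.per = k' at *
    omega

theorem set_buf (h : MemRep z mem col grp buf trl) {i a : ℕ} (hi : i < 2 * z.q) :
    MemRep z (Function.update mem (z.bufB n + i) a) col grp (Function.update buf i a) trl := by
  have h2 : z.bufB n = 2 * z.grpB n := rfl
  have h3 : z.trlB n = z.bufB n + 2 * z.q := rfl
  have h4 : z.grpB n = n / z.per + 1 := rfl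
  generalize hk : n / z.per = k' at *
  refine ⟨h.col.update_outside (by rw [hk]; omega), h.grp.update_outside (by rw [hk]; omega),
    ?_, ?_⟩
  · intro i' hi'
    rw [Function.update_apply, Function.update_apply, h.buf i' hi']
    simp
  · intro i' hi'
    rw [Function.update_of_ne (by omega), h.trl i' hi']

theorem set_trl (h : MemRep z mem col grp buf trl) (i a : ℕ) :
    MemRep z (Function.update mem (z.trlB n + i) a) col grp buf (Function.update trl i a) := by
  have h2 : z.bufB n = 2 * z.grpB n := rfl
  have h3 : z.trlB n = z.bufB n + 2 * z.q := rfl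
  have h4 : z.grpB n = n / z.per + 1 := rfl
  generalize hk : n / z.per = k' at *
  refine ⟨h.col.update_outside (by rw [hk]; omega), h.grp.update_outside (by rw [hk]; omega),
    ?_, ?_⟩
  · intro i' hi'
    rw [Function.update_of_ne (by omega), h.buf i' hi']
  · intro i' hi'
    rw [Function.update_apply, Function.update_apply, h.trl i' hi']
    simp

end MemRep

section fields

variable {z : Sizes} {w : ℕ} {ac : Q → ℕ → ℕ → ℕ} {h : State} {g : Fin n → ℕ} {β : ℕ}
  {base e a : Expr Q} {v : Fin n} {B : AdjArrays fun v u => R u v}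

theorem eval_fld (hf : Fixed z n h) (hp : Packed z.bits z.per h.mem β g)
    (hb : base.eval ac h = β) (he : e.eval ac h = v) : (fld base e).eval ac h = g v := by
  simp only [fld, Expr.eval_mod, Expr.eval_shr, Expr.eval_ld, Expr.eval_add, Expr.eval_div,
    Expr.eval_mul, Expr.eval_var, hb, he, hf.per_eq, hf.bits_eq, hf.pow_eq]
  exact hp v

/-- The two packed arrays lie in the memory area in use. -/
theorem addr_lt (hβ : β ≤ z.grpB n) (v : Fin n) : β + v / z.per < z.bound n := by
  have h1 : (v : ℕ) / z.per ≤ n / z.per := Nat.div_le_div_right v.2.le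
  have h2 : z.bufB n = 2 * z.grpB n := rfl
  have h3 : z.trlB n = z.bufB n + 2 * z.q := rfl
  have h4 : z.grpB n = n / z.per + 1 := rfl
  have h5 : z.bound n = z.trlB n + z.D + 2 := rfl
  generalize (v : ℕ) / z.per = k at *
  generalize n / z.per = k' at *
  omega

theorem shift_lt (hz : z.Valid w B) (v : Fin n) :
    v % z.per * z.bits + z.bits ≤ z.per * z.bits := by
  rw [← Nat.succ_mul]
  exact Nat.mul_le_mul_right _ (Nat.mod_lt _ hz.per_pos)

theorem ok_fld (hz : z.Valid w B) (hf : Fixed z n h) (hβ : β ≤ z.grpB n)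
    (hb : base.eval ac h = β) (he : e.eval ac h = v) (hbo : base.Ok w (z.bound n) ac h)
    (heo : e.Ok w (z.bound n) ac h) : (fld base e).Ok w (z.bound n) ac h := by
  have h1 := addr_lt hβ v
  have h2 := shift_lt hz v
  have h3 := hz.per_bits
  have h4 := hz.bound_le
  have h5 : w < 2 ^ w := Nat.lt_two_pow_self
  simp only [fld, Expr.ok_mod, Expr.ok_shr, Expr.ok_ld, Expr.ok_add, Expr.ok_div,
    Expr.ok_mul, Expr.ok_var, hb, he, hf.per_eq, hf.bits_eq, Expr.eval_add, Expr.eval_div,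
    Expr.eval_mod, Expr.eval_var, hbo, heo, true_and, and_true]
  omega

theorem wp_setFld (hz : z.Valid w B) (hf : Fixed z n h) (hβ : β ≤ z.grpB n)
    (hp : Packed z.bits z.per h.mem β g) (hb : base.eval ac h = β) (he : e.eval ac h = v)
    {x : ℕ} (ha : a.eval ac h = x) (hx : x < 2 ^ z.bits)
    (hs : stoSmall (base + e / .var .per) (.bin .xor (.ld (base + e / .var .per))
      (.bin .shl (.bin .xor (fld base e) a) (e % .var .per * .var .bits))) = true)
    (hbo : base.Ok w (z.bound n) ac h) (heo : e.Ok w (z.bound n) ac h)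
    (hao : a.Ok w (z.bound n) ac h) {Ρ : ℕ → State → Prop}
    (hP : Ρ 1 (h.write (β + v / z.per)
      (h.mem (β + v / z.per) ^^^ ((g v ^^^ x) * 2 ^ (v % z.per * z.bits))))) :
    Wp w (z.bound n) ac (setFld base e a) h Ρ := by
  have h1 := addr_lt hβ v
  have h2 := shift_lt hz v
  have h3 := hz.per_bits
  have h4 := hz.bound_le
  have h5 : w < 2 ^ w := Nat.lt_two_pow_self
  have hev := eval_fld (ac := ac) hf hp hb he
  have hxor : g v ^^^ x < 2 ^ z.bits := Nat.xor_lt_two_pow (hp.lt v) hx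
  have hshl : (g v ^^^ x) * 2 ^ (v % z.per * z.bits) < 2 ^ w :=
    calc _ < 2 ^ z.bits * 2 ^ (v % z.per * z.bits) :=
          Nat.mul_lt_mul_of_pos_right hxor (by positivity)
      _ = 2 ^ (v % z.per * z.bits + z.bits) := by rw [← pow_add, add_comm]
      _ ≤ 2 ^ w := Nat.pow_le_pow_right (by omega) (by omega)
  have haddr : (base + e / Expr.var .per).eval ac h = β + v / z.per := by
    simp [hb, he, hf.per_eq]
  have hoaddr : (base + e / Expr.var .per).Ok w (z.bound n) ac h := by
    simp only [Expr.ok_add, Expr.ok_div, Expr.ok_var, Expr.eval_div, Expr.eval_var, hb, he,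
      hf.per_eq, hbo, heo, true_and, and_true]
    omega
  refine wp_sto hs hoaddr ?_ (by rw [haddr]; exact h1) ?_
  · simp only [Expr.ok_xor, Expr.ok_shl, Expr.ok_ld, Expr.ok_mul, Expr.ok_mod, Expr.ok_var,
      Expr.eval_xor, Expr.eval_mul, Expr.eval_mod, Expr.eval_var, haddr, hev, ha, he, hf.per_eq,
      hf.bits_eq]
    refine ⟨⟨hoaddr, h1⟩, ⟨ok_fld hz hf hβ hb he hbo heo, hao⟩,
      ⟨⟨heo, trivial⟩, trivial, by omega⟩, hshl⟩
  · simp only [Expr.eval_xor, Expr.eval_shl, Expr.eval_ld, Expr.eval_mul, Expr.eval_mod,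
      Expr.eval_var, haddr, hev, ha, he, hf.per_eq, hf.bits_eq]
    exact hP

end fields

end

section

variable {n : ℕ} {R : Fin n → Fin n → Prop} {Q : Type}

/-! ### Pushing an entry -/

/-- Only the variables in `X` may have changed. -/
def Keeps (X : List Var) (h h' : State) : Prop := ∀ y, y ∉ X → h'.reg y = h.reg y

theorem Keeps.fixed {X : List Var} {h h' : State} {z : Sizes} (hk : Keeps X h h')
    (hf : Fixed z n h) (hX : X.all (fun x => !x.isConst) = true) : Fixed z n h' := by
  refine hf.of_reg fun x hx => hk x fun hxX => ?_
  have h1 := List.all_eq_true.1 hX x hxX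
  rw [hx] at h1
  exact absurd h1 (by decide)

/-- The memory and the variables `acc`, `len` and `lo` represent two arrays and a stack. -/
def Holds (B : AdjArrays fun v u => R u v) (z : Sizes) (h : State) (col grp : Fin n → ℕ)
    (S : List (Fin n)) : Prop :=
  ∃ buf trl, MemRep z h.mem col grp buf trl ∧
    StackRep B z.D z.lg z.q S (h.reg .acc) (h.reg .len) (h.reg .lo) buf trl

variable {A : AdjArrays R} {B : AdjArrays fun v u => R u v} {z : Sizes} {wl : ℕ}
  {ac : Q → ℕ → ℕ → ℕ} {f : DQuery → Q} {h : State} {col grp : Fin n → ℕ} {S : List (Fin n)}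
  {u v x : Fin n}

theorem encLen_mul_lg_le (hz : z.Valid wl B) (hS : S.Nodup) :
    encLen B z.D z.lg S * z.lg ≤ n * (z.D + 1) := by
  have h1 := encLen_mul_le (B := B) (D := z.D) (L := z.lg) S
  have h2 : (S.map (weight B z.D)).sum ≤ ∑ v, weight B z.D v := by
    rw [← List.sum_toFinset _ hS]
    exact Finset.sum_le_sum_of_subset (Finset.subset_univ _)
  have h3 := hz.weight_le
  omega

theorem encLen_le (hz : z.Valid wl B) (hS : S.Nodup) :
    encLen B z.D z.lg S ≤ n * (z.D + 1) :=
  (Nat.le_mul_of_pos_right _ hz.lg_pos).trans (encLen_mul_lg_le hz hS)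

/-- There are at most `D + 2` segments. -/
theorem encLen_div_le (hz : z.Valid wl B) (hS : S.Nodup) :
    encLen B z.D z.lg S / z.q ≤ z.D + 1 := by
  have h1 := encLen_mul_lg_le hz hS
  have h2 : n * (z.D + 1) ≤ z.q * z.lg * (z.D + 1) := Nat.mul_le_mul_right _ hz.n_le
  have h3 : encLen B z.D z.lg S * z.lg ≤ (z.q * (z.D + 1)) * z.lg := by nlinarith
  exact Nat.div_le_of_le_mul (Nat.le_of_mul_le_mul_right h3 hz.lg_pos)

/-- A push takes constant time. The lowest segment kept changes only if the new word belongs to the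
second segment above it. -/
theorem wp_pushEntry (hz : z.Valid wl B) (hin : Input ac f A B) (hf : Fixed z n h)
    (hh : Holds B z h col grp (u :: S)) (hnd : (x :: u :: S).Nodup) (hnb : h.reg .nb = x)
    (hpos : h.reg .pos = (B.row x).idxOf u) :
    Wp wl (z.bound n) ac (pushEntry f) h fun t h' => t ≤ 9 ∧ Keeps [.acc, .len, .lo] h h' ∧
      h'.out = h.out ∧ Holds B z h' col grp (x :: u :: S) ∧
      (h.reg .len / z.q - 1 ≤ h.reg .lo → h'.reg .lo = h.reg .lo) ∧
      ∀ k W, Paid z.q z.lg k W (h.reg .len) (h.reg .lo) (enc B z.D z.lg (u :: S)).wt →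
        Paid z.q z.lg k W (h'.reg .len) (h'.reg .lo) (enc B z.D z.lg (x :: u :: S)).wt := by
  obtain ⟨buf, trl, hm, hs⟩ := hh
  have hq := hz.q_pos
  have hw0 : wl ≠ 0 := by have := hz.lg_le; omega
  have hsmall := hz.small
  have hbd := hz.bound_le
  have hb2 : z.trlB n = z.bufB n + 2 * z.q := rfl
  have hb3 : z.bound n = z.trlB n + z.D + 2 := rfl
  have hlen : h.reg .len + 1 ≤ n * (z.D + 1) + 1 := by
    have := encLen_le hz (S := u :: S) (List.nodup_cons.1 hnd).2
    rw [hs.len_eq] at this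
    omega
  have hlo : h.reg .lo ≤ h.reg .len := (Nat.le_mul_of_pos_right _ hq).trans hs.lo_le
  have hmod : h.reg .len % (2 * z.q) < 2 * z.q := Nat.mod_lt _ (by omega)
  have hn : n ≤ n * (z.D + 1) := Nat.le_mul_of_pos_right _ (by omega)
  have hdeg := B.length_row_le x
  have hlt := idxOf_lt_radix (B := B) x u
  have hacc := acc_lt (B := B) (D := z.D) (L := z.lg) (u :: S)
  rw [hs.acc_eq] at hacc
  set a := h.reg .acc * ((B.row x).length + 1) + (B.row x).idxOf u with ha
  have hmul : h.reg .acc * ((B.row x).length + 1) + ((B.row x).length + 1) ≤ 2 ^ wl :=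
    calc _ = (h.reg .acc + 1) * ((B.row x).length + 1) := by ring
      _ ≤ 2 ^ (z.lg + 1) * 2 ^ z.lg :=
        Nat.mul_le_mul hacc (le_trans (by omega) hz.n_lt)
      _ = 2 ^ (2 * z.lg + 1) := by rw [← pow_add]; ring_nf
      _ ≤ 2 ^ wl := Nat.pow_le_pow_right (by omega) hz.lg_le
  refine wp_cons (wp_asg rfl ?_ ?_)
  · simp [hnb, hpos, hin.inDeg_fin]
    omega
  simp only [Expr.eval_add, Expr.eval_mul, Expr.eval_var, Expr.eval_qry, Expr.eval_ofNat, hnb, hpos,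
    hin.inDeg_fin, ← ha]
  refine wp_cons (wp_ite rfl (by simp [Cond.Ok, Cond.fst, Cond.snd]) (fun hc => ?_) (fun hc => ?_))
  · simp only [Cond.Holds, Expr.eval_var, State.set_reg, reduceCtorEq, if_false, if_true,
      hf.N_eq] at hc
    refine wp_nil (wp_nil ⟨by omega, ?_, rfl, ⟨buf, trl, hm, ?_⟩, by simp, ?_⟩)
    · intro y hy
      simp only [List.mem_cons, not_or] at hy
      simp [hy.1]
    · simpa using hs.push_of_lt (w := x) hc
    · intro k W hk
      rw [enc_push_of_lt (by rw [hs.acc_eq]; exact hc)]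
      simpa using hk.push_of_lt _
  · simp only [Cond.Holds, Expr.eval_var, State.set_reg, reduceCtorEq, if_false, if_true,
      hf.N_eq, not_lt] at hc
    have henc := enc_push_of_le (by rw [hs.acc_eq]; exact hc)
    have hpush := hs.push_of_le hq (w := x) hc
    have hpaid : ∀ k W, Paid z.q z.lg k W (h.reg .len) (h.reg .lo) (enc B z.D z.lg (u :: S)).wt →
        Paid z.q z.lg k W (h.reg .len + 1) (max (h.reg .lo) (h.reg .len / z.q - 1))
          (enc B z.D z.lg (x :: u :: S)).wt := by
      intro k W hk
      rw [henc]
      exact hk.push_of_le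
    have hdiv : h.reg .len / z.q ≤ h.reg .len := Nat.div_le_self _ _
    have hlen' := encLen_div_le hz hnd
    rw [hpush.len_eq] at hlen'
    refine wp_cons (wp_sto rfl ?_ (by simp) ?_ ?_)
    · simp [hf.bufB_eq, hf.q_eq]
      omega
    · simp [hf.bufB_eq, hf.q_eq]
      omega
    simp only [Expr.eval_add, Expr.eval_mul, Expr.eval_var, Expr.eval_mod, Expr.eval_ofNat,
      State.set_reg, reduceCtorEq, if_false, if_true, hf.q_eq, hf.bufB_eq]
    set h₁ := (h.set Var.acc a).write (z.bufB n + h.reg Var.len % (2 * z.q)) a with hh₁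
    have hr₁ : ∀ y, h₁.reg y = if y = .acc then a else h.reg y := by simp [hh₁]
    have hf₁ : Fixed z n h₁ := (hf.set (x := .acc) (a := a) rfl).of_reg (fun y _ => by simp [hh₁])
    have hm₁ := hm.set_buf hmod (a := a)
    refine wp_cons (Wp.mono (R := fun t h' => t ≤ 2 ∧
      h' = h₁.set .lo (max (h.reg .lo) (h.reg .len / z.q - 1))) ?_ ?_)
    · refine wp_ite rfl ?_ (fun hc => wp_asg rfl ?_ ?_) (fun hc => wp_nil ?_)
      · simp [Cond.Ok, Cond.fst, Cond.snd, hr₁]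
        omega
      · simp only [Cond.Holds, Expr.eval_add, Expr.eval_var, Expr.eval_ofNat, Expr.eval_div, hr₁,
          reduceCtorEq, if_false, hf.q_eq] at hc
        simp [hr₁, hf.q_eq]
        omega
      · simp only [Cond.Holds, Expr.eval_add, Expr.eval_var, Expr.eval_ofNat, Expr.eval_div, hr₁,
          reduceCtorEq, if_false, hf.q_eq] at hc
        refine ⟨by omega, ?_⟩
        rw [max_eq_right (by omega)]
        simp [hr₁, hf.q_eq]
      · simp only [Cond.Holds, Expr.eval_add, Expr.eval_var, Expr.eval_ofNat, Expr.eval_div, hr₁,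
          reduceCtorEq, if_false, hf.q_eq] at hc
        refine ⟨by omega, ?_⟩
        rw [max_eq_left (by omega)]
        have : h₁.reg .lo = h.reg .lo := by simp [hr₁]
        rw [← this]
        simp [State.set]
    · rintro t₁ h' ⟨ht₁, rfl⟩
      refine wp_cons (wp_asg rfl (by simp; omega) (wp_cons (wp_asg rfl ?_ ?_)))
      · simp [hr₁]
        omega
      simp only [Expr.eval_add, Expr.eval_var, Expr.eval_ofNat, State.set_reg, reduceCtorEq,
        if_false, hr₁]
      set lo' := max (h.reg .lo) (h.reg .len / z.q - 1) with hlo'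
      set h₂ := ((h₁.set .lo lo').set .acc 1).set .len (h.reg .len + 1) with hh₂
      have hr₂ : ∀ y, h₂.reg y = if y = .len then h.reg .len + 1 else if y = .acc then 1 else
          if y = .lo then lo' else h.reg y := by
        intro y
        simp only [hh₂, hh₁, State.set_reg, State.write_reg]
        split_ifs <;> rfl
      have hk₂ : Keeps [.acc, .len, .lo] h h₂ := by
        intro y hy
        simp only [List.mem_cons, not_or] at hy
        simp [hr₂, hy.1, hy.2.1, hy.2.2.1]
      have hmem₂ : h₂.mem = Function.update h.mem (z.bufB n + h.reg Var.len % (2 * z.q)) a := rfl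
      refine wp_cons (wp_ite rfl ?_ (fun hc => wp_sto rfl ?_ (by simp) ?_ ?_) (fun hc => wp_nil ?_))
      · simp [Cond.Ok, Cond.fst, Cond.snd]
      · simp [hr₂, hf.trlB_eq, hf.q_eq]
        omega
      · simp [hr₂, hf.trlB_eq, hf.q_eq]
        omega
      · simp only [Cond.Holds, Expr.eval_mod, Expr.eval_var, Expr.eval_ofNat, hr₂, if_true,
          reduceCtorEq, if_false, hf.q_eq] at hc
        rw [if_pos hc] at hpush
        have e₁ : (Expr.var .trlB + Expr.var .len / Expr.var .q : Expr Q).eval ac h₂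
            = z.trlB n + (h.reg .len + 1) / z.q := by simp [hr₂, hf.trlB_eq, hf.q_eq]
        have e₂ : (Expr.var .nb : Expr Q).eval ac h₂ = x := by simp [hr₂, hnb]
        rw [e₁, e₂]
        refine wp_nil (wp_nil ⟨by omega, hk₂, rfl, ⟨_, _, hm₁.set_trl ((h.reg .len + 1) / z.q) x,
          ?_⟩, ?_, ?_⟩)
        · simpa [hr₂] using hpush
        · intro hle
          simp [hr₂, hlo', hle]
        · intro k W hk
          simpa [hr₂] using hpaid k W hk
      · simp only [Cond.Holds, Expr.eval_mod, Expr.eval_var, Expr.eval_ofNat, hr₂, if_true,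
          reduceCtorEq, if_false, hf.q_eq] at hc
        rw [if_neg hc] at hpush
        refine wp_nil (wp_nil ⟨by omega, hk₂, rfl, ⟨_, _, hm₁, ?_⟩, ?_, ?_⟩)
        · simpa [hr₂] using hpush
        · intro hle
          simp [hr₂, hlo', hle]
        · intro k W hk
          simpa [hr₂] using hpaid k W hk

end

section

variable {n : ℕ} {R : Fin n → Fin n → Prop} {Q : Type}
variable {A : AdjArrays R} {B : AdjArrays fun v u => R u v} {z : Sizes} {wl : ℕ}
  {ac : Q → ℕ → ℕ → ℕ} {f : DQuery → Q} {h h' : State} {col grp : Fin n → ℕ} {S : List (Fin n)}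
  {u v x : Fin n}

/-! ### Changes to colors and groups -/

theorem Keeps.trans {X Y : List Var} {h₁ h₂ h₃ : State} (h12 : Keeps X h₁ h₂) (h23 : Keeps Y h₂ h₃)
    (hY : Y ⊆ X) : Keeps X h₁ h₃ :=
  fun y hy => (h23 y fun hh => hy (hY hh)).trans (h12 y hy)

theorem Keeps.mono {X Y : List Var} {h₁ h₂ : State} (hk : Keeps X h₁ h₂) (hXY : X ⊆ Y) :
    Keeps Y h₁ h₂ :=
  fun y hy => hk y fun hh => hy (hXY hh)

theorem Keeps.refl (X : List Var) (h : State) : Keeps X h h := fun _ _ => rfl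

theorem Keeps.set {X : List Var} {h h' : State} (hk : Keeps X h h') {y : Var} {a : ℕ} (hy : y ∈ X) :
    Keeps X h (h'.set y a) := by
  intro y' hy'
  rw [State.set_reg, if_neg, hk y' hy']
  rintro rfl
  exact hy' hy

theorem State.set_set (h : State) (y : Var) (a b : ℕ) : (h.set y a).set y b = h.set y b := by
  simp [State.set]

theorem Holds.congr (hh : Holds B z h col grp S) (hm : h'.mem = h.mem)
    (ha : h'.reg .acc = h.reg .acc) (hl : h'.reg .len = h.reg .len)
    (hlo : h'.reg .lo = h.reg .lo) : Holds B z h' col grp S := by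
  rwa [Holds, hm, ha, hl, hlo]

theorem wp_setCol {e a : Expr Q} {c : ℕ} (hz : z.Valid wl B) (hf : Fixed z n h)
    (hh : Holds B z h col grp S) (he : e.eval ac h = x) (ha : a.eval ac h = c)
    (hc : c < 2 ^ z.bits)
    (hs : stoSmall (0 + e / .var .per) (.bin .xor (.ld (0 + e / .var .per))
      (.bin .shl (.bin .xor (fld 0 e) a) (e % .var .per * .var .bits))) = true)
    (heo : e.Ok wl (z.bound n) ac h) (hao : a.Ok wl (z.bound n) ac h)
    {Ρ : ℕ → State → Prop} (hP : ∀ h', Keeps [] h h' → h'.out = h.out →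
      Holds B z h' (Function.update col x c) grp S → Ρ 1 h') :
    Wp wl (z.bound n) ac (setFld 0 e a) h Ρ := by
  obtain ⟨buf, trl, hm, hs'⟩ := hh
  refine wp_setFld hz hf (Nat.zero_le _) hm.col rfl he ha hc hs (by simp) heo hao ?_
  exact hP _ (Keeps.refl _ _) rfl ⟨buf, trl, hm.set_col x hc, hs'⟩

theorem wp_setGrp {e a : Expr Q} {c : ℕ} (hz : z.Valid wl B) (hf : Fixed z n h)
    (hh : Holds B z h col grp S) (he : e.eval ac h = x) (ha : a.eval ac h = c)
    (hc : c < 2 ^ z.bits)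
    (hs : stoSmall (.var .grpB + e / .var .per) (.bin .xor (.ld (.var .grpB + e / .var .per))
      (.bin .shl (.bin .xor (fld (.var .grpB) e) a) (e % .var .per * .var .bits))) = true)
    (heo : e.Ok wl (z.bound n) ac h) (hao : a.Ok wl (z.bound n) ac h)
    {Ρ : ℕ → State → Prop} (hP : ∀ h', Keeps [] h h' → h'.out = h.out →
      Holds B z h' col (Function.update grp x c) S → Ρ 1 h') :
    Wp wl (z.bound n) ac (setFld (.var .grpB) e a) h Ρ := by
  obtain ⟨buf, trl, hm, hs'⟩ := hh
  refine wp_setFld hz hf le_rfl hm.grp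
    (show (Expr.var .grpB : Expr Q).eval ac h = _ from hf.grpB_eq) he ha hc hs (by simp) heo hao ?_
  exact hP _ (Keeps.refl _ _) rfl ⟨buf, trl, hm.set_grp x hc, hs'⟩

/-- The number of positions in a group of positions of a vertex. -/
def gsize (A : AdjArrays R) (D : ℕ) (v : Fin n) : ℕ := (A.row v).length / D + 1

/-- The colors distinguish undiscovered, finished and root vertices, and for all other vertices on
the stack tell the segment that holds their entries. Moreover, for vertices with a child on the
stack, the group of its position is known. -/
structure Colored (A : AdjArrays R) (B : AdjArrays fun v u => R u v) (z : Sizes)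
    (S : List (Fin n)) (disc : Finset (Fin n)) (col grp : Fin n → ℕ) : Prop where
  white : ∀ v, v ∉ disc → col v = 0
  black : ∀ v, v ∈ disc → v ∉ S → col v = 1
  root : ∀ v, [v] <:+ S → col v = 3
  hue : ∀ w u S', w :: u :: S' <:+ S → col w = 4 + encLen B z.D z.lg (u :: S') / z.q
  group : ∀ w u S', w :: u :: S' <:+ S → grp u = (A.row u).idxOf w / gsize A z.D u

theorem Colored.cases (hc : Colored A B z S disc col grp) (x : Fin n) :
    col x = 0 ∨ col x = 1 ∨ (x ∈ S ∧ (col x = 3 ∨ ∃ u S', x :: u :: S' <:+ S)) := by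
  by_cases h1 : x ∈ disc
  · by_cases h2 : x ∈ S
    · obtain ⟨s, t, rfl⟩ := List.append_of_mem h2
      refine .inr (.inr ⟨h2, ?_⟩)
      cases t with
      | nil => exact .inl (hc.root x (List.suffix_append _ _))
      | cons u t => exact .inr ⟨u, t, List.suffix_append _ _⟩
    · exact .inr (.inl (hc.black x h1 h2))
  · exact .inl (hc.white x h1)

theorem Colored.ne_two (hc : Colored A B z S disc col grp) (x : Fin n) : col x ≠ 2 := by
  rcases hc.cases x with h | h | ⟨-, h | ⟨u, S', h⟩⟩
  · omega
  · omega
  · omega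
  · rw [hc.hue x u S' h]
    exact Nat.ne_of_gt (lt_of_lt_of_le (by norm_num) (Nat.le_add_right 4 _))

theorem Colored.mem_of_le (hc : Colored A B z S disc col grp) {x : Fin n} (h : 4 ≤ col x) :
    x ∈ S := by
  rcases hc.cases x with h' | h' | ⟨h', -⟩
  · omega
  · omega
  · exact h'

/-! ### Restoring a segment -/

/-- The child at position `p` is the first neighbor with its color from the start of its group on,
and it is found in time proportional to the size of the group. -/
theorem wp_findChild (hz : z.Valid wl B) (hin : Input ac f A B) (hf : Fixed z n h)
    (hcol : Packed z.bits z.per h.mem 0 col) (hgrp : Packed z.bits z.per h.mem (z.grpB n) grp)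
    (hu : h.reg .low = u) {j p : ℕ} (hj : h.reg .seg = j) (hj' : 4 + j < 2 ^ wl)
    (hp : p < (A.row u).length) (hg : grp u = p / gsize A z.D u)
    (hcp : col (A.row u)[p] = 4 + j)
    (hlt : ∀ (i : ℕ) (hi : i < p), col ((A.row u)[i]'(hi.trans hp)) ≠ 4 + j) :
    Wp wl (z.bound n) ac (findChild f) h fun t h' => t ≤ 2 * gsize A z.D u + 2 ∧
      h' = h.set .ctr p := by
  have hw0 : wl ≠ 0 := by have := hz.lg_le; omega
  have hsmall := hz.small
  have hn : n ≤ n * (z.D + 1) := Nat.le_mul_of_pos_right _ (by omega)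
  have hdeg := A.length_row_le u
  have hstart : p / gsize A z.D u * gsize A z.D u ≤ p := Nat.div_mul_le_self _ _
  have hstart' : p < p / gsize A z.D u * gsize A z.D u + gsize A z.D u :=
    Nat.lt_div_mul_add (Nat.succ_pos _)
  have hbd := hz.bound_le
  have hb2 : z.trlB n = z.bufB n + 2 * z.q := rfl
  have hb3 : z.bound n = z.trlB n + z.D + 2 := rfl
  have hb4 : z.bufB n = 2 * z.grpB n := rfl
  have hdiv : (A.row u).length / z.D ≤ (A.row u).length := Nat.div_le_self _ _
  have hfld := eval_fld (ac := ac) (base := .var .grpB) (e := .var .low) hf hgrp hf.grpB_eq hu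
  have hgs : (A.row u).length / z.D + 1 = gsize A z.D u := rfl
  refine wp_cons (wp_asg rfl ?_ ?_)
  · simp only [Expr.ok_mul, Expr.ok_add, Expr.ok_div, Expr.ok_qry, Expr.ok_var, Expr.ok_ofNat,
      Expr.eval_add, Expr.eval_div, Expr.eval_qry, Expr.eval_var, Expr.eval_ofNat, hu,
      hin.outDeg_fin, hf.D_eq, hfld, hgs, hg]
    refine ⟨ok_fld hz hf le_rfl hf.grpB_eq hu trivial trivial,
      ⟨⟨⟨trivial, by omega, by omega⟩, trivial⟩, by omega, by omega⟩, by omega⟩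
  simp only [Expr.eval_mul, Expr.eval_add, Expr.eval_div, Expr.eval_qry, Expr.eval_var,
    Expr.eval_ofNat, hu, hin.outDeg_fin, hf.D_eq, hfld, hgs, hg]
  have hev : ∀ (i : ℕ) (hi : i ≤ p),
      (fld 0 (.qry (f .outHead) (.var .low) (.var .ctr)) : Expr Q).eval ac (h.set .ctr i) =
        col ((A.row u)[i]'(hi.trans_lt hp)) := fun i hi =>
    eval_fld (hf.set rfl) hcol rfl (by simp [hu, hin.outHead_fin u (hi.trans_lt hp)])
  refine wp_cons (wp_while (fun i h' => h' = h.set .ctr i ∧ i ≤ p) (fun i => 2 * (p - i)) rfl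
    ?_ ?_ ⟨rfl, hstart⟩ ?_)
  · rintro i _ ⟨rfl, hi⟩
    refine ⟨by simp [Cond.fst], ?_⟩
    simp only [Cond.snd, Expr.ok_xor, Expr.ok_add, Expr.ok_ofNat, Expr.ok_var, Expr.eval_var,
      Expr.eval_ofNat, State.set_reg, reduceCtorEq, if_false, hj]
    have hh := hin.outHead_fin u (hi.trans_lt hp)
    refine ⟨ok_fld (v := (A.row u)[i]'(hi.trans_lt hp)) hz (hf.set rfl) (Nat.zero_le _) rfl
      (by simp only [Expr.eval_qry, Expr.eval_var, State.set_reg, reduceCtorEq, if_false, hu,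
        if_true, hh]) (by simp) ?_, ⟨by omega, trivial, by omega⟩⟩
    simp only [Expr.ok_qry, Expr.ok_var, Expr.eval_var, State.set_reg, reduceCtorEq, if_false, hu,
      if_true, hh]
    exact ⟨trivial, trivial, by omega⟩
  · rintro i _ ⟨rfl, hi⟩ hc
    simp only [Cond.Holds, Expr.eval_ofNat, Expr.eval_xor, hev i hi, Expr.eval_add, Expr.eval_var,
      State.set_reg, reduceCtorEq, if_false, hj] at hc
    have hip : i ≠ p := by
      rintro rfl
      rw [hcp, Nat.xor_self] at hc
      exact lt_irrefl _ hc
    refine wp_asg rfl (by simp; omega) ⟨i + 1, ⟨by simp [State.set_set], by omega⟩, by omega⟩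
  · rintro t i _ ⟨rfl, hi⟩ hc ht
    simp only [Cond.Holds, Expr.eval_ofNat, Expr.eval_xor, hev i hi, Expr.eval_add, Expr.eval_var,
      State.set_reg, reduceCtorEq, if_false, hj, not_lt, Nat.le_zero, Nat.xor_eq_zero_iff] at hc
    have hip : i = p := by
      by_contra hne
      exact hlt i (by omega) hc
    subst hip
    exact wp_nil ⟨by omega, rfl⟩

end

section

variable {n : ℕ} {R : Fin n → Fin n → Prop} {Q : Type}
variable {A : AdjArrays R} {B : AdjArrays fun v u => R u v} {z : Sizes} {wl : ℕ}
  {ac : Q → ℕ → ℕ → ℕ} {f : DQuery → Q} {h h' : State} {col grp : Fin n → ℕ} {S : List (Fin n)}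
  {u v x : Fin n}

/-- All marked vertices belong to the segment restored, so that their colors are known. -/
theorem wp_unmark {g : Fin n → ℕ} {j : ℕ} (hz : z.Valid wl B) (hf : Fixed z n h)
    (hh : Holds B z h g grp S) (hj : h.reg .seg = j) (hj' : 4 + j < 2 ^ z.bits)
    (hg : ∀ x, g x = col x ∨ g x = 2 ∧ col x = 4 + j) (hcol : ∀ x, col x ≠ 2) :
    Wp wl (z.bound n) ac (unmark : Prog Q 36) h fun t h' => t ≤ 4 * n + 2 ∧ Keeps [.ctr] h h' ∧
      h'.out = h.out ∧ Holds B z h' col grp S := by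
  have hw0 : wl ≠ 0 := by have := hz.lg_le; omega
  have hsmall := hz.small
  have hn : n ≤ n * (z.D + 1) := Nat.le_mul_of_pos_right _ (by omega)
  have hbits : 2 ^ z.bits ≤ 2 ^ wl := Nat.pow_le_pow_right (by omega) hz.bits_le
  refine wp_cons (wp_asg rfl (by simp) ?_)
  simp only [Expr.eval_ofNat]
  refine wp_cons (wp_while (fun i h' => i ≤ n ∧ h'.reg .ctr = i ∧ Keeps [.ctr] h h' ∧
    h'.out = h.out ∧ Holds B z h' (fun x => if x.val < i then col x else g x) grp S)
    (fun i => 4 * (n - i)) rfl ?_ ?_ (g := 0) ?_ ?_)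
  · intro i h' _
    simp [Cond.Ok, Cond.fst, Cond.snd]
  · rintro i h₁ ⟨hi, hc, hk, ho, hh₁⟩ hb
    have hf₁ := hk.fixed hf rfl
    simp only [Cond.Holds, Expr.eval_var, hf₁.n_eq, hc] at hb
    have hev : (Expr.var .ctr : Expr Q).eval ac h₁ = ((⟨i, hb⟩ : Fin n) : ℕ) := hc
    have hseg : h₁.reg .seg = j := (hk .seg (by decide)).trans hj
    have hfld := eval_fld (ac := ac) (base := 0) hf₁ hh₁.choose_spec.choose_spec.1.col rfl hev
    simp only [lt_irrefl, if_false] at hfld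
    have hnext : ∀ h₂ : State, Keeps [] h₁ h₂ → h₂.out = h₁.out →
        Holds B z h₂ (fun x => if x.val < i + 1 then col x else g x) grp S → ∀ t ≤ 1,
        Wp wl (z.bound n) ac (block [asg .ctr (.var .ctr + 1)] : Prog Q 36) h₂ fun t' h' =>
          ∃ g', (g' ≤ n ∧ h'.reg .ctr = g' ∧ Keeps [.ctr] h h' ∧ h'.out = h.out ∧
            Holds B z h' (fun x => if x.val < g' then col x else g x) grp S) ∧
            t + 1 + t' + 1 + 4 * (n - g') ≤ 4 * (n - i) := by
      intro h₂ hk₂ ho₂ hh₂ t ht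
      have hc₂ : h₂.reg .ctr = i := (hk₂ _ (by decide)).trans hc
      refine wp_cons (wp_asg rfl (by simp [hc₂]; omega) (wp_nil ⟨i + 1, ⟨by omega, by simp [hc₂],
        ((hk.trans hk₂ (by simp)).set (by simp)), ho₂.trans ho,
        hh₂.congr rfl (by simp) (by simp) (by simp)⟩, by omega⟩))
    refine wp_cons (wp_ite rfl ⟨ok_fld hz hf₁ (Nat.zero_le _) rfl hev (by simp) trivial, ?_⟩
      (fun hc => ?_) (fun hc => ?_))
    · simp [Cond.snd]
      omega
    · simp only [Cond.Holds, hfld, Expr.eval_ofNat] at hc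
      have hcx : col ⟨i, hb⟩ = 4 + j := by
        rcases hg ⟨i, hb⟩ with h1 | h1
        · exact absurd (h1.symm.trans hc) (hcol _)
        · exact h1.2
      refine wp_setCol hz hf₁ hh₁ hev (c := 4 + j) (by simp [hseg]) hj' rfl trivial
        (by simp [hseg]; omega) (fun h₂ hk₂ ho₂ hh₂ => ?_)
      have hfun : (Function.update (fun x : Fin n => if x.val < i then col x else g x) ⟨i, hb⟩
          (4 + j)) = fun x => if x.val < i + 1 then col x else g x := by
        funext x
        by_cases hx : x = ⟨i, hb⟩
        · subst hx; simp [hcx]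
        · have : x.val ≠ i := fun hh => hx (Fin.ext hh)
          rw [Function.update_of_ne hx]
          simp only [show x.val < i ↔ x.val < i + 1 by omega]
      rw [hfun] at hh₂
      exact hnext h₂ hk₂ ho₂ hh₂ 1 le_rfl
    · simp only [Cond.Holds, hfld, Expr.eval_ofNat] at hc
      have hgx : g ⟨i, hb⟩ = col ⟨i, hb⟩ := by
        rcases hg ⟨i, hb⟩ with h1 | h1
        · exact h1
        · exact absurd h1.1 hc
      have hfun : (fun x : Fin n => if x.val < i then col x else g x) =
          fun x => if x.val < i + 1 then col x else g x := by
        funext x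
        by_cases hx : x = ⟨i, hb⟩
        · subst hx; simp [hgx]
        · have : x.val ≠ i := fun hh => hx (Fin.ext hh)
          simp only [show x.val < i ↔ x.val < i + 1 by omega]
      rw [hfun] at hh₁
      exact wp_nil (hnext h₁ (Keeps.refl _ _) rfl hh₁ 0 (by omega))
  · exact ⟨by omega, by simp, (Keeps.refl _ _).set (by simp), rfl, by
      simpa using hh.congr (h' := h.set .ctr 0) rfl (by simp) (by simp) (by simp)⟩
  · rintro t i h₁ ⟨hi, hc, hk, ho, hh₁⟩ hb ht
    have hf₁ := hk.fixed hf rfl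
    simp only [Cond.Holds, Expr.eval_var, hf₁.n_eq, hc, not_lt] at hb
    have hfun : (fun x : Fin n => if x.val < i then col x else g x) = col := by
      funext x
      rw [if_pos (by omega)]
    rw [hfun] at hh₁
    exact wp_nil ⟨by omega, hk, ho, hh₁⟩

/-- An upper bound for the time that a restoration spends at a vertex. -/
def climbCost (A : AdjArrays R) (D : ℕ) (v : Fin n) : ℕ := 2 * gsize A D v + 20

/-- The colors while segment `j` is restored and the words for the stack `U` have been computed. -/
def marked (col : Fin n → ℕ) (j : ℕ) (U : List (Fin n)) (x : Fin n) : ℕ :=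
  if x ∈ U ∧ col x = 4 + j then 2 else col x

theorem exists_cons_suffix {α : Type*} {U S : List α} (h : U <:+ S) (hne : U ≠ S) :
    ∃ a, a :: U <:+ S := by
  obtain ⟨t, rfl⟩ := h
  rcases List.eq_nil_or_concat t with rfl | ⟨t', a, rfl⟩
  · simp at hne
  · exact ⟨a, t', by simp⟩

/-- On the way up from the trailer `u` of segment `j` to the top `v`, the words of the segment are
computed again. The child of a vertex is its first neighbor of color `4 + j`: neighbors of that
color that precede the child in the array are on the stack, hence below the child, and have been
marked already. -/
theorem wp_climb {disc : Finset (Fin n)} {e : Fin n → ℕ} {tr : List (Event (Fin n))}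
    (hz : z.Valid wl B) (hin : Input ac f A B) (hf : Fixed z n h)
    (hse : Searching A (v :: S) disc e tr) (hco : Colored A B z (v :: S) disc col grp)
    {j : ℕ} {S' : List (Fin n)} (hj' : 4 + j < 2 ^ z.bits) (hS' : u :: S' <:+ v :: S)
    (hseg : ∀ y x S₁, y :: x :: S₁ <:+ v :: S →
        (encLen B z.D z.lg (x :: S₁) / z.q = j ↔ u :: S' <:+ x :: S₁))
    (hh : Holds B z h col grp (u :: S')) (hj : h.reg .seg = j) (hlo : h.reg .lo = j)
    (hlow : h.reg .low = u) (hcur : h.reg .cur = v) :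
    Wp wl (z.bound n) ac (climb f) h fun t h' =>
      t ≤ ((v :: S).map (climbCost A z.D)).sum + 1 ∧
      Keeps [.acc, .len, .lo, .low, .ctr, .nb, .pos] h h' ∧ h'.out = h.out ∧ h'.reg .lo = j ∧
      Holds B z h' (marked col j (v :: S)) grp (v :: S) := by
  have hw0 : wl ≠ 0 := by have := hz.lg_le; omega
  have hsmall := hz.small
  have hn : n ≤ n * (z.D + 1) := Nat.le_mul_of_pos_right _ (by omega)
  have hbits : 2 ^ z.bits ≤ 2 ^ wl := Nat.pow_le_pow_right (by omega) hz.bits_le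
  have hnd := hse.nodup
  have hmark0 : marked col j (u :: S') = col := by
    funext x
    rw [marked, if_neg]
    rintro ⟨hx, hx'⟩
    rcases hco.cases x with h1 | h1 | ⟨-, h1 | ⟨u₁, S₁, h1⟩⟩
    · omega
    · omega
    · omega
    · have h2 := hco.hue x u₁ S₁ h1
      have h3 := (hseg x u₁ S₁ h1).1 (by rw [hx'] at h2; exact (Nat.add_left_cancel h2).symm)
      have h4 : x ∈ u₁ :: S₁ := h3.subset hx
      have h5 := hnd.sublist h1.sublist
      exact (List.nodup_cons.1 h5).1 h4
  refine wp_while (fun U h' => ∃ y U', U = y :: U' ∧ U <:+ v :: S ∧ u :: S' <:+ U ∧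
      h'.reg .low = y ∧ Keeps [.acc, .len, .lo, .low, .ctr, .nb, .pos] h h' ∧ h'.out = h.out ∧
      h'.reg .lo = j ∧ Holds B z h' (marked col j U) grp U)
    (fun U => ((v :: S).map (climbCost A z.D)).sum - (U.tail.map (climbCost A z.D)).sum) rfl
    ?_ ?_ (g := u :: S') ?_ ?_
  · intro U h' _
    simp [Cond.Ok, Cond.fst, Cond.snd]
  · rintro _ h₁ ⟨y, U', rfl, hU, hU', hlow₁, hk₁, ho₁, hlo₁, hh₁⟩ hb
    have hf₁ := hk₁.fixed hf rfl
    have hcur₁ : h₁.reg .cur = v := (hk₁ _ (by decide)).trans hcur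
    have hseg₁ : h₁.reg .seg = j := (hk₁ _ (by decide)).trans hj
    simp only [Cond.Holds, Expr.eval_ofNat, Expr.eval_xor, Expr.eval_var, hlow₁, hcur₁] at hb
    have hne : y :: U' ≠ v :: S := by
      intro heq
      rw [(List.cons.inj heq).1, Nat.xor_self] at hb
      exact lt_irrefl _ hb
    obtain ⟨x, hx⟩ := exists_cons_suffix hU hne
    obtain ⟨hyx, -⟩ := hse.chain x y U' hx
    obtain ⟨hp, hpx⟩ := getElem_idxOf_row A y x hyx
    have hxnd := hnd.sublist hx.sublist
    have hlen : encLen B z.D z.lg (y :: U') / z.q = j := (hseg x y U' hx).2 hU'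
    have hcx : col x = 4 + j := by rw [hco.hue x y U' hx, hlen]
    have hxU : x ∉ y :: U' := (List.nodup_cons.1 hxnd).1
    obtain ⟨buf, trl, hm₁, hs₁⟩ := hh₁
    refine wp_cons (Wp.mono (wp_findChild hz hin hf₁ hm₁.col hm₁.grp hlow₁ hseg₁ (by omega) hp
      (hco.group x y U' hx) ?_ ?_) ?_)
    · rw [hpx, marked, if_neg (fun hh => hxU hh.1), hcx]
    · intro i hi heq
      set x' := (A.row y)[i]'(hi.trans hp) with hx'
      rw [marked] at heq
      split_ifs at heq with h1
      · omega
      · have h2 : x' ∈ v :: S := hco.mem_of_le (by omega)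
        have h3 := hse.below x y U' hx x' (rel_getElem A y i _)
          (by rw [hx', idxOf_row_getElem]; exact hi) h2
        exact h1 ⟨h3, heq⟩
    rintro t h₂ ⟨ht, rfl⟩
    have e₁ := hin.outHead_fin y hp
    have e₂ := hin.outMate_fin y hp
    rw [hpx] at e₁ e₂
    have hidx : (B.row x).idxOf y < n + 1 := by
      have h1 := idxOf_lt_radix (B := B) x y
      have h2 := B.length_row_le x
      omega
    refine wp_cons (wp_asg rfl ?_ ?_)
    · simp [hlow₁, e₁]
      omega
    simp only [Expr.eval_qry, Expr.eval_var, State.set_reg, reduceCtorEq, if_false, if_true, hlow₁,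
      e₁]
    refine wp_cons (wp_asg rfl ?_ ?_)
    · simp [hlow₁, e₂]
      omega
    simp only [Expr.eval_qry, Expr.eval_var, State.set_reg, reduceCtorEq, if_false, if_true, hlow₁,
      e₂]
    set h₃ := ((h₁.set .ctr ((A.row y).idxOf x)).set .nb x).set .pos ((B.row x).idxOf y) with hh₃
    have hk₃ : Keeps [.ctr, .nb, .pos] h₁ h₃ :=
      (((Keeps.refl _ _).set (by simp)).set (by simp)).set (by simp)
    have hh₃' : Holds B z h₃ (marked col j (y :: U')) grp (y :: U') :=
      Holds.congr ⟨buf, trl, hm₁, hs₁⟩ rfl (hk₃ _ (by decide)) (hk₃ _ (by decide))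
        (hk₃ _ (by decide))
    refine wp_cons (Wp.mono (wp_pushEntry hz hin (hk₃.fixed hf₁ rfl) hh₃' hxnd (by simp [hh₃])
      (by simp [hh₃])) ?_)
    rintro t₄ h₄ ⟨ht₄, hk₄, ho₄, hh₄, hlo₄, -⟩
    have hlo₄' : h₄.reg .lo = j := by
      have h1 : h₃.reg .lo = j := (hk₃ _ (by decide)).trans hlo₁
      have h2 : h₃.reg .len = encLen B z.D z.lg (y :: U') :=
        (hk₃ _ (by decide)).trans hs₁.len_eq.symm
      rw [hlo₄, h1]
      rw [h1, h2, hlen]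
      omega
    have hk₄' : Keeps [.acc, .len, .lo, .low, .ctr, .nb, .pos] h h₄ :=
      (hk₁.trans hk₃ (by decide)).trans hk₄ (by decide)
    have hnb₄ : h₄.reg .nb = x := by rw [hk₄ _ (by decide)]; simp [hh₃]
    refine wp_cons (wp_setCol (x := x) (c := 2) (e := .var .nb) hz (hk₄'.fixed hf rfl) hh₄
      (show (Expr.var .nb : Expr Q).eval ac h₄ = x from hnb₄) rfl (by omega) rfl
      trivial (by simp; omega) ?_)
    intro h₅ hk₅ ho₅ hh₅
    have hk₅' := hk₄'.trans hk₅ (by simp)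
    have hmk : Function.update (marked col j (y :: U')) x 2 = marked col j (x :: y :: U') := by
      funext x'
      by_cases hx' : x' = x
      · subst hx'; simp [marked, hcx]
      · simp [marked, hx']
    rw [hmk] at hh₅
    refine wp_cons (wp_asg rfl trivial (wp_nil ⟨x :: y :: U', ⟨x, y :: U', rfl, hx,
      hU'.trans (List.suffix_cons _ _), ?_, hk₅'.set (by simp), ?_, ?_,
      hh₅.congr rfl (by simp) (by simp) (by simp)⟩, ?_⟩))
    · simp [hk₅ .nb (by simp), hnb₄]
    · rw [State.set_out, ho₅, ho₄, ← ho₁]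
      rfl
    · simp [hk₅ .lo (by simp), hlo₄']
    · have hsum : ((y :: U').map (climbCost A z.D)).sum ≤ ((v :: S).map (climbCost A z.D)).sum := by
        obtain ⟨s, hs⟩ := hU
        rw [← hs, List.map_append, List.sum_append]
        exact Nat.le_add_left _ _
      simp only [List.tail_cons, List.map_cons, List.sum_cons] at hsum ⊢
      have : climbCost A z.D y = 2 * gsize A z.D y + 20 := rfl
      omega
  · exact ⟨u, S', rfl, hS', List.suffix_refl _, hlow, Keeps.refl _ _, rfl, hlo, by rwa [hmark0]⟩
  · rintro t _ h₁ ⟨y, U', rfl, hU, hU', hlow₁, hk₁, ho₁, hlo₁, hh₁⟩ hb ht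
    have hcur₁ : h₁.reg .cur = v := (hk₁ _ (by decide)).trans hcur
    simp only [Cond.Holds, Expr.eval_ofNat, Expr.eval_xor, Expr.eval_var, hlow₁, hcur₁, not_lt,
      Nat.le_zero, Nat.xor_eq_zero_iff, Fin.val_inj] at hb
    subst hb
    have hUS : y :: U' = y :: S := by
      rcases List.suffix_cons_iff.1 hU with h1 | h1
      · exact h1
      · exact absurd (h1.subset (by simp)) (List.nodup_cons.1 hnd).1
    rw [hUS] at hh₁
    refine ⟨?_, hk₁, ho₁, hlo₁, hh₁⟩
    have hsum : (S'.map (climbCost A z.D)).sum ≤ ((y :: S).map (climbCost A z.D)).sum := by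
      obtain ⟨s, hs⟩ := hS'
      rw [← hs, List.map_append, List.sum_append, List.map_cons, List.sum_cons]
      omega
    simp only [List.tail_cons] at ht
    omega

end

section

variable {n : ℕ} {R : Fin n → Fin n → Prop} {Q : Type}
variable {A : AdjArrays R} {B : AdjArrays fun v u => R u v} {z : Sizes} {wl : ℕ}
  {ac : Q → ℕ → ℕ → ℕ} {f : DQuery → Q} {h h' : State} {col grp : Fin n → ℕ} {S : List (Fin n)}
  {u v x : Fin n} {disc : Finset (Fin n)} {e : Fin n → ℕ} {tr : List (Event (Fin n))}

/-- An upper bound for the time of a restoration. -/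
def restoreCost (A : AdjArrays R) (D : ℕ) : ℕ := ∑ v, climbCost A D v + 4 * n + 7

/-- A restoration changes nothing but `lo`, as far as the encoded stack is concerned. -/
theorem wp_restore (hz : z.Valid wl B) (hin : Input ac f A B) (hf : Fixed z n h)
    (hse : Searching A (v :: u :: S) disc e tr) (hco : Colored A B z (v :: u :: S) disc col grp)
    (hh : Holds B z h col grp (v :: u :: S)) (hacc : h.reg .acc = 1)
    (hlen : h.reg .lo * z.q = h.reg .len) (hcur : h.reg .cur = v) :
    Wp wl (z.bound n) ac (restore f) h fun t h' => t ≤ restoreCost A z.D ∧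
      Keeps [.acc, .len, .lo, .seg, .low, .ctr, .nb, .pos] h h' ∧ h'.out = h.out ∧
      Holds B z h' col grp (v :: u :: S) ∧ h'.reg .acc = 1 ∧ h'.reg .len = h.reg .len ∧
      1 ≤ h.reg .lo ∧ h'.reg .lo = h.reg .lo - 1 := by
  have hw0 : wl ≠ 0 := by have := hz.lg_le; omega
  have hq := hz.q_pos
  obtain ⟨buf, trl, hm, hs⟩ := hh
  have hnd := hse.nodup
  have huv := (hse.chain v u S (List.suffix_refl _)).1
  have hlo : h.reg .lo ≤ z.D + 1 := by
    have := encLen_div_le hz hnd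
    rwa [hs.len_eq, ← hlen, Nat.mul_div_cancel _ hq] at this
  have hdeg : 1 ≤ (B.row v).length := List.length_pos_of_mem ((B.mem_iff v u).2 huv)
  rw [hacc] at hs
  obtain ⟨w, S', hlo1, hsuf, htrl, hs', hseg⟩ := hs.exists_restart hq hdeg hlen
  have hD := hz.D_lt
  have hbd := hz.bound_le
  have hb3 : z.bound n = z.trlB n + z.D + 2 := rfl
  have hql : z.q ≤ h.reg .len := by
    rw [← hlen]
    exact Nat.le_mul_of_pos_left _ hlo1
  have hmem : h.mem (z.trlB n + (h.reg .lo - 1)) = w := by rw [hm.trl _ (by omega), htrl]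
  refine wp_cons (wp_asg rfl (by simp [hw0]; omega) ?_)
  simp only [Expr.eval_sub, Expr.eval_var, Expr.eval_ofNat]
  refine wp_cons (wp_asg rfl trivial ?_)
  simp only [Expr.eval_var, State.set_reg, if_true]
  refine wp_cons (wp_asg rfl (by simp [hf.q_eq]; omega) ?_)
  simp only [Expr.eval_sub, Expr.eval_var, State.set_reg, reduceCtorEq, if_false, hf.q_eq]
  refine wp_cons (wp_asg rfl (by simp [hf.trlB_eq]; omega) ?_)
  simp only [Expr.eval_ld, Expr.eval_add, Expr.eval_var, State.set_reg, reduceCtorEq, if_false,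
    if_true, hf.trlB_eq, State.set_mem, hmem]
  set h₁ := (((h.set .seg (h.reg .lo - 1)).set .lo (h.reg .lo - 1)).set .len
    (h.reg .len - z.q)).set .low w with hh₁
  have hk₁ : Keeps [.acc, .len, .lo, .seg, .low, .ctr, .nb, .pos] h h₁ :=
    ((((Keeps.refl _ _).set (by simp)).set (by simp)).set (by simp)).set (by simp)
  have hh₁' : Holds B z h₁ col grp (w :: S') := by
    refine ⟨buf, trl, hm, ?_⟩
    have e1 : h₁.reg .acc = 1 := by simp [hh₁, hacc]
    have e2 : h₁.reg .len = (h.reg .lo - 1) * z.q := by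
      simp [hh₁, ← hlen, Nat.sub_mul]
    have e3 : h₁.reg .lo = h.reg .lo - 1 := by simp [hh₁]
    rw [e1, e2, e3]
    exact hs'
  refine wp_cons (Wp.mono (wp_climb hz hin (hk₁.fixed hf rfl) hse hco (by omega)
    (hsuf.trans (List.suffix_cons _ _)) hseg hh₁' (by simp [hh₁]) (by simp [hh₁]) (by simp [hh₁])
    (by simp [hh₁, hcur])) ?_)
  rintro t₂ h₂ ⟨ht₂, hk₂, ho₂, hlo₂, hh₂⟩
  have hk₂' := hk₁.trans hk₂ (by decide)
  refine wp_cons (Wp.mono (wp_unmark (j := h.reg .lo - 1) hz (hk₂'.fixed hf rfl) hh₂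
    ?_ (by omega) ?_ hco.ne_two) ?_)
  · rw [hk₂ _ (by decide)]
    simp [hh₁]
  · intro x
    rw [marked]
    split_ifs with hx
    · exact .inr ⟨rfl, hx.2⟩
    · exact .inl rfl
  rintro t₃ h₃ ⟨ht₃, hk₃, ho₃, hh₃⟩
  have hsum : ((v :: u :: S).map (climbCost A z.D)).sum ≤ ∑ v, climbCost A z.D v := by
    rw [← List.sum_toFinset _ hnd]
    exact Finset.sum_le_sum_of_subset (Finset.subset_univ _)
  refine wp_nil ⟨by rw [restoreCost]; omega, hk₂'.trans hk₃ (by decide), ?_, hh₃, ?_, ?_, hlo1, ?_⟩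
  · rw [ho₃, ho₂]
    rfl
  · obtain ⟨_, _, _, hs₃⟩ := hh₃
    exact hs₃.acc_eq.symm.trans hs.acc_eq
  · obtain ⟨_, _, _, hs₃⟩ := hh₃
    exact hs₃.len_eq.symm.trans hs.len_eq
  · rw [hk₃ _ (by decide), hlo₂]

/-! ### Popping an entry -/

/-- Make the entry of the current vertex available, with `r` restorations, where `r` is 0 or 1. -/
theorem wp_fetch (hz : z.Valid wl B) (hin : Input ac f A B) (hf : Fixed z n h)
    (hse : Searching A (v :: u :: S) disc e tr) (hco : Colored A B z (v :: u :: S) disc col grp)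
    (hh : Holds B z h col grp (v :: u :: S)) (hcur : h.reg .cur = v) :
    Wp wl (z.bound n) ac (fetch f) h fun t h' => ∃ r, t ≤ 4 + r * restoreCost A z.D ∧
      Keeps [.acc, .len, .lo, .seg, .low, .ctr, .nb, .pos] h h' ∧ h'.out = h.out ∧
      h'.reg .acc % ((B.row v).length + 1) = (B.row v).idxOf u ∧
      (∃ buf trl, MemRep z h'.mem col grp buf trl ∧ StackRep B z.D z.lg z.q (u :: S)
        (h'.reg .acc / ((B.row v).length + 1)) (h'.reg .len) (h'.reg .lo) buf trl) ∧
      ∀ k W, Paid z.q z.lg k W (h.reg .len) (h.reg .lo) (enc B z.D z.lg (v :: u :: S)).wt →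
        Paid z.q z.lg (k + r) (W + weight B z.D v) (h'.reg .len) (h'.reg .lo)
          (enc B z.D z.lg (u :: S)).wt := by
  have hw0 : wl ≠ 0 := by have := hz.lg_le; omega
  have hq := hz.q_pos
  have hsmall := hz.small
  have huv := (hse.chain v u S (List.suffix_refl _)).1
  have hdeg : 1 ≤ (B.row v).length := List.length_pos_of_mem ((B.mem_iff v u).2 huv)
  have hlenle : h.reg .len ≤ n * (z.D + 1) := by
    have := encLen_le hz hse.nodup
    obtain ⟨_, _, _, hs⟩ := hh
    rwa [hs.len_eq] at this
  have hlo : h.reg .lo * z.q ≤ h.reg .len := by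
    obtain ⟨_, _, _, hs⟩ := hh
    exact hs.lo_le
  have hbd := hz.bound_le
  have hb2 : z.trlB n = z.bufB n + 2 * z.q := rfl
  have hb3 : z.bound n = z.trlB n + z.D + 2 := rfl
  refine wp_ite rfl (by simp [Cond.Ok, Cond.fst, Cond.snd, hw0]) (fun hc => ?_) (fun hc => ?_)
  · simp only [Cond.Holds, Expr.eval_var, Expr.eval_ofNat] at hc
    -- the state after the restoration, if there is one
    refine wp_cons (Wp.mono (R := fun t h' => ∃ r, t ≤ 1 + r * restoreCost A z.D ∧
      Keeps [.acc, .len, .lo, .seg, .low, .ctr, .nb, .pos] h h' ∧ h'.out = h.out ∧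
      Holds B z h' col grp (v :: u :: S) ∧ h'.reg .acc = 1 ∧ h'.reg .len = h.reg .len ∧
      h'.reg .lo * z.q ≠ h.reg .len ∧
      ∀ k W, Paid z.q z.lg k W (h.reg .len) (h.reg .lo) 0 →
        Paid z.q z.lg (k + r) W (h'.reg .len) (h'.reg .lo) 0) ?_ ?_)
    · refine wp_ite rfl ?_ (fun hc' => ?_) (fun hc' => wp_nil ?_)
      · simp [Cond.Ok, Cond.fst, Cond.snd, hf.q_eq]
        omega
      · simp only [Cond.Holds, Expr.eval_mul, Expr.eval_var, hf.q_eq] at hc'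
        refine Wp.mono (wp_restore hz hin hf hse hco hh hc hc'.symm hcur) ?_
        rintro t₁ h₁ ⟨ht₁, hk₁, ho₁, hh₁, hacc₁, hlen₁, hlo1, hlo₁⟩
        refine ⟨1, by omega, hk₁, ho₁, hh₁, hacc₁, hlen₁, ?_, fun k W hk => ?_⟩
        · rw [hlo₁, hc', Nat.sub_mul, one_mul]
          have := Nat.mul_le_mul_right z.q hlo1
          omega
        · rw [hlen₁, hlo₁]
          exact hk.restore hlo1 hc'.symm
      · simp only [Cond.Holds, Expr.eval_mul, Expr.eval_var, hf.q_eq] at hc'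
        exact ⟨0, by omega, Keeps.refl _ _, rfl, hh, hc, rfl, fun hh => hc' hh.symm,
          fun k W hk => hk⟩
    · rintro t₁ h₁ ⟨r, ht₁, hk₁, ho₁, ⟨buf, trl, hm, hs⟩, hacc₁, hlen₁, hlo₁, hp₁⟩
      have hf₁ := hk₁.fixed hf rfl
      rw [hacc₁] at hs
      obtain ⟨hl1, hs', hmod⟩ := hs.pop_of_eq hdeg (by rwa [hlen₁])
      have hmod2 : (h₁.reg .len - 1) % (2 * z.q) < 2 * z.q := Nat.mod_lt _ (by omega)
      have hmem := hm.buf _ hmod2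
      refine wp_cons (wp_asg rfl (by simp [hw0]; omega) ?_)
      simp only [Expr.eval_sub, Expr.eval_var, Expr.eval_ofNat]
      refine wp_cons (wp_asg rfl (by simp [hf₁.q_eq, hf₁.bufB_eq]; omega) (wp_nil ?_))
      simp only [Expr.eval_ld, Expr.eval_add, Expr.eval_mod, Expr.eval_mul, Expr.eval_ofNat,
        Expr.eval_var, State.set_reg, reduceCtorEq, if_false, if_true, hf₁.q_eq, hf₁.bufB_eq,
        State.set_mem, hmem]
      refine ⟨r, by omega, (hk₁.set (by simp)).set (by simp), ho₁, hmod, ⟨buf, trl, hm, hs'⟩, ?_⟩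
      intro k W hk
      have hfull := hs.full_of_acc_eq_one hdeg
      rw [enc_push_of_le hfull] at hk
      exact (hp₁ k W hk).pop_of_full (le_wt_of_full hfull) hl1
  · simp only [Cond.Holds, Expr.eval_var, Expr.eval_ofNat] at hc
    obtain ⟨buf, trl, hm, hs⟩ := hh
    obtain ⟨hs', hmod⟩ := hs.pop_of_ne hc
    refine wp_nil ⟨0, by omega, Keeps.refl _ _, rfl, hmod, ⟨buf, trl, hm, hs'⟩, ?_⟩
    intro k W hk
    have hlt : (enc B z.D z.lg (u :: S)).acc * ((B.row v).length + 1) + (B.row v).idxOf u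
        < 2 ^ (z.lg + 1) := by
      by_contra hle
      have := hs.acc_eq
      rw [enc_push_of_le (not_lt.1 hle)] at this
      exact hc this.symm
    rw [enc_push_of_lt hlt] at hk
    exact hk.pop

/-- Pop the entry of the current vertex `v`: it leads to the parent `u` of `v` and, with the cross
link, to the position of `v` in the array of `u`. -/
theorem wp_popEntry (hz : z.Valid wl B) (hin : Input ac f A B) (hf : Fixed z n h)
    (hse : Searching A (v :: u :: S) disc e tr) (hco : Colored A B z (v :: u :: S) disc col grp)
    (hh : Holds B z h col grp (v :: u :: S)) (hcur : h.reg .cur = v) :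
    Wp wl (z.bound n) ac (popEntry f) h fun t h' => ∃ r, t ≤ 8 + r * restoreCost A z.D ∧
      Keeps [.acc, .len, .lo, .seg, .low, .ctr, .nb, .pos, .idx] h h' ∧ h'.out = h.out ∧
      h'.reg .low = u ∧ h'.reg .idx = (A.row u).idxOf v ∧ Holds B z h' col grp (u :: S) ∧
      ∀ k W, Paid z.q z.lg k W (h.reg .len) (h.reg .lo) (enc B z.D z.lg (v :: u :: S)).wt →
        Paid z.q z.lg (k + r) (W + weight B z.D v) (h'.reg .len) (h'.reg .lo)
          (enc B z.D z.lg (u :: S)).wt := by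
  have hw0 : wl ≠ 0 := by have := hz.lg_le; omega
  have hsmall := hz.small
  have hn : n ≤ n * (z.D + 1) := Nat.le_mul_of_pos_right _ (by omega)
  have huv := (hse.chain v u S (List.suffix_refl _)).1
  have hdeg := B.length_row_le v
  have hidx := (getElem_idxOf_row A u v huv).1
  have hdeg' := A.length_row_le u
  have e₁ := hin.inHead_idxOf huv
  have e₂ := hin.inMate_idxOf huv
  refine wp_cons (Wp.mono (wp_fetch hz hin hf hse hco hh hcur) ?_)
  rintro t₁ h₁ ⟨r, ht₁, hk₁, ho₁, hmod, ⟨buf, trl, hm, hs⟩, hp⟩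
  have hcur₁ : h₁.reg .cur = v := (hk₁ _ (by decide)).trans hcur
  refine wp_cons (wp_asg rfl (by simp [hcur₁, hin.inDeg_fin, hw0]; omega) ?_)
  simp only [Expr.eval_mod, Expr.eval_add, Expr.eval_qry, Expr.eval_ofNat, Expr.eval_var, hcur₁,
    hin.inDeg_fin, hmod]
  refine wp_cons (wp_asg rfl (by simp [hcur₁, hin.inDeg_fin, hw0]; omega) ?_)
  simp only [Expr.eval_div, Expr.eval_add, Expr.eval_qry, Expr.eval_ofNat, Expr.eval_var,
    State.set_reg, reduceCtorEq, if_false, hcur₁, hin.inDeg_fin]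
  refine wp_cons (wp_asg rfl (by simp [hcur₁, e₁]; omega) ?_)
  simp only [Expr.eval_qry, Expr.eval_var, State.set_reg, reduceCtorEq, if_false, if_true, hcur₁,
    e₁]
  refine wp_cons (wp_asg rfl (by simp [hcur₁, e₂]; omega) ?_)
  simp only [Expr.eval_qry, Expr.eval_var, State.set_reg, reduceCtorEq, if_false, if_true, hcur₁,
    e₂]
  refine wp_nil ⟨r, by omega, ?_, ho₁, by simp, by simp, ⟨buf, trl, hm, by simpa using hs⟩, ?_⟩
  · exact ((((hk₁.mono (by decide)).set (by simp)).set (by simp)).set (by simp)).set (by simp)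
  · simpa using hp

end

section

variable {n : ℕ} {R : Fin n → Fin n → Prop} {Q : Type}
variable {A : AdjArrays R} {B : AdjArrays fun v u => R u v} {z : Sizes} {wl : ℕ}
  {ac : Q → ℕ → ℕ → ℕ} {f : DQuery → Q} {h h' : State} {col grp : Fin n → ℕ} {S : List (Fin n)}
  {u v x : Fin n} {disc : Finset (Fin n)} {e : Fin n → ℕ} {tr : List (Event (Fin n))}

/-! ### The search -/

namespace Colored

theorem push_root (hc : Colored A B z [] disc col grp) :
    Colored A B z [v] (insert v disc) (Function.update col v 3) grp where
  white x hx := by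
    rw [Finset.mem_insert, not_or] at hx
    rw [Function.update_of_ne hx.1, hc.white x hx.2]
  black x hx hxS := by
    have hne : x ≠ v := by simpa using hxS
    rw [Function.update_of_ne hne]
    exact hc.black x ((Finset.mem_insert.1 hx).resolve_left hne) (by simp)
  root x hx := by
    obtain rfl : x = v := by simpa using hx.subset (List.mem_singleton_self x)
    simp
  hue w u S' hs := by simpa using hs.length_le
  group w u S' hs := by simpa using hs.length_le

theorem push (hc : Colored A B z (v :: S) disc col grp) (hS : ∀ y ∈ v :: S, y ∈ disc)
    (hnd : (v :: S).Nodup) (hw : x ∉ disc) :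
    Colored A B z (x :: v :: S) (insert x disc)
      (Function.update col x (4 + encLen B z.D z.lg (v :: S) / z.q))
      (Function.update grp v ((A.row v).idxOf x / gsize A z.D v)) where
  white y hy := by
    rw [Finset.mem_insert, not_or] at hy
    rw [Function.update_of_ne hy.1, hc.white y hy.2]
  black y hy hyS := by
    rw [List.mem_cons, not_or] at hyS
    rw [Function.update_of_ne hyS.1]
    exact hc.black y ((Finset.mem_insert.1 hy).resolve_left hyS.1) hyS.2
  root y hy := by
    rcases List.suffix_cons_iff.1 hy with hy' | hy'
    · simp at hy'
    · rw [Function.update_of_ne, hc.root y hy']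
      rintro rfl
      exact hw (hS _ (hy'.subset (by simp)))
  hue y u' S' hs := by
    rcases List.suffix_cons_iff.1 hs with hs' | hs'
    · obtain ⟨rfl, hs''⟩ := List.cons.inj hs'
      rw [Function.update_self, hs'']
    · rw [Function.update_of_ne, hc.hue y u' S' hs']
      rintro rfl
      exact hw (hS _ (hs'.subset (by simp)))
  group y u' S' hs := by
    rcases List.suffix_cons_iff.1 hs with hs' | hs'
    · obtain ⟨rfl, hs''⟩ := List.cons.inj hs'
      obtain ⟨rfl, rfl⟩ := List.cons.inj hs''
      rw [Function.update_self]
    · rw [Function.update_of_ne, hc.group y u' S' hs']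
      rintro rfl
      rcases List.suffix_cons_iff.1 hs' with hs'' | hs''
      · obtain ⟨rfl, rfl⟩ := List.cons.inj hs''
        simp at hnd
      · exact (List.nodup_cons.1 hnd).1 (hs''.subset (by simp))

theorem pop (hc : Colored A B z (v :: S) disc col grp) (hnd : (v :: S).Nodup) :
    Colored A B z S disc (Function.update col v 1) grp where
  white y hy := by
    by_cases hyv : y = v
    · subst hyv
      rcases S with _ | ⟨u, S⟩
      · have := hc.root y (List.suffix_refl _)
        have := hc.white y hy
        omega
      · have := hc.hue y u S (List.suffix_refl _)
        rw [hc.white y hy] at this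
        exact absurd this (Nat.ne_of_lt (Nat.add_pos_left (by norm_num) _))
    · rw [Function.update_of_ne hyv, hc.white y hy]
  black y hy hyS := by
    by_cases hyv : y = v
    · rw [hyv, Function.update_self]
    · rw [Function.update_of_ne hyv, hc.black y hy (by simp [hyv, hyS])]
  root y hy := by
    rw [Function.update_of_ne, hc.root y (hy.trans (List.suffix_cons _ _))]
    rintro rfl
    exact (List.nodup_cons.1 hnd).1 (hy.subset (by simp))
  hue y u' S' hs := by
    rw [Function.update_of_ne, hc.hue y u' S' (hs.trans (List.suffix_cons _ _))]
    rintro rfl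
    exact (List.nodup_cons.1 hnd).1 (hs.subset (by simp))
  group y u' S' hs := hc.group y u' S' (hs.trans (List.suffix_cons _ _))

end Colored

/-- What is not stored explicitly, but serves to describe the state of the search: the stack, the
discovered vertices, the numbers of edges explored, the events so far, the contents of the two
packed arrays, and the number of restorations so far. -/
structure Ghost (n : ℕ) : Type where
  stack : List (Fin n)
  disc : Finset (Fin n)
  e : Fin n → ℕ
  tr : List (Event (Fin n))
  col : Fin n → ℕ
  grp : Fin n → ℕ
  k : ℕ

/-- The total weight of the finished vertices. -/
def Ghost.done (B : AdjArrays fun v u => R u v) (z : Sizes) (g : Ghost n) : ℕ :=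
  ∑ v ∈ g.disc \ g.stack.toFinset, weight B z.D v

/-- The part of the invariant that does not depend on whether the stack is empty. -/
structure Common (A : AdjArrays R) (B : AdjArrays fun v u => R u v) (z : Sizes) (g : Ghost n)
    (h : State) : Prop where
  fixed : Fixed z n h
  searching : Searching A g.stack g.disc g.e g.tr
  colored : Colored A B z g.stack g.disc g.col g.grp
  out : h.out = g.tr.map (Event.map Fin.val)

/-- The invariant while the stack is not empty. The term `z.q * z.lg` in `paid` makes the bound hold
when a search starts at a root: then segment 0 is the lowest one kept, although it has not been
filled yet. -/
structure Active (A : AdjArrays R) (B : AdjArrays fun v u => R u v) (z : Sizes) (g : Ghost n)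
    (h : State) : Prop extends Common A B z g h where
  top : ∃ v S, g.stack = v :: S ∧ h.reg .cur = v ∧ h.reg .idx = g.e v
  bottom : ∃ v, [v] <:+ g.stack ∧ h.reg .root = v
  holds : Holds B z h g.col g.grp g.stack
  paid : Paid z.q z.lg g.k (g.done B z + z.q * z.lg) (h.reg .len) (h.reg .lo)
    (enc B z.D z.lg g.stack).wt
  fin : h.reg .fin = 0

/-- The invariant while the stack is empty. -/
structure Idle (A : AdjArrays R) (B : AdjArrays fun v u => R u v) (z : Sizes) (g : Ghost n)
    (h : State) : Prop extends Common A B z g h where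
  empty : g.stack = []
  mem : ∃ buf trl, MemRep z h.mem g.col g.grp buf trl
  paid : g.k * z.q * z.lg ≤ g.done B z
  le : g.k ≤ z.D + 3

/-- An upper bound for the time still needed, apart from the search for roots: each edge pays for
its exploration, each vertex on the stack for its pop, each undiscovered vertex for its push, and
each of the restorations still possible for itself. -/
def Ghost.potential (A : AdjArrays R) (z : Sizes) (g : Ghost n) : ℕ :=
  10 * ∑ v, ((A.row v).length - g.e v) + 20 * g.stack.length + 50 * (n - g.disc.card) +
    restoreCost A z.D * (z.D + 3 - g.k)

theorem done_push {k : ℕ} {col' grp' : Fin n → ℕ} {tr' : List (Event (Fin n))} {e' : Fin n → ℕ}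
    (hx : x ∉ disc) :
    (⟨x :: S, insert x disc, e', tr', col', grp', k⟩ : Ghost n).done B z =
      ∑ v ∈ disc \ S.toFinset, weight B z.D v := by
  rw [Ghost.done]
  congr 1
  ext y
  simp only [List.toFinset_cons, Finset.mem_sdiff, Finset.mem_insert, List.mem_toFinset, not_or]
  constructor
  · rintro ⟨h1, h2, h3⟩
    exact ⟨h1.resolve_left h2, h3⟩
  · rintro ⟨h1, h2⟩
    exact ⟨.inr h1, fun hh => hx (hh ▸ h1), h2⟩

theorem done_pop {k : ℕ} {col' grp' : Fin n → ℕ} {tr' : List (Event (Fin n))} {e' : Fin n → ℕ}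
    (hv : v ∈ disc) (hnd : (v :: S).Nodup) :
    (⟨S, disc, e', tr', col', grp', k⟩ : Ghost n).done B z =
      (∑ v ∈ disc \ (v :: S).toFinset, weight B z.D v) + weight B z.D v := by
  rw [Ghost.done, add_comm, ← Finset.sum_insert (by simp)]
  congr 1
  have hvS := (List.nodup_cons.1 hnd).1
  ext y
  simp only [List.toFinset_cons, Finset.mem_sdiff, Finset.mem_insert, List.mem_toFinset, not_or]
  by_cases hy : y = v
  · simp [hy, hv, hvS]
  · simp [hy]

theorem sum_explore (A : AdjArrays R) (hi : e v < (A.row v).length) :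
    ∑ x, ((A.row x).length - Function.update e v (e v + 1) x) + 1 =
      ∑ x, ((A.row x).length - e x) := by
  rw [← Finset.add_sum_erase _ _ (Finset.mem_univ v),
    ← Finset.add_sum_erase (a := v) _ (fun x => (A.row x).length - e x) (Finset.mem_univ v),
    Function.update_self,
    Finset.sum_congr rfl fun x hx => by rw [Function.update_of_ne (Finset.ne_of_mem_erase hx)]]
  omega

/-- Since a segment accounts for a weight of at least `n`, there are at most `D + 3` restorations.
-/
theorem Paid.le_of_valid {k len lo wt W : ℕ} (hz : z.Valid wl B) (hW : W ≤ n * (z.D + 1))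
    (hp : Paid z.q z.lg k (W + z.q * z.lg) len lo wt) : k ≤ z.D + 3 := by
  have h1 : n * (z.D + 1) ≤ z.q * z.lg * (z.D + 1) := Nat.mul_le_mul_right _ hz.n_le
  have h2 : z.lg ≤ z.q * z.lg := Nat.le_mul_of_pos_left _ hz.q_pos
  have h3 : 1 ≤ z.q * z.lg := hz.lg_pos.trans h2
  rw [Paid, Nat.add_mul] at hp
  have h4 : k * z.q * z.lg ≤ z.q * z.lg * (z.D + 3) := by
    have : z.q * z.lg * (z.D + 3) = z.q * z.lg * (z.D + 1) + z.q * z.lg + z.q * z.lg := by ring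
    split_ifs at hp <;> omega
  rw [mul_assoc, mul_comm] at h4
  exact Nat.le_of_mul_le_mul_left h4 h3

theorem Ghost.done_le (hz : z.Valid wl B) (g : Ghost n) : g.done B z ≤ n * (z.D + 1) :=
  (Finset.sum_le_sum_of_subset (Finset.subset_univ _)).trans hz.weight_le

set_option maxHeartbeats 1000000 in
/-- The new vertex is pushed. Its discovery and the exploration of the tree edge pay for this. -/
theorem wp_descend {g : Ghost n} (hz : z.Valid wl B) (hin : Input ac f A B)
    (ha : Active A B z g h) (hg : g.stack = v :: S) (hi : g.e v < (A.row v).length)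
    (hnb : h.reg .nb = (A.row v)[g.e v]) (hw : (A.row v)[g.e v] ∉ g.disc) :
    Wp wl (z.bound n) ac (descend f) h fun t h' => ∃ g', Active A B z g' h' ∧
      t + 10 + g'.potential A z ≤ g.potential A z ∧ g.disc ⊆ g'.disc ∧
      h'.reg .start = h.reg .start := by
  have hw0 : wl ≠ 0 := by have := hz.lg_le; omega
  have hsmall := hz.small
  have hn : n ≤ n * (z.D + 1) := Nat.le_mul_of_pos_right _ (by omega)
  have hbits : 2 ^ z.bits ≤ 2 ^ wl := Nat.pow_le_pow_right (by omega) hz.bits_le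
  have hD := hz.D_lt
  have hbd := hz.bound_le
  have hb2 : z.trlB n = z.bufB n + 2 * z.q := rfl
  have hb3 : z.bound n = z.trlB n + z.D + 2 := rfl
  have hb4 : z.bufB n = 2 * z.grpB n := rfl
  obtain ⟨stack, disc, e, tr, col, grp, k⟩ := g
  simp only at hg hi hnb hw
  subst hg
  obtain ⟨⟨hf, hse, hco, hout⟩, ⟨v', S', hv', hcur, hidx⟩, hbot, hh, hp, hfin⟩ := ha
  simp only at hse hco hout hv' hcur hidx hbot hh hp hfin
  obtain ⟨rfl, rfl⟩ := List.cons.inj hv'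
  have hdeg := A.length_row_le v
  have hdiv : (A.row v).length / z.D ≤ (A.row v).length := Nat.div_le_self _ _
  set y := (A.row v)[e v] with hy
  have hyidx : (A.row v).idxOf y = e v := idxOf_row_getElem A v _ hi
  have hgrp_lt : e v / ((A.row v).length / z.D + 1) < 2 ^ z.bits := by
    have h1 := Nat.lt_mul_div_succ (A.row v).length hz.D_pos
    -- each array is divided into at most `D` groups
    have h2 : e v / ((A.row v).length / z.D + 1) < z.D :=
      Nat.div_lt_of_lt_mul (by rw [mul_comm]; omega)
    omega
  have hseg := encLen_div_le hz hse.nodup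
  have hlen : h.reg .len = encLen B z.D z.lg (v :: S) := by
    obtain ⟨_, _, _, hs⟩ := hh
    exact hs.len_eq.symm
  have hmate := hin.outMate_fin v hi
  have hnd : (y :: v :: S).Nodup := (hse.treeEdge hi hw).nodup
  refine wp_cons (wp_say (wp_cons (wp_say ?_)))
  set h₁ := (h.put _).put _ with hh₁
  have hf₁ : Fixed z n h₁ := hf
  have ho₁ : h₁.out =
      (tr ++ [Event.exploreTreeEdge v y, Event.preprocess y]).map (Event.map Fin.val) := by
    simp [hh₁, hout, Event.map, hcur, hnb]
  have hH₁ : Holds B z h₁ col grp (v :: S) := hh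
  refine wp_cons (wp_setGrp (x := v) (c := e v / ((A.row v).length / z.D + 1)) hz hf₁ hH₁
    (show (Expr.var .cur : Expr Q).eval ac h₁ = _ from hcur)
    ?_ hgrp_lt rfl trivial ?_ fun h₂ hk₂ ho₂ hH₂ => ?_)
  · simp [hh₁, hcur, hidx, hf.D_eq, hin.outDeg_fin]
  · simp [hh₁, hcur, hf.D_eq, hin.outDeg_fin, hw0]
    omega
  have hf₂ := hk₂.fixed hf₁ rfl
  have hl₂ : h₂.reg .len = encLen B z.D z.lg (v :: S) := (hk₂ _ (by simp)).trans hlen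
  refine wp_cons (wp_setCol (x := y) (c := 4 + encLen B z.D z.lg (v :: S) / z.q) hz hf₂ hH₂
    (show (Expr.var .nb : Expr Q).eval ac h₂ = _ from (hk₂ _ (by simp)).trans hnb)
    ?_ ((Nat.add_le_add_left hseg 4).trans_lt (by omega)) rfl trivial ?_ fun h₃ hk₃ ho₃ hH₃ => ?_)
  · simp [hl₂, hf₂.q_eq]
  · simp [hl₂, hf₂.q_eq]
    omega
  have hk₃' : Keeps [] h₁ h₃ := hk₂.trans hk₃ (by simp)
  have hr₃ : ∀ y, h₃.reg y = h.reg y := fun y => hk₃' y (by simp)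
  have hf₃ := hk₃'.fixed hf₁ rfl
  refine wp_cons (wp_asg rfl ?_ ?_)
  · simp only [Expr.ok_qry, Expr.ok_var, Expr.eval_var, hr₃, hcur, hidx, hmate]
    exact ⟨trivial, trivial,
      (List.idxOf_le_length.trans (B.length_row_le _)).trans_lt (by omega)⟩
  simp only [Expr.eval_qry, Expr.eval_var, hr₃, hcur, hidx, hmate]
  refine wp_cons (Wp.mono (wp_pushEntry (x := y) hz hin (hf₃.set rfl)
    (hH₃.congr rfl (by simp) (by simp) (by simp)) hnd (by simp [hr₃, hnb]) (by simp; rfl)) ?_)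
  rintro t₄ h₄ ⟨ht₄, hk₄, ho₄, hH₄, -, hp₄⟩
  have hk : ∀ y, y ∉ [Var.acc, .len, .lo, .pos] → h₄.reg y = h.reg y := by
    intro y hy
    simp only [List.mem_cons, not_or] at hy
    rw [hk₄ y (by simp [hy]), State.set_reg, if_neg (by simp [hy]), hr₃]
  refine wp_cons (wp_asg rfl (by simp) (wp_cons (wp_asg rfl (by simp) (wp_nil ?_))))
  simp only [Expr.eval_var, Expr.eval_ofNat, hk .nb (by decide), hnb]
  have hse' := hse.treeEdge hi hw
  refine ⟨⟨y :: v :: S, insert y disc, Function.update e v (e v + 1), _, _, _, k⟩,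
    ⟨⟨?_, hse', hco.push hse.subset hse.nodup hw, ?_⟩,
      ⟨y, v :: S, rfl, by simp, ?_⟩, ?_, ?_, ?_, ?_⟩, ?_, Finset.subset_insert _ _, ?_⟩
  · exact ((hk₄.fixed (hf₃.set rfl) rfl).set rfl).set rfl
  · simp only [State.set_out, ho₄, ho₃, ho₂, ho₁]
    rfl
  · have : y ≠ v := fun hh => by simp [hh] at hnd
    simp [Function.update_of_ne this, hse.white y hw]
  · obtain ⟨r, hr, hr'⟩ := hbot
    exact ⟨r, hr.trans (List.suffix_cons _ _), by simp [hk, hr']⟩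
  · rw [hyidx]
    exact hH₄.congr rfl (by simp) (by simp) (by simp)
  · rw [done_push hw]
    simp only [State.set_reg, reduceCtorEq, if_false, hr₃] at hp₄ ⊢
    exact hp₄ k _ hp
  · simp [hk, hfin]
  · have h1 := sum_explore A hi
    have h2 : disc.card + 1 ≤ n := by
      rw [← Finset.card_insert_of_notMem hw]
      exact (Finset.card_le_univ _).trans (by simp)
    simp only [Ghost.potential, Finset.card_insert_of_notMem hw, List.length_cons]
    omega
  · simp [hk]

/-- The current vertex is popped, with a restoration if necessary, and colored as finished. The
color changes after the pop, since a restoration needs the old color to reach the vertex. -/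
theorem wp_ascend {g : Ghost n} (hz : z.Valid wl B) (hin : Input ac f A B)
    (ha : Active A B z g h) (hg : g.stack = v :: u :: S) (hi : (A.row v).length ≤ g.e v) :
    Wp wl (z.bound n) ac (ascend f) (h.put (.postprocess v)) fun t h' => ∃ g', Active A B z g' h' ∧
      t + 5 + g'.potential A z ≤ g.potential A z ∧ g.disc ⊆ g'.disc ∧
      h'.reg .start = h.reg .start := by
  have hw0 : wl ≠ 0 := by have := hz.lg_le; omega
  have hsmall := hz.small
  have hn : n ≤ n * (z.D + 1) := Nat.le_mul_of_pos_right _ (by omega)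
  have hD := hz.D_lt
  obtain ⟨stack, disc, e, tr, col, grp, k⟩ := g
  simp only at hg hi
  subst hg
  obtain ⟨⟨hf, hse, hco, hout⟩, ⟨v', S', hv', hcur, hidx⟩, hbot, hh, hp, hfin⟩ := ha
  simp only at hse hco hout hv' hcur hidx hbot hh hp hfin
  obtain ⟨rfl, rfl⟩ := List.cons.inj hv'
  have hvd : v ∈ disc := hse.subset v (by simp)
  have hch := hse.chain v u S (List.suffix_refl _)
  have hle := (getElem_idxOf_row A u v hch.1).1
  have hdegu := A.length_row_le u
  refine wp_cons (Wp.mono (wp_popEntry (h := h.put (.postprocess v)) hz hin hf hse hco hh hcur) ?_)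
  rintro t₁ h₁ ⟨r, ht₁, hk₁, ho₁, hlow, hidx₁, hh₁, hp₁⟩
  have hf₁ : Fixed z n h₁ := hk₁.fixed (h := h.put (.postprocess v)) hf rfl
  have hcur₁ : h₁.reg .cur = v := (hk₁ _ (by decide)).trans hcur
  refine wp_cons (wp_setCol (x := v) (c := 1) hz hf₁ hh₁
    (show (Expr.var .cur : Expr Q).eval ac h₁ = _ from hcur₁) rfl (by omega) rfl trivial
    (by simp [hw0]) fun h₂ hk₂ ho₂ hh₂ => ?_)
  have hr₂ : ∀ y, h₂.reg y = h₁.reg y := fun y => hk₂ y (by simp)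
  refine wp_cons (wp_say (wp_cons (wp_asg rfl (by simp) (wp_cons (wp_asg rfl ?_ (wp_nil ?_))))))
  · simp [hr₂, hidx₁]
    omega
  simp only [Expr.eval_add, Expr.eval_var, Expr.eval_ofNat, State.put_reg, State.set_reg, hr₂,
    hlow, hidx₁, reduceCtorEq, if_false]
  have hp' := hp₁ k _ hp
  have hdone := done_pop (B := B) (z := z) (k := k + r) (col' := Function.update col v 1)
    (grp' := grp) (tr' := tr ++ [.postprocess v, .retreatTreeEdge u v]) (e' := e) hvd hse.nodup
  refine ⟨⟨u :: S, disc, e, tr ++ [.postprocess v, .retreatTreeEdge u v], Function.update col v 1,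
    grp, k + r⟩, ⟨⟨?_, hse.retreat hi, hco.pop hse.nodup, ?_⟩,
      ⟨u, S, rfl, by simp, ?_⟩, ?_, ?_, ?_, ?_⟩, ?_, Finset.Subset.refl _, ?_⟩
  · exact Fixed.set (Fixed.set (h := h₂.put _) (hk₂.fixed hf₁ rfl) rfl) rfl
  · simp [ho₂, ho₁, hout, Event.map, hr₂, hlow, hcur₁]
  · simp [hch.2]
  · obtain ⟨r, hr, hr'⟩ := hbot
    refine ⟨r, ?_, ?_⟩
    · rcases List.suffix_cons_iff.1 hr with hr'' | hr''
      · simp at hr''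
      · exact hr''
    · simp only [State.set_reg, State.put_reg, reduceCtorEq, if_false, hr₂]
      rw [hk₁ _ (by decide)]
      exact hr'
  · exact hh₂.congr rfl (by simp) (by simp) (by simp)
  · rw [hdone]
    simp only [State.set_reg, State.put_reg, reduceCtorEq, if_false, hr₂]
    rw [Ghost.done] at hp'
    rwa [add_right_comm] at hp'
  · simp only [State.set_reg, State.put_reg, reduceCtorEq, if_false, hr₂]
    rw [hk₁ _ (by decide)]
    exact hfin
  · have hkr : k + r ≤ z.D + 3 := by
      refine Paid.le_of_valid hz (W := Ghost.done B z ⟨u :: S, disc, e,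
        tr ++ [.postprocess v, .retreatTreeEdge u v], Function.update col v 1, grp, k + r⟩)
        (Ghost.done_le hz _) (len := h₁.reg .len) (lo := h₁.reg .lo)
        (wt := (enc B z.D z.lg (u :: S)).wt) ?_
      rw [hdone]
      rw [Ghost.done] at hp'
      rwa [add_right_comm] at hp'
    have h1 : restoreCost A z.D * (z.D + 3 - k) =
        r * restoreCost A z.D + restoreCost A z.D * (z.D + 3 - (k + r)) := by
      rw [mul_comm r, ← Nat.mul_add]
      congr 1
      omega
    simp only [Ghost.potential, List.length_cons, h1]
    omega
  · exact hk₁ _ (by decide)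

end

section

variable {n : ℕ} {R : Fin n → Fin n → Prop} {Q : Type}
variable {A : AdjArrays R} {B : AdjArrays fun v u => R u v} {z : Sizes} {wl : ℕ}
  {ac : Q → ℕ → ℕ → ℕ} {f : DQuery → Q} {h h' : State} {col grp : Fin n → ℕ} {S : List (Fin n)}
  {u v x : Fin n} {disc : Finset (Fin n)} {e : Fin n → ℕ} {tr : List (Event (Fin n))}

/-- An edge that has not been explored is explored: a vertex is undiscovered if it has color 0. -/
theorem wp_explore {g : Ghost n} (hz : z.Valid wl B) (hin : Input ac f A B)
    (ha : Active A B z g h) (hg : g.stack = v :: S) (hi : g.e v < (A.row v).length)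
    (hcur : h.reg .cur = v) (hidx : h.reg .idx = g.e v) :
    Wp wl (z.bound n) ac (block [
      asg .nb (.qry (f .outHead) (.var .cur) (.var .idx)),
      ite' (.eq (fld 0 (.var .nb)) 0) (descend f)
        (block [say (.handleBackEdge .cur .nb), asg .idx (.var .idx + 1)])]) h
      fun t h' => ∃ g', Active A B z g' h' ∧
      t + 2 + g'.potential A z ≤ g.potential A z ∧ g.disc ⊆ g'.disc ∧
      h'.reg .start = h.reg .start := by
  have hw0 : wl ≠ 0 := by have := hz.lg_le; omega
  have hsmall := hz.small
  have hn : n ≤ n * (z.D + 1) := Nat.le_mul_of_pos_right _ (by omega)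
  have hdeg := A.length_row_le v
  have hhead := hin.outHead_fin v hi
  set y := (A.row v)[g.e v] with hy
  refine wp_cons (wp_asg rfl ?_ ?_)
  · simp [hcur, hidx, hhead]
    omega
  simp only [Expr.eval_qry, Expr.eval_var, hcur, hidx, hhead]
  have ha' : Active A B z g (h.set .nb y) := by
    obtain ⟨⟨hf, hse, hco, hout⟩, ⟨v', S', hv', hcur, hidx⟩, ⟨r, hr, hr'⟩, hh, hp, hfin⟩ := ha
    exact ⟨⟨hf.set rfl, hse, hco, hout⟩, ⟨v', S', hv', by simpa using hcur, by simpa using hidx⟩,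
      ⟨r, hr, by simpa using hr'⟩, hh.congr rfl (by simp) (by simp) (by simp), by simpa using hp,
      by simpa using hfin⟩
  have hnb : (h.set .nb y).reg .nb = y := by simp
  have hev : (Expr.var .nb : Expr Q).eval ac (h.set .nb y) = (y : ℕ) := hnb
  have hcol : (fld 0 (.var .nb) : Expr Q).eval ac (h.set .nb y) = g.col y := by
    obtain ⟨_, _, hm, _⟩ := ha'.holds
    exact eval_fld ha'.fixed hm.col rfl hev
  refine wp_cons (wp_ite rfl ⟨ok_fld hz ha'.fixed (Nat.zero_le _) rfl hev (by simp) trivial,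
    by simp [Cond.snd]⟩ (fun hc => ?_) (fun hc => ?_))
  · simp only [Cond.Holds, hcol, Expr.eval_ofNat] at hc
    have hw : y ∉ g.disc := by
      intro hd
      rcases ha.colored.cases y with h1 | h1 | ⟨-, h1 | ⟨u, S', h1⟩⟩
      · by_cases hyS : y ∈ g.stack
        · obtain ⟨s, t, hst⟩ := List.append_of_mem hyS
          rcases t with _ | ⟨u, t⟩
          · have := ha.colored.root y ⟨s, hst.symm⟩
            omega
          · have := ha.colored.hue y u t ⟨s, hst.symm⟩
            rw [hc] at this
            exact absurd this (Nat.ne_of_lt (Nat.add_pos_left (by norm_num) _))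
        · have := ha.colored.black y hd hyS
          omega
      · omega
      · omega
      · rw [ha.colored.hue y u S' h1] at hc
        exact absurd hc (Nat.ne_of_gt (Nat.add_pos_left (by norm_num) _))
    refine Wp.mono (wp_descend hz hin ha' hg hi hnb hw) ?_
    rintro t h' ⟨g', hg', hpot, hsub, hst⟩
    exact wp_nil ⟨g', hg', by omega, hsub, by simpa using hst⟩
  · simp only [Cond.Holds, hcol, Expr.eval_ofNat] at hc
    have hw : y ∈ g.disc := by
      by_contra hd
      exact hc (ha.colored.white y hd)
    refine wp_cons (wp_say (wp_cons (wp_asg rfl (by simp [hidx, hw0]; omega) (wp_nil (wp_nil ?_)))))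
    obtain ⟨stack, disc, e, tr, col, grp, k⟩ := g
    simp only at hg hi hw hidx
    subst hg
    obtain ⟨⟨hf, hse, hco, hout⟩, -, ⟨r, hr, hr'⟩, hh, hp, hfin⟩ := ha'
    simp only at hse hco hout hr hh hp
    have hse' := hse.backEdge hi hw
    refine ⟨⟨v :: S, disc, Function.update e v (e v + 1), _, col, grp, k⟩,
      ⟨⟨?_, hse', hco, ?_⟩, ⟨v, S, rfl, ?_, ?_⟩, ⟨r, hr, ?_⟩, ?_, ?_, ?_⟩, ?_,
      Finset.Subset.refl _, ?_⟩
    · exact Fixed.set (h := (h.set .nb y).put _) hf rfl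
    · rw [State.set_out] at hout
      simp [hout, Event.map, hcur, hy]
    · simp [hcur]
    · simp [hidx]
    · simpa using hr'
    · exact hh.congr rfl (by simp) (by simp) (by simp)
    · simp only [State.set_reg, State.put_reg, reduceCtorEq, if_false] at hp ⊢
      exact hp
    · simpa using hfin
    · have h1 := sum_explore A hi
      simp only [Ghost.potential]
      omega
    · simp

/-- A move of the search is correct and is paid for by the potential. -/
theorem wp_move {g : Ghost n} (hz : z.Valid wl B) (hin : Input ac f A B)
    (ha : Active A B z g h) :
    Wp wl (z.bound n) ac (move f) h fun t h' => ∃ g',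
      (Active A B z g' h' ∨ Idle A B z g' h' ∧ h'.reg .fin = 1) ∧
      t + 1 + g'.potential A z ≤ g.potential A z ∧ g.disc ⊆ g'.disc ∧
      h'.reg .start = h.reg .start := by
  have hw0 : wl ≠ 0 := by have := hz.lg_le; omega
  have hsmall := hz.small
  have hn : n ≤ n * (z.D + 1) := Nat.le_mul_of_pos_right _ (by omega)
  have hD := hz.D_lt
  obtain ⟨v, S, hg, hcur, hidx⟩ := ha.top
  have hdeg := A.length_row_le v
  have hd := hin.outDeg_fin v 0
  refine wp_ite rfl ?_ (fun hc => ?_) (fun hc => ?_)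
  · simp [Cond.Ok, Cond.fst, Cond.snd, hcur, hd]
    omega
  · simp only [Cond.Holds, Expr.eval_var, Expr.eval_qry, Expr.eval_ofNat, hcur, hidx, hd] at hc
    refine Wp.mono (wp_explore hz hin ha hg hc hcur hidx) ?_
    rintro t h' ⟨g', hg', hpot, hsub, hst⟩
    exact ⟨g', .inl hg', by omega, hsub, hst⟩
  · simp only [Cond.Holds, Expr.eval_var, Expr.eval_qry, Expr.eval_ofNat, hcur, hidx, hd,
      not_lt] at hc
    refine wp_cons (wp_say ?_)
    have hev : Event.map h.reg (.postprocess .cur) = .postprocess (v : ℕ) := by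
      simp [Event.map, hcur]
    rw [hev]
    obtain ⟨r, hr, hroot⟩ := ha.bottom
    refine wp_cons (wp_ite rfl ⟨trivial, trivial⟩ (fun hc' => ?_) (fun hc' => ?_))
    · simp only [Cond.Holds, Expr.eval_var, State.put_reg, hcur, hroot, Fin.val_inj] at hc'
      subst hc'
      have hS : S = [] := by
        have := ha.searching.nodup
        rw [hg] at hr this
        rcases List.suffix_cons_iff.1 hr with h1 | h1
        · exact (List.cons.inj h1).2.symm
        · exact absurd (h1.subset (by simp)) (List.nodup_cons.1 this).1
      obtain ⟨stack, disc, e, tr, col, grp, k⟩ := g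
      simp only at hg hc hidx
      subst hg
      subst hS
      obtain ⟨⟨hf, hse, hco, hout⟩, -, -, hh, hp, hfin⟩ := ha
      simp only at hse hco hout hh hp
      have hk := Paid.le_of_valid hz (Ghost.done_le hz _) hp
      refine wp_cons (wp_setCol (h := h.put _) (x := v) (c := 1) hz hf hh
        (show (Expr.var .cur : Expr Q).eval ac (h.put _) = _ from hcur) rfl (by omega) rfl trivial
        (by simp [hw0]) fun h₂ hk₂ ho₂ hh₂ => ?_)
      refine wp_cons (wp_asg rfl (by simp [hw0]) (wp_nil (wp_nil ?_)))
      have hdone := done_pop (B := B) (z := z) (k := k) (col' := Function.update col v 1)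
        (grp' := grp) (tr' := tr ++ [.postprocess v]) (e' := e) (hse.subset v (by simp)) hse.nodup
      refine ⟨⟨[], disc, e, tr ++ [.postprocess v], Function.update col v 1, grp, k⟩,
        .inr ⟨⟨⟨?_, hse.finishRoot hc, hco.pop hse.nodup, ?_⟩, rfl, ?_, ?_, hk⟩, by simp⟩, ?_,
        Finset.Subset.refl _, ?_⟩
      · exact (hk₂.fixed (h := h.put _) hf rfl).set rfl
      · simp [ho₂, hout, Event.map]
      · obtain ⟨buf, trl, hm, -⟩ := hh₂
        exact ⟨buf, trl, hm⟩
      -- the root has no entry, so that no word is left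
      · obtain ⟨_, _, _, hs⟩ := hh
        have hlen : h.reg .len = 0 := by rw [← hs.len_eq, encLen_singleton]
        have hlo : h.reg .lo = 0 := by
          have := hs.lo_le
          rw [hlen] at this
          have hq := hz.q_pos
          rcases Nat.mul_eq_zero.1 (Nat.le_zero.1 this) with h1 | h1 <;> omega
        rw [Paid, hlen, hlo, enc_singleton, Ghost.done] at hp
        rw [hdone]
        simp only [zero_add, one_mul, Nat.sub_zero, Nat.add_mul, min_zero, ite_self,
          Nat.le_zero] at hp
        simp only
        omega
      · simp only [Ghost.potential, List.length_cons, List.length_nil]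
        omega
      · simp only [State.set_reg, reduceCtorEq, if_false]
        exact hk₂ _ (by simp)
    · simp only [Cond.Holds, Expr.eval_var, State.put_reg, hcur, hroot, Fin.val_inj] at hc'
      obtain ⟨u, S', rfl⟩ : ∃ u S', S = u :: S' := by
        rw [hg] at hr
        rcases S with _ | ⟨u, S'⟩
        · have := hr.subset (List.mem_singleton_self r)
          exact absurd (List.mem_singleton.1 this).symm hc'
        · exact ⟨u, S', rfl⟩
      refine Wp.mono (wp_ascend hz hin ha hg hc) ?_
      rintro t h' ⟨g', hg', hpot, hsub, hst⟩
      exact wp_nil ⟨g', .inl hg', by omega, hsub, hst⟩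

/-- The search of everything that can be reached from an undiscovered vertex. -/
theorem wp_searchFrom {g : Ghost n} (hz : z.Valid wl B) (hin : Input ac f A B)
    (ha : Idle A B z g h) (hst : h.reg .start = v) (hv : v ∉ g.disc) :
    Wp wl (z.bound n) ac (searchFrom f) h fun t h' => ∃ g', Idle A B z g' h' ∧
      t + g'.potential A z ≤ g.potential A z ∧ insert v g.disc ⊆ g'.disc ∧
      h'.reg .start = v := by
  have hw0 : wl ≠ 0 := by have := hz.lg_le; omega
  have hsmall := hz.small
  have hD := hz.D_lt
  have hbits : 2 ^ z.bits ≤ 2 ^ wl := Nat.pow_le_pow_right (by omega) hz.bits_le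
  have hbd := hz.bound_le
  have hb3 : z.bound n = z.trlB n + z.D + 2 := rfl
  obtain ⟨stack, disc, e, tr, col, grp, k⟩ := g
  obtain ⟨⟨hf, hse, hco, hout⟩, hemp, ⟨buf, trl, hm⟩, hp, hk⟩ := ha
  simp only at hse hco hout hemp hm hp hk hv
  subst hemp
  refine wp_cons (wp_asg rfl (by simp) (wp_cons (wp_asg rfl (by simp) (wp_cons (wp_asg rfl (by simp)
    (wp_cons (wp_asg rfl (by simp) (wp_cons (wp_asg rfl (by simp [hw0])
    (wp_cons (wp_asg rfl (by simp) (wp_cons (wp_asg rfl (by simp) ?_)))))))))))))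
  simp only [Expr.eval_var, Expr.eval_ofNat, State.set_reg, reduceCtorEq, if_false, hst]
  set h₁ := ((((((h.set .cur v).set .root v).set .idx 0).set .fin 0).set .acc 1).set .len 0).set
    .lo 0 with hh₁
  have hf₁ : Fixed z n h₁ :=
    ((((((hf.set rfl).set rfl).set rfl).set rfl).set rfl).set rfl).set rfl
  refine wp_cons (wp_sto rfl trivial trivial (by simp [hf₁.trlB_eq]; omega) ?_)
  simp only [Expr.eval_var, hf₁.trlB_eq]
  have hm₂ := hm.set_trl 0 v
  rw [add_zero] at hm₂
  have hst₁ : h₁.reg .start = v := by simp [hh₁, hst]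
  have hH : Holds B z (h₁.write (z.trlB n) (h₁.reg .start)) col grp [v] := by
    refine ⟨buf, _, by rw [hst₁]; exact hm₂, ?_⟩
    have := StackRep.singleton (B := B) (D := z.D) (L := z.lg) (q := z.q) (buf := buf)
      (trl := Function.update trl 0 (v : ℕ)) v (by simp)
    simpa [hh₁] using this
  refine wp_cons (wp_setCol (x := v) (c := 3) hz (h := h₁.write _ _) hf₁ hH
    (show (Expr.var .start : Expr Q).eval ac (h₁.write _ _) = _ from hst₁) rfl (by omega) rfl
    trivial (by simp; omega) fun h₂ hk₂ ho₂ hH₂ => ?_)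
  have hr₂ : ∀ y, h₂.reg y = h₁.reg y := fun y => hk₂ y (by simp)
  have hf₂ : Fixed z n h₂ := hk₂.fixed (h := h₁.write _ _) hf₁ rfl
  refine wp_cons (wp_say ?_)
  have hdone := done_push (B := B) (z := z) (k := k) (col' := Function.update col v 3) (S := [])
    (grp' := grp) (tr' := tr ++ [.preprocess v]) (e' := e) hv
  have hdone' : Ghost.done B z ⟨[], disc, e, tr, col, grp, k⟩ =
    ∑ v ∈ disc \ [].toFinset, weight B z.D v := rfl
  refine wp_cons (wp_while
    (fun g' h' => (Active A B z g' h' ∨ Idle A B z g' h' ∧ h'.reg .fin = 1) ∧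
      insert v disc ⊆ g'.disc ∧ h'.reg .start = v) (Ghost.potential A z) rfl ?_ ?_
    (g := ⟨[v], insert v disc, e, tr ++ [.preprocess v], Function.update col v 3, grp, k⟩)
    ⟨.inl ⟨⟨hf₂, hse.root hv, hco.push_root, ?_⟩, ⟨v, [], rfl, ?_, ?_⟩,
      ⟨v, List.suffix_refl _, ?_⟩, hH₂, ?_, ?_⟩, subset_rfl, ?_⟩ ?_)
  · intro g' h' _
    exact ⟨trivial, by simp [Cond.snd, hw0]⟩
  · rintro g' h' ⟨hg', hsub, hst'⟩ hc
    rcases hg' with hg' | ⟨-, hfin⟩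
    · refine Wp.mono (wp_move hz hin hg') ?_
      rintro t h'' ⟨g'', hg'', hpot, hsub', hst''⟩
      exact ⟨g'', ⟨hg'', hsub.trans hsub', hst''.trans hst'⟩, hpot⟩
    · simp [Cond.Holds, hfin] at hc
  · simp [ho₂, hh₁, hout, Event.map, hr₂]
  · simp [hr₂, hh₁]
  · simp [hr₂, hh₁, hse.white v hv]
  · simp [hr₂, hh₁]
  · have h1 : h₂.reg .len = 0 := by simp [hr₂, hh₁]
    have h2 : h₂.reg .lo = 0 := by simp [hr₂, hh₁]
    simp only [State.put_reg, h1, h2]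
    rw [hdone, ← hdone', Paid, enc_singleton]
    simp only [zero_add, one_mul, Nat.sub_zero, Nat.add_mul, min_zero, ite_self]
    omega
  · simp [hr₂, hh₁]
  · simp [hr₂, hst₁]
  · rintro t g' h' ⟨hg', hsub, hst'⟩ hc hpot
    rcases hg' with hg' | ⟨hg', -⟩
    · simp [Cond.Holds, hg'.fin] at hc
    · refine wp_nil ⟨g', hg', ?_, hsub, hst'⟩
      have h2 : disc.card + 1 ≤ n := by
        rw [← Finset.card_insert_of_notMem hv]
        exact (Finset.card_le_univ _).trans (by simp)
      simp only [Ghost.potential, Finset.card_insert_of_notMem hv, List.length_cons,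
        List.length_nil] at hpot ⊢
      omega

/-- After the computation of the sizes, the search is correct and takes linear time, provided that
the restoration of all segments does. -/
theorem wp_searchAll (hz : z.Valid wl B) (hin : Input ac f A B) (hf : Fixed z n h)
    (hmem : ∀ p, h.mem p = 0) (hout : h.out = []) :
    Wp wl (z.bound n) ac (searchAll f) h fun t h' =>
      t ≤ 10 * ∑ v, (A.row v).length + 54 * n + restoreCost A z.D * (z.D + 3) + 2 ∧
      ∃ tr, IsDFS R tr ∧ h'.out = tr.map (Event.map Fin.val) := by
  have hw0 : wl ≠ 0 := by have := hz.lg_le; omega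
  have hsmall := hz.small
  have hn : n ≤ n * (z.D + 1) := Nat.le_mul_of_pos_right _ (by omega)
  refine wp_cons (wp_asg rfl (by simp) ?_)
  simp only [Expr.eval_ofNat]
  refine wp_cons (wp_while
    (fun g h' => Idle A B z g.2 h' ∧ g.1 ≤ n ∧ h'.reg .start = g.1 ∧
      ∀ x : Fin n, x.val < g.1 → x ∈ g.2.disc)
    (fun g : ℕ × Ghost n => 4 * (n - g.1) + g.2.potential A z) rfl ?_ ?_
    (g := ⟨0, ⟨[], ∅, fun _ => 0, [], fun _ => 0, fun _ => 0, 0⟩⟩) ?_ ?_)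
  · intro g h' _
    exact ⟨trivial, trivial⟩
  · rintro ⟨i, g⟩ h' ⟨hg, hi, hst, hd⟩ hc
    simp only [Cond.Holds, Expr.eval_var, hg.fixed.n_eq] at hc hst hd hi hg
    rw [hst] at hc
    have hev : (Expr.var .start : Expr Q).eval ac h' = ((⟨i, hc⟩ : Fin n) : ℕ) := hst
    have hcol : (fld 0 (.var .start) : Expr Q).eval ac h' = g.col ⟨i, hc⟩ := by
      obtain ⟨_, _, hm⟩ := hg.mem
      exact eval_fld hg.fixed hm.col rfl hev
    have hnext : ∀ (h₂ : State) (g₂ : Ghost n) (t : ℕ), Idle A B z g₂ h₂ → h₂.reg .start = i →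
        (∀ x : Fin n, x.val < i + 1 → x ∈ g₂.disc) →
        t + g₂.potential A z ≤ g.potential A z →
        Wp wl (z.bound n) ac (block [asg .start (.var .start + 1)] : Prog Q 36) h₂ fun t' h₃ =>
          ∃ g₃ : ℕ × Ghost n, (Idle A B z g₃.2 h₃ ∧ g₃.1 ≤ n ∧ h₃.reg .start = g₃.1 ∧
            ∀ x : Fin n, x.val < g₃.1 → x ∈ g₃.2.disc) ∧
            t + 1 + t' + 1 + (4 * (n - g₃.1) + g₃.2.potential A z) ≤
              4 * (n - i) + g.potential A z := by
      intro h₂ g₂ t hg₂ hst₂ hd₂ hpot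
      refine wp_cons (wp_asg rfl (by simp [hst₂, hw0]; omega)
        (wp_nil ⟨⟨i + 1, g₂⟩, ⟨?_, hc, ?_, hd₂⟩, ?_⟩))
      · obtain ⟨⟨hf, hse, hco, hout⟩, hemp, hm, hp, hk⟩ := hg₂
        exact ⟨⟨hf.set rfl, hse, hco, hout⟩, hemp, hm, hp, hk⟩
      · simp [hst₂]
      · simp only
        omega
    refine wp_cons (wp_ite rfl ⟨ok_fld hz hg.fixed (Nat.zero_le _) rfl hev (by simp) trivial,
      by simp [Cond.snd]⟩ (fun hc' => ?_) (fun hc' => ?_))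
    · simp only [Cond.Holds, hcol, Expr.eval_ofNat] at hc'
      have hv : (⟨i, hc⟩ : Fin n) ∉ g.disc := fun hd' => by
        have := hg.colored.black _ hd' (by simp [hg.empty])
        omega
      refine Wp.mono (wp_searchFrom hz hin hg hst hv) ?_
      rintro t h₂ ⟨g₂, hg₂, hpot, hsub, hst₂⟩
      refine hnext h₂ g₂ t hg₂ hst₂ (fun x hx => ?_) hpot
      rcases Nat.lt_succ_iff_lt_or_eq.1 hx with h1 | h1
      · exact hsub (Finset.mem_insert_of_mem (hd x h1))
      · exact hsub (by rw [Finset.mem_insert]; exact .inl (Fin.ext h1))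
    · simp only [Cond.Holds, hcol, Expr.eval_ofNat] at hc'
      refine wp_nil (hnext h' g 0 hg hst (fun x hx => ?_) (by omega))
      rcases Nat.lt_succ_iff_lt_or_eq.1 hx with h1 | h1
      · exact hd x h1
      · by_contra hx'
        exact hc' (by rw [← hg.colored.white x hx']; congr 1; exact Fin.ext h1.symm)
  · refine ⟨⟨⟨hf.set rfl, Searching.init A, ?_, ?_⟩, rfl, ⟨fun _ => 0, fun _ => 0, ?_⟩, ?_,
      Nat.zero_le _⟩, Nat.zero_le _, by simp, by simp⟩
    · exact ⟨by simp, by simp, by simp, by simp, by simp⟩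
    · simpa using hout
    · refine ⟨fun v => ?_, fun v => ?_, fun i _ => hmem _, fun i _ => hmem _⟩ <;>
        simp [hmem]
    · simp
  · rintro t ⟨i, g⟩ h' ⟨hg, hi, hst, hd⟩ hc hpot
    simp only [Cond.Holds, Expr.eval_var, hg.fixed.n_eq] at hc hst hd hi hg
    have hrun := hg.searching.run
    rw [hg.empty] at hrun
    refine wp_nil ⟨?_, g.tr, ⟨_, _, hrun, fun v => hd v (by omega)⟩, hg.out⟩
    simp only [Ghost.potential, Finset.card_empty, List.length_nil, Nat.sub_zero] at hpot
    omega

end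

section

variable {n : ℕ} {R : Fin n → Fin n → Prop} {Q : Type}
variable {A : AdjArrays R} {B : AdjArrays fun v u => R u v} {w U : ℕ}
  {ac : Q → ℕ → ℕ → ℕ} {f : DQuery → Q} {h h' : State}

/-! ### The computation of the sizes -/

theorem State.set_comm (h : State) {x y : Var} (hxy : x ≠ y) (a b : ℕ) :
    (h.set x a).set y b = (h.set y b).set x a := by
  simp [State.set, Function.update_comm hxy]

/-- Two steps that update `x` and `y` once more. -/
theorem State.set_set_set (h : State) {x y : Var} (hxy : x ≠ y) (a b c d : ℕ) :
    (((h.set x a).set y b).set x c).set y d = (h.set x c).set y d := by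
  rw [State.set_comm _ hxy.symm, State.set_set, State.set_set]

theorem wp_sizeOf {x y : Var} {e : Expr Q} {v : ℕ} (hxy : x ≠ y) (hw : w ≠ 0)
    (hs : (Cond.lt (.var y) (e + 1)).small = true)
    (he : ∀ a b, e.eval ac ((h.set x a).set y b) = v)
    (hok : ∀ a b, e.Ok w U ac ((h.set x a).set y b)) (hv : 2 * v + 1 < 2 ^ w) :
    Wp w U ac (sizeOf' x y e) h fun t h' => t ≤ 3 * Nat.size v + 3 ∧
      h' = (h.set x (Nat.size v)).set y (2 ^ Nat.size v) := by
  refine wp_cons (wp_asg rfl (by simp) (wp_cons (wp_asg rfl (by simp [hw]) ?_)))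
  simp only [Expr.eval_ofNat]
  refine wp_cons (wp_while (fun i h' => h' = (h.set x i).set y (2 ^ i) ∧ i ≤ Nat.size v)
    (fun i => 3 * (Nat.size v - i)) hs ?_ ?_ (g := 0) ⟨by simp, Nat.zero_le _⟩ ?_)
  · rintro i _ ⟨rfl, hi⟩
    refine ⟨trivial, ?_⟩
    simp only [Cond.snd, Expr.ok_add, Expr.ok_ofNat, Expr.eval_ofNat, he]
    exact ⟨hok _ _, by omega, by omega⟩
  · rintro i _ ⟨rfl, hi⟩ hc
    simp only [Cond.Holds, Expr.eval_var, Expr.eval_add, Expr.eval_ofNat, he, State.set_reg,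
      if_true] at hc
    have hi' : i < Nat.size v := Nat.lt_size.2 (by omega)
    have h1 : i < 2 ^ i := Nat.lt_two_pow_self
    refine wp_cons (wp_asg rfl (by simp [hxy, hw]; omega)
      (wp_cons (wp_asg rfl (by simp [hxy.symm]; omega) (wp_nil ?_))))
    refine ⟨i + 1, ⟨?_, hi'⟩, by omega⟩
    simp [hxy, hxy.symm, State.set_set_set, pow_succ]
  · rintro t i _ ⟨rfl, hi⟩ hc ht
    simp only [Cond.Holds, Expr.eval_var, Expr.eval_add, Expr.eval_ofNat, he, State.set_reg,
      if_true] at hc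
    have hi' : i = Nat.size v := le_antisymm hi (Nat.size_le.2 (by omega))
    subst hi'
    exact wp_nil ⟨by omega, rfl⟩

theorem AdjArrays.deg_le (A : AdjArrays R) (u : ℕ) : A.deg u ≤ n := by
  rw [AdjArrays.deg, AdjArrays.nrow]
  split_ifs with hu
  · rw [List.length_map]
    exact A.length_row_le _
  · exact Nat.zero_le _

theorem AdjArrays.sum_deg_le (A : AdjArrays R) (i : ℕ) : ∑ u ∈ Finset.range i, A.deg u ≤ i * n := by
  simpa using Finset.sum_le_card_nsmul (Finset.range i) _ n fun u _ => A.deg_le u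

/-- The number of entries of all arrays. -/
def AdjArrays.size (A : AdjArrays R) : ℕ := ∑ v, (A.row v).length

theorem AdjArrays.sum_deg (A : AdjArrays R) : ∑ u ∈ Finset.range n, A.deg u = A.size := by
  rw [Finset.sum_range, AdjArrays.size]
  exact Finset.sum_congr rfl fun v _ => A.deg_fin v

theorem wp_countEdges (hin : Input ac f A B) (hw : n * n + n + 1 < 2 ^ w) (hn : h.reg .n = n) :
    Wp w U ac (countEdges f) h fun t h' => t ≤ 3 * n + 3 ∧
      h' = (h.set .total A.size).set .ctr n := by
  refine wp_cons (wp_asg rfl (by simp) (wp_cons (wp_asg rfl (by simp) ?_)))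
  simp only [Expr.eval_ofNat]
  refine wp_cons (wp_while
    (fun i h' => h' = (h.set .total (∑ u ∈ Finset.range i, A.deg u)).set .ctr i ∧ i ≤ n)
    (fun i => 3 * (n - i)) rfl ?_ ?_ (g := 0) ⟨?_, Nat.zero_le _⟩ ?_)
  · rintro i _ ⟨rfl, hi⟩
    exact ⟨trivial, trivial⟩
  · rintro i _ ⟨rfl, hi⟩ hc
    simp only [Cond.Holds, Expr.eval_var, State.set_reg, reduceCtorEq, if_false, if_true,
      hn] at hc
    have h1 := A.sum_deg_le i
    have h2 := A.deg_le i
    have h3 : (i + 1) * n ≤ n * n := Nat.mul_le_mul_right _ hc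
    rw [Nat.succ_mul] at h3
    refine wp_cons (wp_asg rfl ?_ (wp_cons (wp_asg rfl ?_ (wp_nil ?_))))
    · simp [hin.outDeg]
      omega
    · simp only [Expr.ok_add, Expr.ok_var, Expr.ok_ofNat, Expr.eval_var, Expr.eval_ofNat,
        State.set_reg, reduceCtorEq, if_false, if_true]
      exact ⟨trivial, by omega, by omega⟩
    refine ⟨i + 1, ⟨?_, hc⟩, by omega⟩
    simp [hin.outDeg, State.set_set_set, Finset.sum_range_succ]
  · rw [State.set_comm _ (by decide)]
    simp
  · rintro t i _ ⟨rfl, hi⟩ hc ht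
    simp only [Cond.Holds, Expr.eval_var, State.set_reg, reduceCtorEq, if_false, if_true,
      hn] at hc
    have hi' : i = n := by omega
    subst hi'
    exact wp_nil ⟨by omega, by rw [A.sum_deg]⟩

/-- The sizes for `n` vertices and arrays with `M` entries in total. A full word has about `logb 2
n` bits, and `D` is the logarithm of the average degree, so that all entries on the stack together
have at most `n * (D + 1)` bits. The fields of packed arrays are wide enough for `D + 6` colors.
-/
def sizes (n M : ℕ) : Sizes where
  bits := Nat.size (Nat.size (M / n + 2) + 5)
  per := Nat.size n / Nat.size (Nat.size (M / n + 2) + 5) + 1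
  D := Nat.size (M / n + 2)
  q := n / Nat.size n + 1
  lg := Nat.size n

section bounds

variable {M : ℕ}

theorem one_le_size (hn : 1 ≤ n) : 1 ≤ Nat.size n := Nat.size_pos.2 hn

theorem size_lt_two_pow (n : ℕ) : Nat.size n < 2 ^ Nat.size n := Nat.lt_two_pow_self

theorem D_le (hn : 1 ≤ n) (hM : M ≤ n * n) : (sizes n M).D ≤ Nat.size n + 2 := by
  have h1 : M / n ≤ n := Nat.div_le_of_le_mul hM
  have h2 := Nat.lt_size_self n
  refine Nat.size_le.2 ?_
  rw [pow_add]
  have h3 : M / n + 2 ≤ n + 2 := by omega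
  omega

theorem bits_le (hn : 1 ≤ n) (hM : M ≤ n * n) : (sizes n M).bits ≤ Nat.size n + 3 := by
  have h1 := D_le hn hM
  have h2 := size_lt_two_pow n
  refine Nat.size_le.2 ?_
  rw [pow_add]
  have h3 : Nat.size (M / n + 2) ≤ Nat.size n + 2 := h1
  omega

/-- The word length leaves room for products of numbers of the order of `n`. -/
theorem two_pow_ge (n : ℕ) (hn : 1 ≤ n) :
    256 * (2 ^ Nat.size n * 2 ^ Nat.size n) ≤ 2 ^ (10 * Nat.size n) := by
  have h1 := one_le_size hn
  calc 256 * (2 ^ Nat.size n * 2 ^ Nat.size n) = 2 ^ (8 + (Nat.size n + Nat.size n)) := by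
        rw [pow_add, pow_add]; norm_num
    _ ≤ _ := Nat.pow_le_pow_right (by norm_num) (by omega)

/-- Double counting of the edges. -/
theorem size_eq (A : AdjArrays R) (B : AdjArrays fun v u => R u v) : A.size = B.size := by
  classical
  have h1 : ∀ u, (A.row u).length = (Finset.univ.bipartiteAbove R u).card := by
    intro u
    rw [← List.toFinset_card_of_nodup (A.nodup u)]
    congr 1
    ext v
    simp [A.mem_iff]
  have h2 : ∀ v, (B.row v).length = (Finset.univ.bipartiteBelow R v).card := by
    intro v
    rw [← List.toFinset_card_of_nodup (B.nodup v)]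
    congr 1
    ext u
    simp [B.mem_iff]
  simp only [AdjArrays.size, h1, h2]
  exact Finset.sum_card_bipartiteAbove_eq_sum_card_bipartiteBelow _

theorem AdjArrays.size_le (A : AdjArrays R) : A.size ≤ n * n := by
  simpa [AdjArrays.size] using
    Finset.sum_le_card_nsmul Finset.univ _ n fun v _ => A.length_row_le v

/-- The weights are small on average, since the sum of all indegrees is the number of entries. -/
theorem sum_weight_le (A : AdjArrays R) (B : AdjArrays fun v u => R u v) (hn : 1 ≤ n) :
    ∑ v, weight B (sizes n A.size).D v ≤ n * ((sizes n A.size).D + 1) := by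
  have h1 : A.size / n + 2 < 2 ^ (sizes n A.size).D := Nat.lt_size_self _
  have h2 : A.size < n * (A.size / n + 1) := Nat.lt_mul_div_succ _ hn
  set D := (sizes n A.size).D
  have h3 : (∑ v, ((B.row v).length + 1) / 2 ^ D) * 2 ^ D ≤ n * 2 ^ D := by
    calc (∑ v, ((B.row v).length + 1) / 2 ^ D) * 2 ^ D
        = ∑ v, ((B.row v).length + 1) / 2 ^ D * 2 ^ D := Finset.sum_mul ..
      _ ≤ ∑ v, ((B.row v).length + 1) := Finset.sum_le_sum fun v _ => Nat.div_mul_le_self _ _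
      _ = A.size + n := by rw [Finset.sum_add_distrib, size_eq A B]; simp [AdjArrays.size]
      _ ≤ n * (A.size / n + 2) := by rw [Nat.mul_add] at *; omega
      _ ≤ n * 2 ^ D := Nat.mul_le_mul_left _ h1.le
  have h4 := Nat.le_of_mul_le_mul_right h3 (by positivity)
  simp only [weight, Finset.sum_add_distrib, Finset.sum_const, Finset.card_univ, Fintype.card_fin,
    smul_eq_mul, Nat.mul_add, mul_one]
  omega

theorem per_mul_bits_le (n M : ℕ) :
    (sizes n M).per * (sizes n M).bits ≤ Nat.size n + (sizes n M).bits := by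
  change (Nat.size n / (sizes n M).bits + 1) * (sizes n M).bits ≤ _
  rw [Nat.succ_mul]
  exact Nat.add_le_add_right (Nat.div_mul_le_self _ _) _

theorem bound_le (hn : 1 ≤ n) (hM : M ≤ n * n) :
    (sizes n M).bound n ≤ 4 * n + Nat.size n + 8 := by
  have h1 := D_le hn hM
  have h2 : n / (sizes n M).per ≤ n := Nat.div_le_self _ _
  have h3 : n / Nat.size n ≤ n := Nat.div_le_self _ _
  have h4 : (sizes n M).bound n = 2 * (n / (sizes n M).per + 1) + 2 * (n / Nat.size n + 1) +
    (sizes n M).D + 2 := rfl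
  omega

theorem sizes_valid (A : AdjArrays R) (B : AdjArrays fun v u => R u v) (hn : 1 ≤ n) :
    (sizes n A.size).Valid (10 * Nat.size n) B := by
  have hM := A.size_le
  have h1 := one_le_size hn
  have h2 := Nat.lt_size_self n
  have h3 := size_lt_two_pow n
  have h4 := D_le hn hM
  have h5 := bits_le hn hM
  have h6 := two_pow_ge n hn
  have h7 := per_mul_bits_le n A.size
  have h8 := bound_le hn hM
  have h9 : 2 ^ Nat.size n ≤ 2 ^ Nat.size n * 2 ^ Nat.size n :=
    Nat.le_mul_of_pos_left _ (by positivity)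
  have h10 : n * ((sizes n A.size).D + 1) ≤
      2 ^ Nat.size n * 2 ^ Nat.size n + 2 ^ Nat.size n * 2 :=
    (Nat.mul_le_mul h2.le (by omega)).trans_eq (Nat.mul_add ..)
  exact ⟨Nat.succ_pos _, h1, Nat.size_pos.2 (Nat.succ_pos _), h2,
    by rw [mul_comm]; exact (Nat.lt_mul_div_succ _ h1).le, sum_weight_le A B hn,
    Nat.lt_size_self _, by omega, by omega, Nat.succ_pos _,
    by change 2 * Nat.size n + 1 ≤ _; omega, by omega, by omega⟩

end bounds

/-- The sizes are computed in linear time without use of the memory. -/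
theorem wp_setup (hin : Input ac f A B) (hn1 : 1 ≤ n) (hn : h.reg .n = n) :
    Wp (10 * Nat.size n) U ac (setup f) h fun t h' => t ≤ 12 * n + 50 ∧
      Fixed (sizes n A.size) n h' ∧ h'.mem = h.mem ∧ h'.out = h.out := by
  have hM := A.size_le
  have h1 := one_le_size hn1
  have h2 := Nat.lt_size_self n
  have h3 := size_lt_two_pow n
  have h4 := D_le hn1 hM
  have h5 := bits_le hn1 hM
  have h6 := two_pow_ge n hn1
  have h9 : 2 ^ Nat.size n ≤ 2 ^ Nat.size n * 2 ^ Nat.size n :=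
    Nat.le_mul_of_pos_left _ (by positivity)
  have h10 : n * n ≤ 2 ^ Nat.size n * 2 ^ Nat.size n := Nat.mul_le_mul h2.le h2.le
  have h11 : Nat.size n ≤ n := Nat.size_le.2 Nat.lt_two_pow_self
  have h12 : A.size / n ≤ n := Nat.div_le_of_le_mul hM
  have h13 : 2 ^ (sizes n A.size).bits ≤ 8 * 2 ^ Nat.size n := by
    calc _ ≤ 2 ^ (Nat.size n + 3) := Nat.pow_le_pow_right (by norm_num) h5
      _ = _ := by rw [pow_add]; ring
  have hw : 10 * Nat.size n ≠ 0 := by omega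
  have h14 : Nat.size n / (sizes n A.size).bits ≤ Nat.size n := Nat.div_le_self _ _
  have h15 : n / (sizes n A.size).per ≤ n := Nat.div_le_self _ _
  have h16 : n / Nat.size n ≤ n := Nat.div_le_self _ _
  set w := 10 * Nat.size n
  refine wp_cons (Wp.mono (wp_countEdges hin (by omega) hn) ?_)
  rintro t₁ _ ⟨ht₁, rfl⟩
  refine wp_cons (Wp.mono (wp_sizeOf (v := n) (by decide) hw rfl (by simp [hn]) (by simp)
    (by omega)) ?_)
  rintro t₂ _ ⟨ht₂, rfl⟩
  refine wp_cons (wp_asg rfl (by simp; omega) ?_)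
  refine wp_cons (Wp.mono (wp_sizeOf (v := A.size / n + 2) (by decide) hw rfl (by simp [hn])
    (by simp [hn]; omega) (by omega)) ?_)
  rintro t₃ _ ⟨ht₃, rfl⟩
  have hD : Nat.size (A.size / n + 2) = (sizes n A.size).D := rfl
  rw [hD] at ht₃ ⊢
  refine wp_cons (Wp.mono (wp_sizeOf (v := (sizes n A.size).D + 5) (by decide) hw rfl (by simp)
    (by simp; omega) (by omega)) ?_)
  rintro t₄ _ ⟨ht₄, rfl⟩
  have hb : Nat.size ((sizes n A.size).D + 5) = (sizes n A.size).bits := rfl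
  rw [hb] at ht₄ ⊢
  have hp : Nat.size n / (sizes n A.size).bits + 1 = (sizes n A.size).per := rfl
  refine wp_cons (wp_asg rfl (by simp [hw]; omega) (wp_cons (wp_asg rfl ?_
    (wp_cons (wp_asg rfl ?_ (wp_cons (wp_asg rfl ?_ (wp_cons (wp_asg rfl ?_ (wp_nil ?_))))))))))
  · simp [hn, hw, hp]
    omega
  · simp [hn, hw]
    omega
  · simp [hn, hp]
    omega
  · simp [hn, hp]
    omega
  · refine ⟨by omega, ?_, rfl, rfl⟩
    intro x hx
    cases x <;> first | (exact absurd hx (by decide)) | skip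
    all_goals simp [Sizes.val, Sizes.trlB, Sizes.bufB, Sizes.grpB, hn, hp, pow_succ]
    all_goals rfl

end

section

variable {n : ℕ} {R : Fin n → Fin n → Prop} {Q : Type}
variable {A : AdjArrays R} {B : AdjArrays fun v u => R u v}
  {ac : Q → ℕ → ℕ → ℕ} {f : DQuery → Q}

/-! ### Time and space -/

/-- At the start, all variables except `n` and all words of the memory are 0. -/
theorem rel_init {U : ℕ} (n : ℕ) :
    Rel (10 * Nat.size n) U ⟨fun x => if x = .n then n else 0, fun _ => 0, []⟩
      (initConfig 36 (10 * Nat.size n) n) := by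
  have hlt : n < 2 ^ (10 * Nat.size n) :=
    (Nat.lt_size_self n).trans_le (Nat.pow_le_pow_right (by norm_num) (by omega))
  refine ⟨fun x => ?_, rfl, rfl, Nat.zero_le _, fun r => ?_, fun a => ?_⟩
  · simp only [initConfig, Nat.mod_eq_of_lt hlt]
    have : x.loc.val = 0 ↔ x = .n := by cases x <;> decide
    simp [this]
  · simp only [initConfig]
    split_ifs
    · exact Nat.mod_lt _ (by positivity)
    · positivity
  · simp only [initConfig]
    positivity

/-- The program carries out a depth-first search, with explicit bounds for time and space. -/
theorem exec_dfs (hin : Input ac f A B) (hn : 1 ≤ n) :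
    ∃ (t : ℕ) (s : Config 36) (tr : List (Event (Fin n))),
      Exec (10 * Nat.size n) ac (dfs f) (initConfig 36 (10 * Nat.size n) n) t s ∧ IsDFS R tr ∧
      s.out = tr.map (Event.map Fin.val) ∧
      t ≤ 64 * (10 * A.size + 66 * n + 52 +
        restoreCost A (sizes n A.size).D * ((sizes n A.size).D + 3)) ∧
      s.used ≤ (sizes n A.size).bound n := by
  have hz := sizes_valid A B hn
  have hw : Wp (10 * Nat.size n) ((sizes n A.size).bound n) ac (dfs f)
      ⟨fun x => if x = .n then n else 0, fun _ => 0, []⟩ fun t h' =>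
        t ≤ 10 * A.size + 66 * n + 52 +
          restoreCost A (sizes n A.size).D * ((sizes n A.size).D + 3) ∧
        ∃ tr, IsDFS R tr ∧ h'.out = tr.map (Event.map Fin.val) := by
    refine wp_seq (Wp.mono (wp_setup hin hn (by simp)) ?_)
    rintro t h ⟨ht, hf, hm, ho⟩
    refine Wp.mono (wp_searchAll hz hin hf (fun p => by rw [hm]) ho) ?_
    rintro t' h' ⟨ht', hr⟩
    rw [← AdjArrays.size] at ht'
    exact ⟨by omega, hr⟩
  obtain ⟨t, h', he, ht, tr, htr, ho⟩ := hw
  obtain ⟨t', ht', c, hc, hr⟩ := he _ (rel_init n)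
  exact ⟨t', c, tr, hc, htr, hr.out.trans ho, by omega, hr.used⟩

theorem D_le_div (n M : ℕ) : (sizes n M).D ≤ M / n + 2 := Nat.size_le.2 Nat.lt_two_pow_self

/-- All restorations together take linear time. A restoration takes time `O(n + M / D)`, since at
each vertex it only searches a group of positions, and the number of restorations is `O(D)`, where
`n * D` is at most `M + 2 * n`. -/
theorem restoreCost_mul_le (A : AdjArrays R) (hn : 1 ≤ n) :
    restoreCost A (sizes n A.size).D * ((sizes n A.size).D + 3) ≤ 140 * A.size + 264 * n := by
  have hD : 1 ≤ (sizes n A.size).D := Nat.size_pos.2 (Nat.succ_pos _)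
  have hnD : n * (sizes n A.size).D ≤ A.size + 2 * n := by
    calc _ ≤ n * (A.size / n + 2) := Nat.mul_le_mul_left _ (D_le_div _ _)
      _ = n * (A.size / n) + 2 * n := by ring
      _ ≤ _ := Nat.add_le_add_right (Nat.mul_div_le _ _) _
  generalize (sizes n A.size).D = D at *
  have hs : (∑ v, (A.row v).length / D) * D ≤ A.size := by
    rw [Finset.sum_mul]
    exact Finset.sum_le_sum fun v _ => Nat.div_mul_le_self _ _
  have hr : restoreCost A D ≤ 2 * ∑ v, (A.row v).length / D + 33 * n := by
    simp only [restoreCost, climbCost, gsize, Finset.sum_add_distrib, ← Finset.mul_sum,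
      Finset.sum_const, Finset.card_univ, Fintype.card_fin, smul_eq_mul]
    omega
  calc restoreCost A D * (D + 3) ≤ (2 * ∑ v, (A.row v).length / D + 33 * n) * (4 * D) :=
        Nat.mul_le_mul hr (by omega)
    _ = 8 * ((∑ v, (A.row v).length / D) * D) + 132 * (n * D) := by ring
    _ ≤ _ := by omega

/-- This takes care of the `O(logb 2 n)` words for trailers. -/
theorem sq_size_le (hn : 1 ≤ n) : Nat.size n * Nat.size n ≤ 4 * n := by
  have h1 : ∀ k : ℕ, k * k ≤ 2 * 2 ^ k := by
    intro k
    induction k with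
    | zero => simp
    | succ k ih =>
      have h2 : k < 2 ^ k := Nat.lt_two_pow_self
      rw [pow_succ]
      nlinarith
  obtain ⟨l, hl⟩ : ∃ l, Nat.size n = l + 1 := ⟨Nat.size n - 1, by have := one_le_size hn; omega⟩
  have h2 : 2 ^ l ≤ n := Nat.lt_size.1 (by omega)
  have h3 := h1 (Nat.size n)
  have h4 : 2 ^ Nat.size n = 2 ^ l * 2 := by rw [hl, pow_succ]
  omega

/-- The packed arrays take `O(n)` fields, the circular buffer takes `O(n / logb 2 n)` words, and the
other words are few. -/
theorem space_le {M : ℕ} (hn : 1 ≤ n) (hM : M ≤ n * n) :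
    (36 + (sizes n M).bound n) * Nat.size n ≤ 52 * (n * (sizes n M).bits) := by
  have h1 := sq_size_le hn
  have h2 : Nat.size n ≤ n := Nat.size_le.2 Nat.lt_two_pow_self
  have h3 : (sizes n M).D * Nat.size n ≤ (Nat.size n + 2) * Nat.size n :=
    Nat.mul_le_mul_right _ (D_le hn hM)
  have h4 : n / Nat.size n * Nat.size n ≤ n := Nat.div_mul_le_self _ _
  have hb : 1 ≤ (sizes n M).bits := Nat.size_pos.2 (Nat.succ_pos _)
  have h5 : n / (sizes n M).per * Nat.size n ≤ n * (sizes n M).bits := by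
    calc _ ≤ n / (sizes n M).per * ((sizes n M).bits * (sizes n M).per) :=
          Nat.mul_le_mul_left _ (Nat.lt_mul_div_succ _ hb).le
      _ = n / (sizes n M).per * (sizes n M).per * (sizes n M).bits := by ring
      _ ≤ _ := Nat.mul_le_mul_right _ (Nat.div_mul_le_self _ _)
  have h6 : n ≤ n * (sizes n M).bits := Nat.le_mul_of_pos_right _ hb
  have h7 : (36 + (sizes n M).bound n) * Nat.size n = 2 * (n / (sizes n M).per * Nat.size n) +
      2 * (n / Nat.size n * Nat.size n) + (sizes n M).D * Nat.size n + 42 * Nat.size n := by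
    change (36 + (2 * (n / (sizes n M).per + 1) + 2 * (n / Nat.size n + 1) + (sizes n M).D + 2)) *
      Nat.size n = _
    ring
  rw [Nat.add_mul] at h3
  omega

theorem size_le_logb {a : ℕ} (ha : 1 ≤ a) : (Nat.size a : ℝ) ≤ Real.logb 2 a + 1 := by
  obtain ⟨l, hl⟩ : ∃ l, Nat.size a = l + 1 := ⟨Nat.size a - 1, by have := one_le_size ha; omega⟩
  have h1 : 2 ^ l ≤ a := Nat.lt_size.1 (by omega)
  have h2 : (l : ℝ) ≤ Real.logb 2 a := by
    rw [Real.le_logb_iff_rpow_le (by norm_num) (by exact_mod_cast ha), Real.rpow_natCast]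
    exact_mod_cast h1
  rw [hl]
  push_cast
  linarith

/-- A field has doubly logarithmic width in the average degree. -/
theorem bits_le_logb {M m : ℕ} (hn : 1 ≤ n) (hM : M ≤ 2 * m) :
    ((sizes n M).bits : ℝ) ≤ 5 * Real.logb 2 (Real.logb 2 (4 + (m : ℝ) / n)) := by
  have hn' : (0 : ℝ) < n := by exact_mod_cast hn
  set x : ℝ := 4 + (m : ℝ) / n with hx
  have hx4 : 4 ≤ x := by
    have : (0 : ℝ) ≤ (m : ℝ) / n := by positivity
    linarith
  have hl2 : 2 ≤ Real.logb 2 x := by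
    rw [Real.le_logb_iff_rpow_le (by norm_num) (by linarith)]
    norm_num
    exact hx4
  have hll : 1 ≤ Real.logb 2 (Real.logb 2 x) := by
    rw [Real.le_logb_iff_rpow_le (by norm_num) (by linarith)]
    norm_num
    exact hl2
  have h1 : ((M / n + 2 : ℕ) : ℝ) ≤ 2 * x := by
    have h2 : ((M / n : ℕ) : ℝ) ≤ (M : ℝ) / n := Nat.cast_div_le
    have h3 : (M : ℝ) / n ≤ 2 * ((m : ℝ) / n) := by
      rw [← mul_div_assoc]
      exact div_le_div_of_nonneg_right (by exact_mod_cast hM) hn'.le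
    push_cast
    linarith
  have hD : ((sizes n M).D : ℝ) ≤ Real.logb 2 x + 2 := by
    have h2 : ((sizes n M).D : ℝ) ≤ Real.logb 2 ((M / n + 2 : ℕ) : ℝ) + 1 :=
      size_le_logb (Nat.succ_pos _)
    have h3 : Real.logb 2 ((M / n + 2 : ℕ) : ℝ) ≤ Real.logb 2 (2 * x) :=
      Real.logb_le_logb_of_le (by norm_num) (by positivity) h1
    rw [Real.logb_mul (by norm_num) (by linarith), Real.logb_self_eq_one (by norm_num)] at h3
    linarith
  have h4 : ((sizes n M).bits : ℝ) ≤ Real.logb 2 (((sizes n M).D + 5 : ℕ) : ℝ) + 1 :=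
    size_le_logb (Nat.succ_pos _)
  have h5 : Real.logb 2 (((sizes n M).D + 5 : ℕ) : ℝ) ≤ Real.logb 2 (2 ^ 3 * Real.logb 2 x) := by
    refine Real.logb_le_logb_of_le (by norm_num) (by positivity) ?_
    push_cast
    linarith
  rw [Real.logb_mul (by norm_num) (by linarith), Real.logb_pow,
    Real.logb_self_eq_one (by norm_num)] at h5
  push_cast at h4 h5
  linarith

/-- The bounds in terms of the number `m` of edges; an undirected edge has two array entries. -/
theorem carriesOutDFS_dfs (hin : Input ac f A B) (hn : 1 ≤ n) {m : ℕ} (hm : A.size ≤ 2 * m) :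
    CarriesOutDFS (dfs f) (10 * Nat.size n) ac R (100000 * ((n : ℝ) + m))
      (100000 * ((n : ℝ) * Real.logb 2 (Real.logb 2 (4 + (m : ℝ) / n)))) := by
  obtain ⟨t, s, tr, he, htr, ho, ht, hs⟩ := exec_dfs hin hn
  have h1 := restoreCost_mul_le A hn
  have h2 : t ≤ 100000 * (n + m) := by omega
  have h3 := space_le hn A.size_le
  have h4 := bits_le_logb hn hm
  have h5 : (36 + s.used) * (10 * Nat.size n) ≤ 520 * (n * (sizes n A.size).bits) := by
    calc _ ≤ (36 + (sizes n A.size).bound n) * (10 * Nat.size n) :=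
          Nat.mul_le_mul_right _ (by omega)
      _ = 10 * ((36 + (sizes n A.size).bound n) * Nat.size n) := by ring
      _ ≤ _ := by omega
  refine ⟨t, s, tr, he, htr, ho, by exact_mod_cast h2, ?_⟩
  have h6 : (((36 + s.used) * (10 * Nat.size n) : ℕ) : ℝ) ≤
      520 * (n * (sizes n A.size).bits) := by exact_mod_cast h5
  have h7 : (n : ℝ) * (sizes n A.size).bits ≤
      n * (5 * Real.logb 2 (Real.logb 2 (4 + (m : ℝ) / n))) :=
    mul_le_mul_of_nonneg_left h4 (Nat.cast_nonneg _)
  have h8 : 0 ≤ (n : ℝ) * (sizes n A.size).bits := by positivity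
  linarith

/-! ### Undirected and directed graphs -/

theorem size_eq_ncard (A : AdjArrays R) : A.size = {e : Fin n × Fin n | R e.1 e.2}.ncard := by
  classical
  have h1 : ∀ u, (A.row u).length = (Finset.univ.filter (R u)).card := by
    intro u
    rw [← List.toFinset_card_of_nodup (A.nodup u)]
    congr 1
    ext v
    simp [A.mem_iff]
  rw [Set.ncard_eq_toFinset_card']
  simp only [AdjArrays.size, h1, Finset.card_filter, Set.toFinset_ofPred,
    Fintype.sum_prod_type]

theorem size_eq_two_mul {G : SimpleGraph (Fin n)} (A : AdjArrays G.Adj) :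
    A.size = 2 * G.edgeSet.ncard := by
  classical
  rw [Set.ncard_eq_toFinset_card', ← SimpleGraph.edgeFinset, ← G.sum_degrees_eq_twice_card_edges]
  refine Finset.sum_congr rfl fun u _ => ?_
  rw [← List.toFinset_card_of_nodup (A.nodup u), ← G.card_neighborFinset_eq_degree]
  congr 1
  ext v
  simp [A.mem_iff]

/-- In an undirected graph, the neighbors of a vertex are both its outneighbors and its
inneighbors. -/
def undirected : DQuery → UQuery
  | .outDeg | .inDeg => .deg
  | .outHead | .inHead => .head
  | .outMate | .inMate => .mate

/-- The arrays of an undirected graph, considered as arrays of inneighbors. -/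
def AdjArrays.swap {G : SimpleGraph (Fin n)} (A : AdjArrays G.Adj) :
    AdjArrays fun v u => G.Adj u v where
  row := A.row
  nodup := A.nodup
  mem_iff u v := (A.mem_iff u v).trans (G.adj_comm u v)

theorem input_uAccess {G : SimpleGraph (Fin n)} (A : AdjArrays G.Adj) :
    Input (uAccess A) undirected A A.swap :=
  ⟨fun _ _ => rfl, fun _ _ => rfl, fun _ _ => rfl, fun _ _ => rfl, fun _ _ => rfl, fun _ _ => rfl⟩

theorem input_dAccess {G : Digraph (Fin n)} (A : AdjArrays G.Adj)
    (B : AdjArrays fun v u => G.Adj u v) : Input (dAccess A B) id A B :=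
  ⟨fun _ _ => rfl, fun _ _ => rfl, fun _ _ => rfl, fun _ _ => rfl, fun _ _ => rfl, fun _ _ => rfl⟩

end

end SpaceDFS

theorem mainTheorem3 :
    (∃ (k κ : ℕ) (p : SpaceDFS.Prog SpaceDFS.UQuery k) (C : ℝ), 1 ≤ κ ∧
      ∀ (n : ℕ) (_hn : 1 ≤ n) (G : SimpleGraph (Fin n)) (A : SpaceDFS.AdjArrays G.Adj) (m : ℕ)
        (_hm : m = G.edgeSet.ncard),
        SpaceDFS.CarriesOutDFS p (κ * Nat.size n) (SpaceDFS.uAccess A) G.Adj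
          (C * ((n : ℝ) + (m : ℝ)))
          (C * ((n : ℝ) * Real.logb 2 (Real.logb 2 (4 + (m : ℝ) / (n : ℝ)))))) ∧
    (∃ (k κ : ℕ) (p : SpaceDFS.Prog SpaceDFS.DQuery k) (C : ℝ), 1 ≤ κ ∧
      ∀ (n : ℕ) (_hn : 1 ≤ n) (G : Digraph (Fin n)) (A : SpaceDFS.AdjArrays G.Adj)
        (B : SpaceDFS.AdjArrays (fun v u => G.Adj u v)) (m : ℕ)
        (_hm : m = {e : Fin n × Fin n | G.Adj e.1 e.2}.ncard),
        SpaceDFS.CarriesOutDFS p (κ * Nat.size n) (SpaceDFS.dAccess A B) G.Adj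
          (C * ((n : ℝ) + (m : ℝ)))
          (C * ((n : ℝ) * Real.logb 2 (Real.logb 2 (4 + (m : ℝ) / (n : ℝ)))))) := by
  refine ⟨⟨36, 10, SpaceDFS.dfs SpaceDFS.undirected, 100000, by norm_num, ?_⟩,
    ⟨36, 10, SpaceDFS.dfs id, 100000, by norm_num, ?_⟩⟩
  · intro n hn G A m hm
    refine SpaceDFS.carriesOutDFS_dfs (SpaceDFS.input_uAccess A) hn ?_
    rw [SpaceDFS.size_eq_two_mul, hm]
  · intro n hn G A B m hm
    refine SpaceDFS.carriesOutDFS_dfs (SpaceDFS.input_dAccess A B) hn ?_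
    rw [SpaceDFS.size_eq_ncard, hm]
    omega
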